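/- Let $\mu>0$ and let $\Phi:\mathbb R_+\to\mathbb R_+$ be measurable with $\|\Phi\|_1=\int_0^\infty\Phi(t)\,dt<1$. Set $\Phi_1:=\Phi$, $\Phi_{n}(t):=\int_0^t\Phi(t-s)\Phi_{n-1}(s)\,ds$ for $n\ge 2$, and $\Psi:=\sum_{n\ge1}\Phi_n$. Let $N$ be a Poisson random measure on $\mathbb R_+\times\mathbb R_+$ with intensity the Lebesgue measure $dt\,d\theta$, and let $\lambda=(\lambda_t)_{t\ge0}$ be the Hawkes intensity with parameters $(\mu,\Phi)$ driven by $N$, that is, a nonnegative process, predictable for the natural filtration of $N$, such that almost surely $$\lambda_t=\mu+\int_{(0,t)\times\mathbb R_+}\Phi(t-s)\,\mathbf 1_{\{\theta\le\lambda_s\}}\,N(ds,d\theta),\qquad t\ge0,$$ and such that $H_t:=\int_{(0,t]\times\mathbb R_+}\mathbf 1_{\{\theta\le\lambda_s\}}N(ds,d\theta)$ is a counting process (almost surely finite for all $t\ge 0$). For $\zeta\equiv\Phi$ or $\zeta\equiv1$ put $$X^\zeta_t:=\int_{(0,t)\times\mathbb R_+}\zeta(t-s)\,\mathbf 1_{\{\theta\le\lambda_s\}}\,N(ds,d\theta),\qquad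 t\ge0$$ (so that, for each $t$, almost surely $X^1_t=H_t$ and $X^\Phi_t=\lambda_t-\mu$). All expectations and integrals below are those of nonnegative quantities, and the identities hold in $[0,+\infty]$. (i) For every $s\ge0$, $$\mathbb E[X^1_s]=\mu s+\mu\int_0^s\!\int_0^u\Psi(r)\,dr\,du,\qquad \mathbb E[X^\Phi_s]=\mu\int_0^s\Psi(u)\,du,$$ and both are finite. (ii) For $0\le s\le t$ and $\zeta\equiv\Phi$ or $\zeta\equiv1$, $$\begin{aligned}\mathbb E[X^\Phi_sX^\zeta_t]={}&\mathbb E[X^\Phi_s]\,\mathbb E[X^\zeta_t]+\mu\int_0^s\zeta(t-v)\Psi(s-v)\Big(1+\int_0^v\Psi(w)\,dw\Big)dv\\&+\mu\int_0^t\!\int_0^{s\wedge u}\zeta(t-u)\Psi(u-v)\Psi(s-v)\Big(1+\int_0^v\Psi(v-w)\,dw\Big)dv\,du,\end{aligned}$$ $$\begin{aligned}\mathbb E[X^1_sX^\zeta_t]={}&\mathbb E[X^1_s]\,\mathbb E[X^\zeta_t]+\mu\int_0^s\zeta(t-u)\Big(1+\int_u^s\Psi(y-u)\,dy\Big)\Big(1+\int_0^u\Psi(w)\,dw\Big)du\\&+\mu\int_0^t\!\int_0^{s\wedge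 u}\zeta(t-u)\Psi(u-v)\Big(1+\int_0^v\Psi(w)\,dw\Big)\Big(1+\int_v^s\Psi(y-v)\,dy\Big)dv\,du.\end{aligned}$$ The second expectation is always finite; the first is finite if $\zeta\equiv1$ or if $\int_0^t\Phi(u)^2\,du<\infty$. -/

import Mathlib

open MeasureTheory ProbabilityTheory
open scoped NNReal ENNReal

noncomputable section

/-- Lebesgue measure on `ℝ₊ = [0, ∞)`. The measure on `ℝ₊ × ℝ₊` is then the product measure. -/
instance instMeasureSpaceNNReal : MeasureSpace ℝ≥0 where
  volume := ((volume : Measure ℝ).restrict (Set.Ici 0)).map Real.toNNReal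

/-- `N` is a Poisson random measure on `ℝ₊ × ℝ₊` whose intensity is Lebesgue measure
`dt dθ`: it is a measurable map into the space of measures, `N(A)` is Poisson distributed with
parameter `|A|` for every Borel set `A` of finite Lebesgue measure, and the values of `N` on
finitely many pairwise disjoint Borel sets are independent. -/
structure IsPoissonRandomMeasure {Ω : Type*} [MeasurableSpace Ω] (P : Measure Ω)
    (N : Ω → Measure (ℝ≥0 × ℝ≥0)) : Prop where
  measurable : Measurable N
  law : ∀ A : Set (ℝ≥0 × ℝ≥0), MeasurableSet A → volume A ≠ ∞ →
    P.map (fun ω => N ω A) =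
      (poissonMeasure (volume A).toNNReal).map (fun n : ℕ => (n : ℝ≥0∞))
  indep : ∀ (k : ℕ) (A : Fin k → Set (ℝ≥0 × ℝ≥0)), (∀ i, MeasurableSet (A i)) →
    Pairwise (fun i j => Disjoint (A i) (A j)) → iIndepFun (fun i ω => N ω (A i)) P

/-- The natural history `𝓕ᴺ` of `N`: `𝓕ᴺ t` is generated by the variables `N (T × B)` with
`T ⊆ [0, t]` and `B ⊆ ℝ₊` Borel sets. -/
def naturalHistory {Ω : Type*} [mΩ : MeasurableSpace Ω] (N : Ω → Measure (ℝ≥0 × ℝ≥0))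
    (hN : Measurable N) : Filtration ℝ≥0 mΩ where
  seq t := ⨆ (T : Set ℝ≥0) (B : Set ℝ≥0) (_ : MeasurableSet T) (_ : MeasurableSet B)
    (_ : T ⊆ Set.Iic t), MeasurableSpace.comap (fun ω => N ω (T ×ˢ B)) inferInstance
  mono' := by
    intro s t hst
    refine iSup_mono fun T => iSup_mono fun B => iSup_mono fun _ => iSup_mono fun _ => ?_
    exact iSup_le fun h => le_iSup_of_le (h.trans (Set.Iic_subset_Iic.2 hst)) le_rfl
  le' := by
    intro t
    refine iSup_le fun T => iSup_le fun B => iSup_le fun hT => iSup_le fun hB =>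
      iSup_le fun _ => ?_
    exact ((Measure.measurable_coe (hT.prod hB)).comp hN).comap_le

/-- `X^ζ_t = ∫_{(0,t) × ℝ₊} ζ(t - s) 1_{θ ≤ λ_s} N(ds, dθ)`, the integrand being nonnegative. -/
def hawkesX {Ω : Type*} (N : Ω → Measure (ℝ≥0 × ℝ≥0)) (lam : ℝ≥0 → Ω → ℝ≥0)
    (ζ : ℝ≥0 → ℝ≥0) (t : ℝ≥0) (ω : Ω) : ℝ≥0∞ :=
  ∫⁻ x in Set.Ioo 0 t ×ˢ Set.univ,
    {x : ℝ≥0 × ℝ≥0 | x.2 ≤ lam x.1 ω}.indicator (fun x => (ζ (t - x.1) : ℝ≥0∞)) x ∂(N ω)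

/-- `H_t = ∫_{(0,t] × ℝ₊} 1_{θ ≤ λ_s} N(ds, dθ)`. -/
def hawkesH {Ω : Type*} (N : Ω → Measure (ℝ≥0 × ℝ≥0)) (lam : ℝ≥0 → Ω → ℝ≥0)
    (t : ℝ≥0) (ω : Ω) : ℝ≥0∞ :=
  ∫⁻ x in Set.Ioc 0 t ×ˢ Set.univ,
    {x : ℝ≥0 × ℝ≥0 | x.2 ≤ lam x.1 ω}.indicator (fun _ => (1 : ℝ≥0∞)) x ∂(N ω)

/-- `lam` is the intensity process of the Hawkes process with parameters `μ` and `Φ` built on the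
Poisson random measure `N`: a predictable process which almost surely solves
`λ_t = μ + ∫_{(0,t) × ℝ₊} Φ(t - s) 1_{θ ≤ λ_s} N(ds, dθ)` for all `t ≥ 0`, and for which
`H` is a counting process, i.e. has finitely many jumps on bounded intervals. -/
structure IsHawkesIntensity {Ω : Type*} [MeasurableSpace Ω] (P : Measure Ω)
    (N : Ω → Measure (ℝ≥0 × ℝ≥0)) (hN : Measurable N) (μ : ℝ≥0) (Φ : ℝ≥0 → ℝ≥0)
    (lam : ℝ≥0 → Ω → ℝ≥0) : Prop where
  predictable : Measurable[(naturalHistory N hN).predictable]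
    (fun p : ℝ≥0 × Ω => lam p.1 p.2)
  solves : ∀ᵐ ω ∂P, ∀ t : ℝ≥0, (lam t ω : ℝ≥0∞) = (μ : ℝ≥0∞) + hawkesX N lam Φ t ω
  counting : ∀ᵐ ω ∂P, ∀ t : ℝ≥0, hawkesH N lam t ω < ∞

/-- Iterated convolutions: `iterConv Φ n` is `Φ_{n+1}`, where `Φ_1 = Φ` and
`Φ_{n+1}(t) = ∫_0^t Φ(t - s) Φ_n(s) ds`. -/
def iterConv (Φ : ℝ≥0 → ℝ≥0) : ℕ → ℝ≥0 → ℝ≥0∞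
  | 0 => fun t => (Φ t : ℝ≥0∞)
  | n + 1 => fun t => ∫⁻ s in Set.Iic t, (Φ (t - s) : ℝ≥0∞) * iterConv Φ n s

/-- `Ψ = ∑_{n ≥ 1} Φ_n`, a series of nonnegative functions. -/
def hawkesPsi (Φ : ℝ≥0 → ℝ≥0) (t : ℝ≥0) : ℝ≥0∞ := ∑' n : ℕ, iterConv Φ n t

end

open MeasureTheory ProbabilityTheory
open scoped NNReal ENNReal

/-! ### Lebesgue measure on the half-line -/

/-! Let ν be the counting measure of the accepted points (those with θ ≤ λ_u). Then X^ζ_t = ∫ f dν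
with f(u) = ζ(t-u) 1_{u<t}, and ν has compensator λ_u du.

For a test function f put h(v) = f(v) + ∫_v^∞ f(u) Ψ(u-v) du (`hawkesDual`). Since Ψ = Φ + Φ*Ψ, this
h solves the dual equation h(v) = f(v) + ∫_v^∞ h(u) Φ(u-v) du. Inserting the Hawkes equation for λ
and applying Fubini gives, path by path, ∫ h λ du + ∫ f dν = μ ∫ h + ∫ h dν
(`lintegral_hawkesDual_mul_add`). In other words, ∫ f dν is the constant μ ∫ h plus the compensated
integral of the deterministic function h.

So the mean of ∫ f dν is μ ∫ h. The covariance of ∫ f dν and ∫ g dν is, by the isometry, E ∫ h_f h_g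
λ du = E ∫ h_f h_g dν, which is again a first moment. As ∫ `hawkesDual` f = ∫ f(v) (1 + ∫_0^v Ψ) dv,
it equals μ ∫ h_f h_g (1 + ∫_0^v Ψ) dv. For the two delay kernels h is explicit on v < s: Ψ(s-v) for
Φ, and 1 + ∫_v^s Ψ(y-v) dy for 1. Expanding only the h of the later time t produces the single and
the double integral of the statement.

The compensation formula is checked on generators of the predictable σ-algebra. The isometry follows
by splitting a product of two integrals according to the order of the times: the strict past is a
predictable factor, and the diagonal survives only for the Poisson measure, which is simple.

Everything lives in [0, ∞], so every difference is written as a sum on the other side and cancelled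
only once it is known to be finite. Finiteness comes from stopping when ν has mass K
(`thinnedHorizon`), for bounded f with bounded support; these restrictions are then removed by
monotone convergence. -/

theorem lintegral_nnreal_eq {f : ℝ≥0 → ℝ≥0∞} (hf : Measurable f) :
    ∫⁻ x, f x = ∫⁻ x in Set.Ici (0 : ℝ), f x.toNNReal := by
  change ∫⁻ x, f x ∂(((volume : Measure ℝ).restrict (Set.Ici 0)).map Real.toNNReal) = _
  rw [lintegral_map hf measurable_real_toNNReal]

theorem setLIntegral_nnreal_eq {f : ℝ≥0 → ℝ≥0∞} (hf : Measurable f) {s : Set ℝ≥0}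
    (hs : MeasurableSet s) :
    ∫⁻ x in s, f x = ∫⁻ x, (Set.Ici (0 : ℝ) ∩ Real.toNNReal ⁻¹' s).indicator
      (fun x => f x.toNNReal) x := by
  rw [← lintegral_indicator hs, lintegral_nnreal_eq (hf.indicator hs),
    ← lintegral_indicator measurableSet_Ici]
  congr 1 with x
  by_cases h1 : x ∈ Set.Ici (0 : ℝ) <;> by_cases h2 : x.toNNReal ∈ s <;>
    simp [Set.indicator, h1, h2]

theorem volume_nnreal_apply {s : Set ℝ≥0} (hs : MeasurableSet s) :
    volume s = volume (Set.Ici (0 : ℝ) ∩ Real.toNNReal ⁻¹' s) := by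
  change (((volume : Measure ℝ).restrict (Set.Ici 0)).map Real.toNNReal) s = _
  rw [Measure.map_apply measurable_real_toNNReal hs,
    Measure.restrict_apply (measurable_real_toNNReal hs), Set.inter_comm]

theorem volume_nnreal_Icc (a b : ℝ≥0) : volume (Set.Icc a b) = ((b - a : ℝ≥0) : ℝ≥0∞) := by
  rw [volume_nnreal_apply measurableSet_Icc]
  have : Set.Ici (0 : ℝ) ∩ Real.toNNReal ⁻¹' Set.Icc a b = Set.Icc (a : ℝ) b := by
    ext x
    simp only [Set.mem_inter_iff, Set.mem_Ici, Set.mem_preimage, Set.mem_Icc]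
    constructor
    · rintro ⟨h0, h1, h2⟩
      exact ⟨(Real.le_toNNReal_iff_coe_le h0).1 h1, Real.toNNReal_le_iff_le_coe.1 h2⟩
    · rintro ⟨h1, h2⟩
      have h0 : 0 ≤ x := a.2.trans h1
      exact ⟨h0, (Real.le_toNNReal_iff_coe_le h0).2 h1, Real.toNNReal_le_iff_le_coe.2 h2⟩
  rw [this, Real.volume_Icc, ENNReal.ofReal, NNReal.sub_def]

instance instNoAtomsNNReal : NullSingletonClass (volume : Measure ℝ≥0) where
  measure_singleton x := by rw [← Set.Icc_self, volume_nnreal_Icc]; simp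

theorem volume_nnreal_Iic (b : ℝ≥0) : volume (Set.Iic b) = b := by
  rw [← Set.Icc_bot, volume_nnreal_Icc]; simp

theorem volume_nnreal_Ioc (a b : ℝ≥0) : volume (Set.Ioc a b) = ((b - a : ℝ≥0) : ℝ≥0∞) := by
  rw [← volume_nnreal_Icc]; exact measure_congr Ioc_ae_eq_Icc

theorem volume_nnreal_Ico (a b : ℝ≥0) : volume (Set.Ico a b) = ((b - a : ℝ≥0) : ℝ≥0∞) := by
  rw [← volume_nnreal_Icc]; exact measure_congr Ico_ae_eq_Icc

instance instSigmaFiniteNNReal : SigmaFinite (volume : Measure ℝ≥0) :=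
  ⟨⟨{ set := fun n => Set.Iic (n : ℝ≥0)
      set_mem := fun _ => trivial
      finite := fun n => by rw [volume_nnreal_Iic]; exact ENNReal.coe_lt_top
      spanning := by
        refine Set.eq_univ_of_forall fun x => ?_
        obtain ⟨n, hn⟩ := exists_nat_ge x
        exact Set.mem_iUnion.2 ⟨n, hn⟩ }⟩⟩

/-- Reflection preserves Lebesgue measure on ℝ, and on `u ≤ t` the truncated subtraction agrees with
the real one. -/
theorem setLIntegral_Iic_reflect {g : ℝ≥0 → ℝ≥0∞} (hg : Measurable g) (t : ℝ≥0) :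
    ∫⁻ u in Set.Iic t, g (t - u) = ∫⁻ u in Set.Iic t, g u := by
  rw [setLIntegral_nnreal_eq (f := fun u => g (t - u)) (by fun_prop) measurableSet_Iic,
    setLIntegral_nnreal_eq hg measurableSet_Iic, ← lintegral_sub_left_eq_self _ (t : ℝ)]
  congr 1 with x
  have hiff : ∀ x : ℝ, x ∈ Set.Ici (0 : ℝ) ∩ Real.toNNReal ⁻¹' Set.Iic t ↔ 0 ≤ x ∧ x ≤ t := by
    intro x
    simp [Real.toNNReal_le_iff_le_coe]
  by_cases h : 0 ≤ x ∧ x ≤ t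
  · have h' : 0 ≤ (t : ℝ) - x ∧ (t : ℝ) - x ≤ t := ⟨by linarith, by linarith⟩
    rw [Set.indicator_of_mem ((hiff _).2 h), Set.indicator_of_mem ((hiff _).2 h')]
    congr 1
    rw [← NNReal.coe_inj, NNReal.coe_sub ((hiff _).2 h').2, Real.coe_toNNReal _ h'.1,
      Real.coe_toNNReal _ h.1]
    ring
  · have h' : ¬ (0 ≤ (t : ℝ) - x ∧ (t : ℝ) - x ≤ t) := fun h' => h ⟨by linarith, by linarith⟩
    rw [Set.indicator_of_notMem (fun hh => h ((hiff _).1 hh)),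
      Set.indicator_of_notMem (fun hh => h' ((hiff _).1 hh))]

theorem setLIntegral_Ici_translate {g : ℝ≥0 → ℝ≥0∞} (hg : Measurable g) (v : ℝ≥0) :
    ∫⁻ u in Set.Ici v, g (u - v) = ∫⁻ u, g u := by
  rw [← setLIntegral_univ (μ := volume) g,
    setLIntegral_nnreal_eq (f := fun u => g (u - v)) (by fun_prop) measurableSet_Ici,
    setLIntegral_nnreal_eq hg MeasurableSet.univ]
  symm
  rw [← lintegral_sub_right_eq_self _ (v : ℝ)]
  congr 1 with x
  have hiff : x ∈ Set.Ici (0 : ℝ) ∩ Real.toNNReal ⁻¹' Set.Ici v ↔ (v : ℝ) ≤ x := by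
    simp only [Set.mem_inter_iff, Set.mem_Ici, Set.mem_preimage]
    constructor
    · rintro ⟨h0, h1⟩; exact (Real.le_toNNReal_iff_coe_le h0).1 h1
    · intro h
      have h0 : 0 ≤ x := v.2.trans h
      exact ⟨h0, (Real.le_toNNReal_iff_coe_le h0).2 h⟩
  by_cases h : (v : ℝ) ≤ x
  · have h0 : 0 ≤ x := v.2.trans h
    rw [Set.indicator_of_mem (hiff.2 h), Set.indicator_of_mem (by simpa using h)]
    congr 1
    rw [← NNReal.coe_inj, Real.coe_toNNReal _ (by linarith), NNReal.coe_sub (hiff.2 h).2,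
      Real.coe_toNNReal _ h0]
  · rw [Set.indicator_of_notMem (fun hh => h (hiff.1 hh)), Set.indicator_of_notMem (by simpa using h)]

/-! ### Kernels with finite values, and locally finite random measures on the quadrant -/

section Kernels

variable {α β : Type*} [MeasurableSpace α] [MeasurableSpace β]

/-- Finite values need not be uniformly bounded, so the parameter space is sliced by the integer
part of the total mass; on each slice the kernel is finite. -/
theorem isSFiniteKernel_of_forall_isFiniteMeasure (κ : Kernel α β)
    (hκ : ∀ a, IsFiniteMeasure (κ a)) : IsSFiniteKernel κ := by
  have hmeas : Measurable fun a => κ a Set.univ := κ.measurable_coe MeasurableSet.univ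
  have hs : ∀ k : ℕ, MeasurableSet {a | (k : ℝ≥0∞) ≤ κ a Set.univ ∧ κ a Set.univ < (k : ℝ≥0∞) + 1} :=
    fun k => (measurableSet_le measurable_const hmeas).inter (measurableSet_lt hmeas measurable_const)
  classical
  let η : ℕ → Kernel α β := fun k => Kernel.piecewise (hs k) κ 0
  have hη : ∀ k, IsFiniteKernel (η k) := fun k => by
    refine ⟨⟨(k : ℝ≥0∞) + 1, by simp, fun a => ?_⟩⟩
    simp only [η, Kernel.piecewise_apply']
    split_ifs with h
    · exact h.2.le
    · simp
  have hsum : κ = Kernel.sum η := by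
    refine Kernel.ext fun a => ?_
    ext t ht
    rw [Kernel.sum_apply' _ _ ht]
    have hfin : κ a Set.univ < ∞ := measure_lt_top _ _
    set x := κ a Set.univ with hx
    have hk : ((⌊x.toReal⌋₊ : ℕ) : ℝ≥0∞) ≤ x ∧ x < (⌊x.toReal⌋₊ : ℕ) + 1 := by
      have hxr : x = ENNReal.ofReal x.toReal := (ENNReal.ofReal_toReal hfin.ne).symm
      constructor
      · conv_rhs => rw [hxr]
        rw [← ENNReal.ofReal_natCast]
        exact ENNReal.ofReal_le_ofReal (Nat.floor_le ENNReal.toReal_nonneg)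
      · conv_lhs => rw [hxr]
        have : ((⌊x.toReal⌋₊ : ℕ) + 1 : ℝ≥0∞) = ENNReal.ofReal ((⌊x.toReal⌋₊ + 1 : ℕ) : ℝ) := by
          rw [ENNReal.ofReal_natCast]; push_cast; rfl
        rw [this]
        refine (ENNReal.ofReal_lt_ofReal_iff (by positivity)).2 ?_
        push_cast
        exact Nat.lt_floor_add_one _
    -- Exactly one slice contains `a`, the one indexed by the floor of its mass.
    rw [tsum_eq_single ⌊x.toReal⌋₊]
    · simp only [η, Kernel.piecewise_apply']
      exact (if_pos (show a ∈ {a | _} from hk)).symm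
    · intro k hne
      simp only [η, Kernel.piecewise_apply']
      rw [if_neg]
      · simp
      · rintro ⟨h1, h2⟩
        apply hne
        have a1 : (k : ℝ≥0∞) < (⌊x.toReal⌋₊ : ℕ) + 1 := h1.trans_lt hk.2
        have a2 : ((⌊x.toReal⌋₊ : ℕ) : ℝ≥0∞) < k + 1 := hk.1.trans_lt h2
        norm_cast at a1 a2
        omega
  rw [hsum]
  infer_instance

theorem isSFiniteKernel_of_iUnion (κ : Kernel α β) (s : ℕ → Set β) (hs : ∀ n, MeasurableSet (s n))
    (hU : ⋃ n, s n = Set.univ) (hfin : ∀ a n, κ a (s n) < ∞) : IsSFiniteKernel κ := by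
  have hd : ∀ n, MeasurableSet (disjointed s n) := fun n => MeasurableSet.disjointed hs n
  have hsum : κ = Kernel.sum fun n => κ.restrict (hd n) := by
    refine Kernel.ext fun a => ?_
    ext t ht
    rw [Kernel.sum_apply' _ _ ht]
    simp_rw [Kernel.restrict_apply' _ _ _ ht]
    rw [← measure_iUnion, ← Set.inter_iUnion, iUnion_disjointed, hU, Set.inter_univ]
    · exact fun i j hij => ((disjoint_disjointed s hij).mono Set.inter_subset_right
        Set.inter_subset_right)
    · exact fun n => ht.inter (hd n)
  rw [hsum]
  have : ∀ n, IsSFiniteKernel (κ.restrict (hd n)) := fun n =>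
    isSFiniteKernel_of_forall_isFiniteMeasure _ fun a => ⟨by
      rw [Kernel.restrict_apply, Measure.restrict_apply_univ]
      exact (measure_mono (disjointed_subset s n)).trans_lt (hfin a n)⟩
  infer_instance

end Kernels

/-- The boxes `[0, n] × [0, n]` exhausting the quadrant. -/
def quadrantBox (n : ℕ) : Set (ℝ≥0 × ℝ≥0) := Set.Iic (n : ℝ≥0) ×ˢ Set.Iic (n : ℝ≥0)

theorem measurableSet_quadrantBox (n : ℕ) : MeasurableSet (quadrantBox n) :=
  measurableSet_Iic.prod measurableSet_Iic

theorem quadrantBox_mono : Monotone quadrantBox := fun _ _ h =>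
  Set.prod_mono (Set.Iic_subset_Iic.2 (by exact_mod_cast h)) (Set.Iic_subset_Iic.2 (by exact_mod_cast h))

theorem iUnion_quadrantBox : ⋃ n, quadrantBox n = Set.univ := by
  refine Set.eq_univ_of_forall fun x => ?_
  obtain ⟨n, hn⟩ := exists_nat_ge (max x.1 x.2)
  exact Set.mem_iUnion.2 ⟨n, (le_max_left _ _).trans hn, (le_max_right _ _).trans hn⟩

theorem volume_quadrantBox_lt_top (n : ℕ) : volume (quadrantBox n) < ∞ := by
  rw [quadrantBox, Measure.volume_eq_prod, Measure.prod_prod, volume_nnreal_Iic]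
  exact ENNReal.mul_lt_top ENNReal.coe_lt_top ENNReal.coe_lt_top

section RandomMeasure

variable {α : Type*} [MeasurableSpace α]

/-- On a box the measures are finite, so the π-system of rectangles decides measurability; the boxes
then exhaust the quadrant. -/
theorem measurable_of_measurable_rectangles {κ : α → Measure (ℝ≥0 × ℝ≥0)}
    (hfin : ∀ a n, κ a (quadrantBox n) < ∞)
    (hm : ∀ T B : Set ℝ≥0, MeasurableSet T → MeasurableSet B → Measurable fun a => κ a (T ×ˢ B)) :
    Measurable κ := by
  have h1 : ∀ n, Measurable fun a => (κ a).restrict (quadrantBox n) := fun n => by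
    have : ∀ a, IsFiniteMeasure ((κ a).restrict (quadrantBox n)) := fun a =>
      ⟨by rw [Measure.restrict_apply_univ]; exact hfin a n⟩
    refine Measurable.measure_of_isPiSystem generateFrom_prod.symm isPiSystem_prod ?_ ?_
    · rintro _ ⟨T, hT, B, hB, rfl⟩
      rw [Set.mem_ofPred_eq] at hT hB
      have : ∀ a, (κ a).restrict (quadrantBox n) (T ×ˢ B)
          = κ a ((T ∩ Set.Iic (n : ℝ≥0)) ×ˢ (B ∩ Set.Iic (n : ℝ≥0))) := fun a => by
        rw [Measure.restrict_apply (hT.prod hB), quadrantBox, Set.prod_inter_prod]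
      simp_rw [this]
      exact hm _ _ (hT.inter measurableSet_Iic) (hB.inter measurableSet_Iic)
    · simp_rw [Measure.restrict_apply_univ]
      exact hm _ _ measurableSet_Iic measurableSet_Iic
  refine Measure.measurable_of_measurable_coe _ fun s hs => ?_
  have h2 : ∀ a, κ a s = ⨆ n, (κ a).restrict (quadrantBox n) s := fun a => by
    simp_rw [Measure.restrict_apply hs]
    rw [← Monotone.measure_iUnion, ← Set.inter_iUnion, iUnion_quadrantBox, Set.inter_univ]
    exact fun i j hij => Set.inter_subset_inter_right _ (quadrantBox_mono hij)
  simp_rw [h2]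
  exact Measurable.iSup fun n => (Measure.measurable_coe hs).comp (h1 n)

theorem isSFiniteKernel_of_quadrantBox (κ : Kernel α (ℝ≥0 × ℝ≥0))
    (hfin : ∀ a n, κ a (quadrantBox n) < ∞) : IsSFiniteKernel κ :=
  isSFiniteKernel_of_iUnion κ quadrantBox measurableSet_quadrantBox iUnion_quadrantBox hfin

/-- The σ-algebra on the parameter space is arbitrary, so the result applies both to the full
σ-algebra on Ω and to the history at a fixed time. -/
theorem measurable_lintegral_randomMeasure {κ : α → Measure (ℝ≥0 × ℝ≥0)}
    (hfin : ∀ a n, κ a (quadrantBox n) < ∞)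
    (hm : ∀ T B : Set ℝ≥0, MeasurableSet T → MeasurableSet B → Measurable fun a => κ a (T ×ˢ B))
    {F : α → ℝ≥0 × ℝ≥0 → ℝ≥0∞} (hF : Measurable (Function.uncurry F)) :
    Measurable fun a => ∫⁻ x, F a x ∂κ a := by
  let K : Kernel α (ℝ≥0 × ℝ≥0) := ⟨κ, measurable_of_measurable_rectangles hfin hm⟩
  have : IsSFiniteKernel K := isSFiniteKernel_of_quadrantBox K hfin
  exact hF.lintegral_kernel_prod_right (κ := K)

end RandomMeasure

/-! ### Predictable fields and adapted random measures -/

section Predictable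

variable {Ω : Type*} {mΩ : MeasurableSpace Ω}

/-- A process indexed by the half-line, measurable for the predictable σ-algebra. -/
def IsPredictableProcess (G : Filtration ℝ≥0 mΩ) (Z : ℝ≥0 → Ω → ℝ≥0∞) : Prop :=
  Measurable[G.predictable] fun p : ℝ≥0 × Ω => Z p.1 p.2

/-- A random function of time and mark, measurable for the product of the predictable σ-algebra
and the Borel σ-algebra of the mark space. -/
def IsPredictableField (G : Filtration ℝ≥0 mΩ) (F : ℝ≥0 × ℝ≥0 → Ω → ℝ≥0∞) : Prop :=
  Measurable[G.predictable.prod inferInstance] fun p : (ℝ≥0 × Ω) × ℝ≥0 => F (p.1.1, p.2) p.1.2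

/-- A random measure on `ℝ₊ × ℝ₊`, finite on bounded sets, whose restriction to `[0, t] × ℝ₊` is
`G t`-measurable. -/
structure IsAdaptedRandomMeasure (G : Filtration ℝ≥0 mΩ) (κ : Ω → Measure (ℝ≥0 × ℝ≥0)) :
    Prop where
  finite : ∀ ω n, κ ω (quadrantBox n) < ∞
  adapted : ∀ (t : ℝ≥0) (T B : Set ℝ≥0), MeasurableSet T → MeasurableSet B → T ⊆ Set.Iic t →
    Measurable[G t] fun ω => κ ω (T ×ˢ B)

variable {G : Filtration ℝ≥0 mΩ}

theorem measurable_fst_predictable :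
    Measurable[G.predictable] (Prod.fst : ℝ≥0 × Ω → ℝ≥0) := by
  refine measurable_of_Ioi (mδ := G.predictable) fun i => ?_
  have : Prod.fst ⁻¹' Set.Ioi i = Set.Ioi i ×ˢ (Set.univ : Set Ω) := by ext; simp
  rw [this]
  exact measurableSet_predictable_Ioi_prod MeasurableSet.univ

theorem predictable_le_prod : G.predictable ≤ (inferInstance : MeasurableSpace (ℝ≥0 × Ω)) :=
  measurableSpace_le_predictable_of_measurableSet
    (fun _ hA => (measurableSet_singleton _).prod (G.le _ _ hA))
    (fun _ _ hA => measurableSet_Ioi.prod (G.le _ _ hA))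

theorem predictable_mono {G' : Filtration ℝ≥0 mΩ} (h : ∀ t, G t ≤ G' t) :
    G.predictable ≤ G'.predictable :=
  measurableSpace_le_predictable_of_measurableSet
    (fun _ hA => measurableSet_predictable_singleton_bot_prod (h _ _ hA))
    (fun _ _ hA => measurableSet_predictable_Ioi_prod (h _ _ hA))

/-- Freezing the time at `q` makes a predictable set `G q`-measurable. -/
theorem measurable_min_predictable (q : ℝ≥0) :
    @Measurable (Ω × ℝ≥0) (ℝ≥0 × Ω) ((G q).prod inferInstance) G.predictable
      (fun p => (min p.2 q, p.1)) := by
  rw [measurable_iff_comap_le, MeasurableSpace.comap_le_iff_le_map]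
  refine measurableSpace_le_predictable_of_measurableSet (fun A hA => ?_) (fun i A hA => ?_)
  · rw [MeasurableSpace.map_def]
    have h : (fun p : Ω × ℝ≥0 => (min p.2 q, p.1)) ⁻¹' ({⊥} ×ˢ A)
        = A ×ˢ ((fun u => min u q) ⁻¹' {⊥}) := by ext; simp [and_comm]
    rw [h]
    have h0 : MeasurableSet[G q] A := G.mono bot_le _ hA
    exact @MeasurableSet.prod _ _ (G q) _ _ _ h0
      ((measurable_id.min measurable_const) (measurableSet_singleton _))
  · rw [MeasurableSpace.map_def]
    have h : (fun p : Ω × ℝ≥0 => (min p.2 q, p.1)) ⁻¹' (Set.Ioi i ×ˢ A)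
        = A ×ˢ ((fun u => min u q) ⁻¹' Set.Ioi i) := by ext; simp [and_comm]
    rw [h]
    -- If `i < q`, the event is already known at time `q`; otherwise a time frozen at `q` never
    -- exceeds `i`, and the preimage is empty.
    by_cases hi : i < q
    · have h0 : MeasurableSet[G q] A := G.mono hi.le _ hA
      exact @MeasurableSet.prod _ _ (G q) _ _ _ h0
        ((measurable_id.min measurable_const) measurableSet_Ioi)
    · have : (fun u => min u q) ⁻¹' Set.Ioi i = ∅ := by
        ext u; simp [not_lt.1 hi]
      rw [this, Set.prod_empty]
      exact @MeasurableSet.empty _ ((G q).prod inferInstance)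

namespace IsPredictableProcess

theorem field {Z : ℝ≥0 → Ω → ℝ≥0∞} (hZ : IsPredictableProcess G Z) :
    IsPredictableField G fun x ω => Z x.1 ω :=
  Measurable.comp hZ (@measurable_fst _ _ G.predictable _)

theorem of_deterministic {f : ℝ≥0 → ℝ≥0∞} (hf : Measurable f) :
    IsPredictableProcess G fun u _ => f u :=
  hf.comp measurable_fst_predictable

end IsPredictableProcess

namespace IsPredictableField

variable {F F' : ℝ≥0 × ℝ≥0 → Ω → ℝ≥0∞}

theorem mul (hF : IsPredictableField G F) (hF' : IsPredictableField G F') :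
    IsPredictableField G fun x ω => F x ω * F' x ω :=
  Measurable.mul hF hF'

theorem of_deterministic {f : ℝ≥0 × ℝ≥0 → ℝ≥0∞} (hf : Measurable f) :
    IsPredictableField G fun x _ => f x :=
  hf.comp ((measurable_fst_predictable.comp (@measurable_fst _ _ G.predictable _)).prodMk
    (@measurable_snd _ _ G.predictable _))

theorem le_indicator {lam : ℝ≥0 → Ω → ℝ≥0}
    (hlam : Measurable[G.predictable] fun p : ℝ≥0 × Ω => lam p.1 p.2) :
    IsPredictableField G fun x ω => (Set.Iic (lam x.1 ω)).indicator 1 x.2 := by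
  have h : MeasurableSet[G.predictable.prod inferInstance]
      {p : (ℝ≥0 × Ω) × ℝ≥0 | p.2 ≤ lam p.1.1 p.1.2} :=
    measurableSet_le (mδ := G.predictable.prod inferInstance)
      (@measurable_snd _ _ G.predictable _)
      (hlam.comp (@measurable_fst _ _ G.predictable _))
  exact Measurable.indicator (m := G.predictable.prod inferInstance) measurable_const h

theorem measurable_uncurry (hF : IsPredictableField G F) :
    Measurable fun p : Ω × ℝ≥0 × ℝ≥0 => F p.2 p.1 := by
  have h1 : Measurable fun p : (ℝ≥0 × Ω) × ℝ≥0 => F (p.1.1, p.2) p.1.2 := by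
    refine Measurable.mono hF ?_ le_rfl
    exact sup_le_sup (MeasurableSpace.comap_mono predictable_le_prod) le_rfl
  exact h1.comp (g := fun p : (ℝ≥0 × Ω) × ℝ≥0 => F (p.1.1, p.2) p.1.2)
    (f := fun p : Ω × ℝ≥0 × ℝ≥0 => ((p.2.1, p.1), p.2.2)) (by fun_prop)

theorem measurable_min (hF : IsPredictableField G F) (q : ℝ≥0) :
    Measurable[(G q).prod inferInstance]
      fun p : Ω × ℝ≥0 × ℝ≥0 => F (min p.2.1 q, p.2.2) p.1 := by
  have h2 : @Measurable (Ω × ℝ≥0 × ℝ≥0) ((ℝ≥0 × Ω) × ℝ≥0) ((G q).prod inferInstance)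
      (G.predictable.prod inferInstance) (fun p => ((min p.2.1 q, p.1), p.2.2)) := by
    refine @Measurable.prodMk _ ((G q).prod inferInstance) _ _ G.predictable _ _ _ ?_ ?_
    · refine (measurable_min_predictable (G := G) q).comp
        (f := fun p : Ω × ℝ≥0 × ℝ≥0 => (p.1, p.2.1)) ?_
      exact @Measurable.prodMk _ ((G q).prod inferInstance) _ _ (G q) _ _ _
        (@measurable_fst _ _ (G q) _) (measurable_fst.comp (@measurable_snd _ _ (G q) _))
    · exact measurable_snd.comp (@measurable_snd _ _ (G q) _)
  exact Measurable.comp hF h2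

end IsPredictableField

namespace IsAdaptedRandomMeasure

variable {κ : Ω → Measure (ℝ≥0 × ℝ≥0)} {F : ℝ≥0 × ℝ≥0 → Ω → ℝ≥0∞}

theorem measurable_rectangle (hκ : IsAdaptedRandomMeasure G κ) (T B : Set ℝ≥0)
    (hT : MeasurableSet T) (hB : MeasurableSet B) : Measurable fun ω => κ ω (T ×ˢ B) := by
  have h2 : ∀ ω, κ ω (T ×ˢ B) = ⨆ n : ℕ, κ ω ((T ∩ Set.Iic (n : ℝ≥0)) ×ˢ B) := fun ω => by
    rw [← Monotone.measure_iUnion, ← Set.iUnion_prod_const, ← Set.inter_iUnion]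
    · have : ⋃ n : ℕ, Set.Iic (n : ℝ≥0) = Set.univ :=
        Set.eq_univ_of_forall fun x => Set.mem_iUnion.2 (exists_nat_ge x)
      rw [this, Set.inter_univ]
    · exact fun i j hij => Set.prod_mono
        (Set.inter_subset_inter_right _ (Set.Iic_subset_Iic.2 (by exact_mod_cast hij))) le_rfl
  simp_rw [h2]
  exact Measurable.iSup fun n => (hκ.adapted n _ _ (hT.inter measurableSet_Iic) hB
    Set.inter_subset_right).mono (G.le _) le_rfl

theorem measurable (hκ : IsAdaptedRandomMeasure G κ) : Measurable κ :=
  measurable_of_measurable_rectangles hκ.finite hκ.measurable_rectangle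

theorem sFinite (hκ : IsAdaptedRandomMeasure G κ) (ω : Ω) : SFinite (κ ω) := by
  let K : Kernel Ω (ℝ≥0 × ℝ≥0) := ⟨κ, hκ.measurable⟩
  have : IsSFiniteKernel K := isSFiniteKernel_of_quadrantBox K hκ.finite
  exact inferInstanceAs (SFinite (K ω))

theorem measurable_lintegral (hκ : IsAdaptedRandomMeasure G κ) (hF : IsPredictableField G F) :
    Measurable fun ω => ∫⁻ x, F x ω ∂κ ω :=
  measurable_lintegral_randomMeasure hκ.finite hκ.measurable_rectangle
    (F := fun ω x => F x ω) hF.measurable_uncurry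

/-- On `[0, q]` replacing the time by its minimum with `q` changes nothing, and the frozen field
only involves the history at `q`. -/
theorem measurable_setLIntegral_Iic (hκ : IsAdaptedRandomMeasure G κ)
    (hF : IsPredictableField G F) (q : ℝ≥0) :
    Measurable[G q] fun ω => ∫⁻ x in Set.Iic q ×ˢ Set.univ, F x ω ∂κ ω := by
  have h1 : ∀ ω, ∫⁻ x in Set.Iic q ×ˢ Set.univ, F x ω ∂κ ω
      = ∫⁻ x, F (min x.1 q, x.2) ω ∂(κ ω).restrict (Set.Iic q ×ˢ Set.univ) := fun ω =>
    setLIntegral_congr_fun (measurableSet_Iic.prod MeasurableSet.univ) fun x hx => by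
      simp only [min_eq_left (show x.1 ≤ q from hx.1)]
  simp_rw [h1]
  refine @measurable_lintegral_randomMeasure Ω (G q)
    (fun ω => (κ ω).restrict (Set.Iic q ×ˢ Set.univ)) ?_ ?_
    (fun ω x => F (min x.1 q, x.2) ω) (hF.measurable_min q)
  · exact fun ω n => (Measure.restrict_apply_le _ _).trans_lt (hκ.finite ω n)
  · intro T B hT hB
    simp_rw [Measure.restrict_apply (hT.prod hB), Set.prod_inter_prod, Set.inter_univ]
    exact hκ.adapted q _ _ (hT.inter measurableSet_Iic) hB Set.inter_subset_right

/-- The integral of a predictable field over the strict past is a predictable process. -/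
theorem isPredictableProcess_setLIntegral_Iio (hκ : IsAdaptedRandomMeasure G κ)
    (hF : IsPredictableField G F) :
    IsPredictableProcess G fun v ω => ∫⁻ x in Set.Iio v ×ˢ Set.univ, F x ω ∂κ ω := by
  obtain ⟨s, hsc, hsd⟩ := TopologicalSpace.exists_countable_dense ℝ≥0
  have := hsc.to_subtype
  -- Left-continuity in `v`: the integral over `[0, v)` is the supremum, over a countable dense set
  -- of `q < v`, of integrals over `[0, q]`. Each term is a `G q`-measurable variable switched on
  -- after `q`, hence predictable.
  have h1 : ∀ (v : ℝ≥0) (ω : Ω), ∫⁻ x in Set.Iio v ×ˢ Set.univ, F x ω ∂κ ω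
      = ⨆ q : s, (Set.Ioi (q : ℝ≥0)).indicator
          (fun _ => ∫⁻ x in Set.Iic (q : ℝ≥0) ×ˢ Set.univ, F x ω ∂κ ω) v := by
    intro v ω
    refine le_antisymm ?_ (iSup_le fun q => ?_)
    · by_cases hv : ∃ q : s, (q : ℝ≥0) < v
      swap
      · have : Set.Iio v = ∅ := by
          by_contra hne
          have hne' : (Set.Iio v).Nonempty := Set.nonempty_iff_ne_empty.2 hne
          obtain ⟨q, hq, hqs⟩ := hsd.exists_mem_open isOpen_Iio hne'
          exact hv ⟨⟨q, hq⟩, hqs⟩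
        simp [this]
      have hne : Nonempty {q : s // (q : ℝ≥0) < v} := ⟨⟨hv.choose, hv.choose_spec⟩⟩
      have hU : Set.Iio v ×ˢ (Set.univ : Set ℝ≥0)
          = ⋃ q : {q : s // (q : ℝ≥0) < v}, Set.Iic (q : ℝ≥0) ×ˢ Set.univ := by
        rw [← Set.iUnion_prod_const]
        congr 1
        ext u
        simp only [Set.mem_Iio, Set.mem_iUnion, Set.mem_Iic]
        constructor
        · intro hu
          obtain ⟨q, hq, hqs⟩ := hsd.exists_between hu
          exact ⟨⟨⟨q, hq⟩, hqs.2⟩, hqs.1.le⟩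
        · rintro ⟨q, hq⟩
          exact hq.trans_lt q.2
      have hdir : Directed (· ⊆ ·) fun q : {q : s // (q : ℝ≥0) < v} =>
          Set.Iic (q : ℝ≥0) ×ˢ (Set.univ : Set ℝ≥0) := by
        have : Monotone fun q : {q : s // (q : ℝ≥0) < v} =>
            Set.Iic (q : ℝ≥0) ×ˢ (Set.univ : Set ℝ≥0) := fun a b hab =>
          Set.prod_mono (Set.Iic_subset_Iic.2 hab) le_rfl
        exact this.directed_le
      rw [hU, setLIntegral_iUnion_of_directed _ hdir]
      refine iSup_le fun q => ?_
      refine le_iSup_of_le q.1 ?_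
      rw [Set.indicator_of_mem (show v ∈ Set.Ioi _ from q.2)]
    · by_cases hq : (q : ℝ≥0) < v
      · rw [Set.indicator_of_mem (show v ∈ Set.Ioi _ from hq)]
        exact lintegral_mono_set (Set.prod_mono (fun u hu => lt_of_le_of_lt hu hq) le_rfl)
      · rw [Set.indicator_of_notMem (show v ∉ Set.Ioi _ from hq)]
        exact zero_le
  unfold IsPredictableProcess
  simp_rw [h1]
  refine Measurable.iSup fun q => ?_
  intro C hC
  set W := fun ω => ∫⁻ x in Set.Iic (q : ℝ≥0) ×ˢ Set.univ, F x ω ∂κ ω with hW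
  have hWm : Measurable[G q] W := hκ.measurable_setLIntegral_Iic hF q
  have hcase : (fun p : ℝ≥0 × Ω => (Set.Ioi (q : ℝ≥0)).indicator (fun _ => W p.2) p.1) ⁻¹' C
      = (Set.Ioi (q : ℝ≥0) ×ˢ (W ⁻¹' C)) ∪
        ((Set.Ioi (q : ℝ≥0) ×ˢ (Set.univ : Set Ω))ᶜ ∩ {_p | (0 : ℝ≥0∞) ∈ C}) := by
    ext p
    by_cases hp : p.1 ∈ Set.Ioi (q : ℝ≥0) <;> simp [hp]
  rw [hcase]
  refine MeasurableSet.union (measurableSet_predictable_Ioi_prod (hWm hC))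
    (MeasurableSet.inter (measurableSet_predictable_Ioi_prod MeasurableSet.univ).compl ?_)
  exact @MeasurableSet.const _ G.predictable _

end IsAdaptedRandomMeasure

theorem isAdaptedRandomMeasure_volume : IsAdaptedRandomMeasure G fun _ => volume where
  finite _ n := volume_quadrantBox_lt_top n
  adapted _ _ _ _ _ _ := @measurable_const _ _ _ (G _) _

end Predictable

/-! ### Compensation formula and isometry for simple random measures -/

theorem lintegral_eq_iSup_quadrantBox (ν : Measure (ℝ≥0 × ℝ≥0)) (f : ℝ≥0 × ℝ≥0 → ℝ≥0∞) :
    ∫⁻ x, f x ∂ν = ⨆ n, ∫⁻ x in quadrantBox n, f x ∂ν := by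
  rw [← setLIntegral_iUnion_of_directed _ quadrantBox_mono.directed_le, iUnion_quadrantBox,
    setLIntegral_univ]

/-- The predictable generators do not include the whole space, so the usual uniqueness theorem does
not apply directly. Two disjoint generators covering it give agreement on full strips, which is what
complements need. -/
theorem ext_prod_of_generateFrom {α β : Type*} [mα : MeasurableSpace α] [MeasurableSpace β]
    {C : Set (Set α)} (hgen : mα = MeasurableSpace.generateFrom C) (hpi : IsPiSystem C)
    {S₀ S₁ : Set α} (h₀ : S₀ ∈ C) (h₁ : S₁ ∈ C) (hd : Disjoint S₀ S₁)
    (hU : S₀ ∪ S₁ = Set.univ) {μ ν : Measure (α × β)} [IsFiniteMeasure μ]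
    (h : ∀ S ∈ C, ∀ B, MeasurableSet B → μ (S ×ˢ B) = ν (S ×ˢ B)) : μ = ν := by
  have hm : ∀ S ∈ C, MeasurableSet S := fun S hS => by
    rw [hgen]; exact MeasurableSpace.measurableSet_generateFrom hS
  have huniv : ∀ B, MeasurableSet B → μ (Set.univ ×ˢ B) = ν (Set.univ ×ˢ B) := fun B hB => by
    have hd' : Disjoint (S₀ ×ˢ B) (S₁ ×ˢ B) := Set.disjoint_prod.2 (Or.inl hd)
    rw [← hU, Set.union_prod, measure_union hd' ((hm _ h₁).prod hB),
      measure_union hd' ((hm _ h₁).prod hB), h _ h₀ B hB, h _ h₁ B hB]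
  refine Measure.ext_prod fun {S B} hS hB => ?_
  induction S, hS using MeasurableSpace.induction_on_inter hgen hpi with
  | empty => simp
  | basic S hS => exact h S hS B hB
  | compl S hS ih =>
    have hc : Sᶜ ×ˢ B = (Set.univ ×ˢ B) \ (S ×ˢ B) := by ext; simp; tauto
    have hsub : S ×ˢ B ⊆ Set.univ ×ˢ B := Set.prod_mono (Set.subset_univ _) le_rfl
    rw [hc, measure_sdiff hsub (hS.prod hB).nullMeasurableSet (measure_ne_top _ _),
      measure_sdiff hsub (hS.prod hB).nullMeasurableSet (by rw [← ih]; exact measure_ne_top _ _),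
      ih, huniv B hB]
  | iUnion f hdf hf ih =>
    have hdd : Pairwise (Function.onFun Disjoint fun i => f i ×ˢ B) := fun i j hij =>
      Set.disjoint_prod.2 (Or.inl (hdf hij))
    rw [Set.iUnion_prod_const, measure_iUnion hdd fun i => (hf i).prod hB,
      measure_iUnion hdd fun i => (hf i).prod hB]
    simp_rw [ih]

section Compensation

variable {Ω : Type*} {mΩ : MeasurableSpace Ω}

/-- A random measure adapted to `G` which is surely the counting measure of a locally finite set
with at most one point at each time and no point at time zero, and whose compensator with respect
to `G` is the Lebesgue measure. -/
structure IsSimplePoissonMeasure (P : Measure Ω) (G : Filtration ℝ≥0 mΩ)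
    (N : Ω → Measure (ℝ≥0 × ℝ≥0)) : Prop extends IsAdaptedRandomMeasure G N where
  zero : ∀ ω, N ω ({0} ×ˢ Set.univ) = 0
  compensated : ∀ (s t : ℝ≥0) (n : ℕ) (A : Set Ω) (B : Set ℝ≥0), MeasurableSet[G s] A →
    MeasurableSet B → ∫⁻ ω in A, N ω (Set.Ioc s t ×ˢ (B ∩ Set.Iic (n : ℝ≥0))) ∂P
      = P A * volume (Set.Ioc s t ×ˢ (B ∩ Set.Iic (n : ℝ≥0)))
  natValued : ∀ ω C, MeasurableSet C → ∃ k : ℕ∞, N ω C = k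
  simple : ∀ ω u, N ω ({u} ×ˢ Set.univ) ≤ 1

variable {P : Measure Ω} {G : Filtration ℝ≥0 mΩ}
  {N : Ω → Measure (ℝ≥0 × ℝ≥0)} {F F' : ℝ≥0 × ℝ≥0 → Ω → ℝ≥0∞}

theorem isPiSystem_predictable (G : Filtration ℝ≥0 mΩ) : IsPiSystem
    ({s | ∃ A, MeasurableSet[G ⊥] A ∧ s = {⊥} ×ˢ A} ∪
      {s | ∃ i A, MeasurableSet[G i] A ∧ s = Set.Ioi i ×ˢ A} : Set (Set (ℝ≥0 × Ω))) := by
  have key : ∀ (i : ℝ≥0) (A B : Set Ω), (({⊥} : Set ℝ≥0) ×ˢ A) ∩ (Set.Ioi i ×ˢ B) = ∅ := by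
    intro i A B
    rw [Set.prod_inter_prod]
    have : ({⊥} : Set ℝ≥0) ∩ Set.Ioi i = ∅ := by ext; simp
    rw [this, Set.empty_prod]
  rintro _ (⟨A, hA, rfl⟩ | ⟨i, A, hA, rfl⟩) _ (⟨B, hB, rfl⟩ | ⟨j, B, hB, rfl⟩) hne
  · refine Or.inl ⟨A ∩ B, @MeasurableSet.inter _ (G ⊥) _ _ hA hB, ?_⟩
    rw [Set.prod_inter_prod, Set.inter_self]
  · rw [key] at hne; simp at hne
  · rw [Set.inter_comm, key] at hne; simp at hne
  · refine Or.inr ⟨max i j, A ∩ B, @MeasurableSet.inter _ (G (max i j)) _ _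
      (G.mono (le_max_left _ _) _ hA) (G.mono (le_max_right _ _) _ hB), ?_⟩
    rw [Set.prod_inter_prod, Set.Ioi_inter_Ioi]

theorem measurable_timeMark : @Measurable (Ω × ℝ≥0 × ℝ≥0) ((ℝ≥0 × Ω) × ℝ≥0) _
    (G.predictable.prod inferInstance) (fun p => ((p.2.1, p.1), p.2.2)) := by
  have h : Measurable (fun p : Ω × ℝ≥0 × ℝ≥0 => ((p.2.1, p.1), p.2.2)) := by fun_prop
  exact h.mono le_rfl (sup_le_sup (MeasurableSpace.comap_mono predictable_le_prod) le_rfl)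

/-- The mean integrals of all predictable fields are integrals against one measure on the
predictable σ-algebra times the marks. Comparing two random measures thus becomes comparing two such
measures on rectangles. -/
theorem IsAdaptedRandomMeasure.setLIntegral_box_eq [IsProbabilityMeasure P] {κ : Ω → Measure (ℝ≥0 × ℝ≥0)}
    (hκ : IsAdaptedRandomMeasure G κ) (n : ℕ) :
    ∃ M : @Measure ((ℝ≥0 × Ω) × ℝ≥0) (G.predictable.prod inferInstance),
      (∀ F, IsPredictableField G F →
        ∫⁻ ω, ∫⁻ x in quadrantBox n, F x ω ∂κ ω ∂P
          = @lintegral _ (G.predictable.prod inferInstance) M (fun p => F (p.1.1, p.2) p.1.2)) ∧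
      (∀ (T : Set ℝ≥0) (A : Set Ω) (B : Set ℝ≥0), MeasurableSet[G.predictable] (T ×ˢ A) →
        MeasurableSet A → MeasurableSet B →
        M ((T ×ˢ A) ×ˢ B) = ∫⁻ ω in A, κ ω ((T ∩ Set.Iic (n : ℝ≥0)) ×ˢ (B ∩ Set.Iic (n : ℝ≥0))) ∂P) ∧
      M Set.univ = ∫⁻ ω, κ ω (quadrantBox n) ∂P := by
  let K₀ : Kernel Ω (ℝ≥0 × ℝ≥0) := ⟨κ, hκ.measurable⟩
  have : IsSFiniteKernel K₀ := isSFiniteKernel_of_quadrantBox K₀ hκ.finite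
  let K := K₀.restrict (measurableSet_quadrantBox n)
  have hK : ∀ ω, K ω = (κ ω).restrict (quadrantBox n) := fun ω => Kernel.restrict_apply _ _ _
  refine ⟨@Measure.map _ _ _ (G.predictable.prod inferInstance)
    (fun p : Ω × ℝ≥0 × ℝ≥0 => ((p.2.1, p.1), p.2.2)) (P ⊗ₘ K), fun F hF => ?_, ?_, ?_⟩
  · have hF' := hF
    unfold IsPredictableField at hF
    rw [@lintegral_map _ _ _ (G.predictable.prod inferInstance) _ _ _ hF measurable_timeMark,
      Measure.lintegral_compProd hF'.measurable_uncurry]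
    simp_rw [hK]
  · intro T A B hTA hA hB
    have hm : MeasurableSet[G.predictable.prod inferInstance] ((T ×ˢ A) ×ˢ B) :=
      @MeasurableSet.prod _ _ G.predictable _ _ _ hTA hB
    rw [Measure.map_apply measurable_timeMark hm, Measure.compProd_apply (measurable_timeMark hm),
      ← lintegral_indicator hA]
    congr 1 with ω
    by_cases hω : ω ∈ A
    · rw [Set.indicator_of_mem hω, hK, Measure.restrict_apply
        (measurable_prodMk_left (measurable_timeMark hm))]
      congr 1
      ext x
      simp only [quadrantBox, Set.mem_inter_iff, Set.mem_preimage, Set.mem_prod, hω, Set.mem_Iic]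
      tauto
    · rw [Set.indicator_of_notMem hω]
      convert measure_empty (μ := K ω)
      ext x
      simp [hω]
  · rw [Measure.map_apply measurable_timeMark MeasurableSet.univ, Set.preimage_univ,
      Measure.compProd_apply MeasurableSet.univ]
    simp_rw [hK]
    simp

namespace IsSimplePoissonMeasure

/-- The compensation formula: predictable fields have the same mean integral against the Poisson
measure and against its intensity. -/
theorem lintegral_lintegral_eq [IsProbabilityMeasure P] (h : IsSimplePoissonMeasure P G N) (hF : IsPredictableField G F) :
    ∫⁻ ω, ∫⁻ x, F x ω ∂N ω ∂P = ∫⁻ ω, (∫⁻ x, F x ω) ∂P := by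
  have hv : IsAdaptedRandomMeasure G fun _ : Ω => (volume : Measure (ℝ≥0 × ℝ≥0)) :=
    isAdaptedRandomMeasure_volume
  have hbox : ∀ n, ∫⁻ ω, ∫⁻ x in quadrantBox n, F x ω ∂N ω ∂P
      = ∫⁻ ω, (∫⁻ x in quadrantBox n, F x ω) ∂P := by
    intro n
    obtain ⟨M, hMF, hMr, -⟩ := h.toIsAdaptedRandomMeasure.setLIntegral_box_eq (P := P) n
    obtain ⟨M', hMF', hMr', hMu'⟩ := hv.setLIntegral_box_eq (P := P) n
    rw [hMF F hF, hMF' F hF]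
    congr 1
    symm
    have : IsFiniteMeasure M' := ⟨by
      rw [hMu', lintegral_const, measure_univ, mul_one]; exact volume_quadrantBox_lt_top n⟩
    refine @ext_prod_of_generateFrom _ _ G.predictable _ _ rfl (isPiSystem_predictable G)
      ({⊥} ×ˢ Set.univ) (Set.Ioi ⊥ ×ˢ Set.univ) (Or.inl ⟨_, MeasurableSet.univ, rfl⟩)
      (Or.inr ⟨_, _, MeasurableSet.univ, rfl⟩) ?_ ?_ M' M this ?_
    · exact Set.disjoint_prod.2 (Or.inl (by simp))
    · rw [← Set.union_prod, ← Set.univ_prod_univ]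
      congr 1
      ext u
      simp
    · rintro _ (⟨A, hA, rfl⟩ | ⟨i, A, hA, rfl⟩) B hB
      · rw [hMr _ _ _ (measurableSet_predictable_singleton_bot_prod hA) (G.le _ _ hA) hB,
          hMr' _ _ _ (measurableSet_predictable_singleton_bot_prod hA) (G.le _ _ hA) hB]
        -- Generators at time zero carry no mass for either measure: the Poisson measure has no
        -- point there and a vertical line is Lebesgue null.
        refine lintegral_congr fun ω => ?_
        have hsub : (({⊥} : Set ℝ≥0) ∩ Set.Iic (n : ℝ≥0)) ×ˢ (B ∩ Set.Iic (n : ℝ≥0))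
            ⊆ {0} ×ˢ Set.univ := Set.prod_mono Set.inter_subset_left (Set.subset_univ _)
        rw [measure_mono_null hsub (h.zero ω), measure_mono_null hsub]
        rw [Measure.volume_eq_prod, Measure.prod_prod]
        simp
      · rw [hMr _ _ _ (measurableSet_predictable_Ioi_prod hA) (G.le _ _ hA) hB,
          hMr' _ _ _ (measurableSet_predictable_Ioi_prod hA) (G.le _ _ hA) hB,
          Set.Ioi_inter_Iic, h.compensated i n n A B hA hB, setLIntegral_const, mul_comm]
  have hsup : ∀ (ν : Measure (ℝ≥0 × ℝ≥0)) ω,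
      ∫⁻ x, F x ω ∂ν = ⨆ n, ∫⁻ x in quadrantBox n, F x ω ∂ν := fun ν ω =>
    lintegral_eq_iSup_quadrantBox ν _
  rw [lintegral_congr fun ω => hsup (N ω) ω, lintegral_congr fun ω => hsup volume ω]
  have hres : ∀ {κ : Ω → Measure (ℝ≥0 × ℝ≥0)}, IsAdaptedRandomMeasure G κ → ∀ n,
      Measurable fun ω => ∫⁻ x in quadrantBox n, F x ω ∂κ ω := fun {κ} hκ n => by
    have hind : IsPredictableField G fun x ω => (quadrantBox n).indicator 1 x * F x ω :=
      (IsPredictableField.of_deterministic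
        (measurable_one.indicator (measurableSet_quadrantBox n))).mul hF
    convert hκ.measurable_lintegral hind using 2 with ω
    rw [← lintegral_indicator (measurableSet_quadrantBox n)]
    congr 1 with x
    by_cases hx : x ∈ quadrantBox n <;> simp [hx]
  rw [lintegral_iSup (hres h.toIsAdaptedRandomMeasure)
    (fun i j hij ω => lintegral_mono_set (quadrantBox_mono hij)),
    lintegral_iSup (hres hv) (fun i j hij ω => lintegral_mono_set (quadrantBox_mono hij))]
  simp_rw [hbox]

/-- A point whose singleton has mass below 1 has, by outer regularity, an open neighbourhood of mass
below 1, hence of mass 0 by integrality. A set that is null locally is null. -/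
theorem one_le_measure_singleton (h : IsSimplePoissonMeasure P G N) (ω : Ω) :
    ∀ᵐ x ∂N ω, 1 ≤ N ω {x} := by
  have : IsLocallyFiniteMeasure (N ω) := ⟨fun x => by
    obtain ⟨n, hn⟩ := exists_nat_gt (max x.1 x.2)
    refine ⟨quadrantBox n, ?_, h.finite ω n⟩
    exact prod_mem_nhds (Iic_mem_nhds ((le_max_left _ _).trans_lt hn))
      (Iic_mem_nhds ((le_max_right _ _).trans_lt hn))⟩
  rw [ae_iff]
  refine measure_null_of_locally_null _ fun x hx => ?_
  have hx1 : N ω {x} < 1 := not_le.1 hx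
  obtain ⟨U, hxU, hU, hU1⟩ := Set.exists_isOpen_lt_of_lt {x} 1 hx1
  refine ⟨U, mem_nhdsWithin_of_mem_nhds (hU.mem_nhds (hxU rfl)), ?_⟩
  obtain ⟨k, hk⟩ := h.natValued ω U hU.measurableSet
  rw [hk] at hU1 ⊢
  have : k < 1 := by exact_mod_cast hU1
  simp [Order.lt_one_iff.1 this]

/-- A typical point has mass at least 1 while its vertical line has mass at most 1, so the line
carries that atom and nothing else. This evaluates the diagonal term of the isometry. -/
theorem setLIntegral_singleton_prod (h : IsSimplePoissonMeasure P G N) (ω : Ω)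
    (g : ℝ≥0 × ℝ≥0 → ℝ≥0∞) :
    ∀ᵐ x ∂N ω, ∫⁻ y in {x.1} ×ˢ Set.univ, g y ∂N ω = g x := by
  filter_upwards [h.one_le_measure_singleton ω] with x hx
  have hsub : {x} ⊆ ({x.1} : Set ℝ≥0) ×ˢ (Set.univ : Set ℝ≥0) := by rintro _ rfl; simp
  have h1 : N ω {x} = 1 := le_antisymm ((measure_mono hsub).trans (h.simple ω x.1)) hx
  have h0 : N ω (({x.1} ×ˢ Set.univ) \ {x}) = 0 := by
    rw [measure_sdiff hsub (measurableSet_singleton x).nullMeasurableSet (by simp [h1]), h1]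
    exact tsub_eq_zero_of_le (h.simple ω x.1)
  have hae : (({x.1} : Set ℝ≥0) ×ˢ (Set.univ : Set ℝ≥0) : Set (ℝ≥0 × ℝ≥0))
      =ᵐ[N ω] ({x} : Set (ℝ≥0 × ℝ≥0)) := by
    refine Filter.EventuallyLE.antisymm ?_ hsub.eventuallyLE
    exact ae_le_set.2 h0
  rw [setLIntegral_congr hae, lintegral_singleton, h1, mul_one]

end IsSimplePoissonMeasure

/-- Splitting a product of integrals according to the order of the time components. -/
theorem lintegral_mul_lintegral_eq_add (a b : Measure (ℝ≥0 × ℝ≥0)) [SFinite a] [SFinite b]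
    {f g : ℝ≥0 × ℝ≥0 → ℝ≥0∞} (hf : Measurable f) (hg : Measurable g) :
    (∫⁻ x, f x ∂a) * ∫⁻ y, g y ∂b
      = ∫⁻ x, f x * (∫⁻ y in Set.Iio x.1 ×ˢ Set.univ, g y ∂b) ∂a
        + ∫⁻ x, f x * (∫⁻ y in {x.1} ×ˢ Set.univ, g y ∂b) ∂a
        + ∫⁻ y, g y * (∫⁻ x in Set.Iio y.1 ×ˢ Set.univ, f x ∂a) ∂b := by
  have hlt : MeasurableSet {p : (ℝ≥0 × ℝ≥0) × (ℝ≥0 × ℝ≥0) | p.2.1 < p.1.1} :=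
    measurableSet_lt (by fun_prop) (by fun_prop)
  have heq : MeasurableSet {p : (ℝ≥0 × ℝ≥0) × (ℝ≥0 × ℝ≥0) | p.2.1 = p.1.1} :=
    measurableSet_eq_fun (by fun_prop) (by fun_prop)
  have hgt : MeasurableSet {p : (ℝ≥0 × ℝ≥0) × (ℝ≥0 × ℝ≥0) | p.1.1 < p.2.1} :=
    measurableSet_lt (by fun_prop) (by fun_prop)
  have hg2 : Measurable fun p : (ℝ≥0 × ℝ≥0) × (ℝ≥0 × ℝ≥0) => g p.2 := by fun_prop
  have hfg2 : Measurable fun p : (ℝ≥0 × ℝ≥0) × (ℝ≥0 × ℝ≥0) => f p.1 * g p.2 := by fun_prop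
  have m1 := (hg2.indicator hlt).lintegral_prod_right' (ν := b)
  have m2 := (hg2.indicator heq).lintegral_prod_right' (ν := b)
  have split : ∀ x, ∫⁻ y, g y ∂b = ∫⁻ y in Set.Iio x ×ˢ Set.univ, g y ∂b
      + ∫⁻ y in {x} ×ˢ Set.univ, g y ∂b + ∫⁻ y in Set.Ioi x ×ˢ Set.univ, g y ∂b := fun x => by
    rw [← lintegral_union ((measurableSet_singleton x).prod MeasurableSet.univ)
        (Set.disjoint_prod.2 (Or.inl (by simp))),
      ← lintegral_union (measurableSet_Ioi.prod MeasurableSet.univ), ← Set.union_prod,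
      ← Set.union_prod]
    · have : Set.Iio x ∪ {x} ∪ Set.Ioi x = Set.univ := by
        ext u; simp only [Set.mem_union, Set.mem_Iio, Set.mem_singleton_iff, Set.mem_Ioi,
          Set.mem_univ, iff_true]
        rcases lt_trichotomy u x with h | h | h <;> simp [h]
      rw [this, Set.univ_prod_univ, setLIntegral_univ]
    · rw [← Set.union_prod]
      refine Set.disjoint_prod.2 (Or.inl ?_)
      rw [Set.disjoint_left]
      rintro u (hu | hu) hu'
      · exact lt_asymm (Set.mem_Iio.1 hu) (Set.mem_Ioi.1 hu')
      · exact absurd hu' (by simp [Set.mem_singleton_iff.1 hu])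
  -- The mark 0 is a dummy: only the time component enters the condition.
  have e1 : ∀ x, ∫⁻ y in Set.Iio x ×ˢ Set.univ, g y ∂b = ∫⁻ y, {p : (ℝ≥0 × ℝ≥0) × (ℝ≥0 × ℝ≥0) |
      p.2.1 < p.1.1}.indicator (fun p => g p.2) ((x, 0), y) ∂b := fun x => by
    rw [← lintegral_indicator (measurableSet_Iio.prod MeasurableSet.univ)]
    congr 1 with y
    by_cases hy : y.1 < x <;> simp [Set.indicator, hy]
  have e2 : ∀ x, ∫⁻ y in {x} ×ˢ Set.univ, g y ∂b = ∫⁻ y, {p : (ℝ≥0 × ℝ≥0) × (ℝ≥0 × ℝ≥0) |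
      p.2.1 = p.1.1}.indicator (fun p => g p.2) ((x, 0), y) ∂b := fun x => by
    rw [← lintegral_indicator ((measurableSet_singleton x).prod MeasurableSet.univ)]
    congr 1 with y
    by_cases hy : y.1 = x <;> simp [Set.indicator, hy]
  have m1' : Measurable fun x : ℝ≥0 × ℝ≥0 => ∫⁻ y in Set.Iio x.1 ×ˢ Set.univ, g y ∂b := by
    simp_rw [e1]
    exact m1.comp (g := fun x => ∫⁻ y, {p : (ℝ≥0 × ℝ≥0) × (ℝ≥0 × ℝ≥0) |
      p.2.1 < p.1.1}.indicator (fun p => g p.2) (x, y) ∂b) (f := fun x : ℝ≥0 × ℝ≥0 => (x.1, (0 : ℝ≥0)))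
      (by fun_prop)
  have m2' : Measurable fun x : ℝ≥0 × ℝ≥0 => ∫⁻ y in {x.1} ×ˢ Set.univ, g y ∂b := by
    simp_rw [e2]
    exact m2.comp (g := fun x => ∫⁻ y, {p : (ℝ≥0 × ℝ≥0) × (ℝ≥0 × ℝ≥0) |
      p.2.1 = p.1.1}.indicator (fun p => g p.2) (x, y) ∂b) (f := fun x : ℝ≥0 × ℝ≥0 => (x.1, (0 : ℝ≥0)))
      (by fun_prop)
  have swap : ∫⁻ x, f x * (∫⁻ y in Set.Ioi x.1 ×ˢ Set.univ, g y ∂b) ∂a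
      = ∫⁻ y, g y * (∫⁻ x in Set.Iio y.1 ×ˢ Set.univ, f x ∂a) ∂b := by
    have l : ∀ x : ℝ≥0 × ℝ≥0, f x * (∫⁻ y in Set.Ioi x.1 ×ˢ Set.univ, g y ∂b)
        = ∫⁻ y, {p : (ℝ≥0 × ℝ≥0) × (ℝ≥0 × ℝ≥0) | p.1.1 < p.2.1}.indicator
          (fun p => f p.1 * g p.2) (x, y) ∂b := fun x => by
      rw [← lintegral_const_mul _ hg, ← lintegral_indicator (measurableSet_Ioi.prod MeasurableSet.univ)]
      congr 1 with y
      by_cases hy : x.1 < y.1 <;> simp [Set.indicator, hy]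
    have r : ∀ y : ℝ≥0 × ℝ≥0, g y * (∫⁻ x in Set.Iio y.1 ×ˢ Set.univ, f x ∂a)
        = ∫⁻ x, {p : (ℝ≥0 × ℝ≥0) × (ℝ≥0 × ℝ≥0) | p.1.1 < p.2.1}.indicator
          (fun p => f p.1 * g p.2) (x, y) ∂a := fun y => by
      rw [← lintegral_const_mul _ hf, ← lintegral_indicator (measurableSet_Iio.prod MeasurableSet.univ)]
      congr 1 with x
      by_cases hy : x.1 < y.1 <;> simp [Set.indicator, hy, mul_comm]
    simp_rw [l, r]
    exact lintegral_lintegral_swap (hfg2.indicator hgt).aemeasurable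
  have m1f : Measurable fun x => f x * ∫⁻ y in Set.Iio x.1 ×ˢ Set.univ, g y ∂b := hf.mul m1'
  have m2f : Measurable fun x => f x * ∫⁻ y in {x.1} ×ˢ Set.univ, g y ∂b := hf.mul m2'
  have m12 : Measurable fun x => f x * (∫⁻ y in Set.Iio x.1 ×ˢ Set.univ, g y ∂b)
      + f x * ∫⁻ y in {x.1} ×ˢ Set.univ, g y ∂b := m1f.add m2f
  rw [← swap, ← lintegral_add_left m1f, ← lintegral_add_left m12,
    ← lintegral_mul_const _ hf]
  refine lintegral_congr fun x => ?_
  rw [split x.1, mul_add, mul_add]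

theorem volume_singleton_prod_univ (u : ℝ≥0) :
    volume (({u} : Set ℝ≥0) ×ˢ (Set.univ : Set ℝ≥0)) = 0 := by
  rw [Measure.volume_eq_prod, Measure.prod_prod]; simp

/-- The isometry formula for compensated integrals of predictable fields, written with
nonnegative terms only. -/
theorem IsSimplePoissonMeasure.isometry [IsProbabilityMeasure P] (h : IsSimplePoissonMeasure P G N)
    (hF : IsPredictableField G F) (hF' : IsPredictableField G F') :
    ∫⁻ ω, (∫⁻ x, F x ω ∂N ω) * (∫⁻ x, F' x ω ∂N ω) ∂P + ∫⁻ ω, (∫⁻ x, F x ω) * (∫⁻ x, F' x ω) ∂P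
      = ∫⁻ ω, (∫⁻ x, F x ω ∂N ω) * (∫⁻ x, F' x ω) ∂P
        + ∫⁻ ω, (∫⁻ x, F x ω) * (∫⁻ x, F' x ω ∂N ω) ∂P
        + ∫⁻ ω, (∫⁻ x, F x ω * F' x ω) ∂P := by
  have hv : IsAdaptedRandomMeasure G fun _ : Ω => (volume : Measure (ℝ≥0 × ℝ≥0)) :=
    isAdaptedRandomMeasure_volume
  have hN := h.toIsAdaptedRandomMeasure
  have hsN := hN.sFinite
  have mF : ∀ ω, Measurable fun x => F x ω := fun ω =>
    hF.measurable_uncurry.comp measurable_prodMk_left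
  have mF' : ∀ ω, Measurable fun x => F' x ω := fun ω =>
    hF'.measurable_uncurry.comp measurable_prodMk_left
  -- The inner integral over the strict past is predictable, so the compensation formula applies to
  -- each iterated integral.
  have hF2 : ∀ {κ : Ω → Measure (ℝ≥0 × ℝ≥0)} {F F' : ℝ≥0 × ℝ≥0 → Ω → ℝ≥0∞},
      IsAdaptedRandomMeasure G κ → IsPredictableField G F → IsPredictableField G F' →
      IsPredictableField G fun x ω => F x ω * ∫⁻ y in Set.Iio x.1 ×ˢ Set.univ, F' y ω ∂κ ω :=
    fun hκ h1 h2 => h1.mul (hκ.isPredictableProcess_setLIntegral_Iio h2).field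
  have aNN' := hF2 hN hF hF'
  have aN'N := hF2 hN hF' hF
  have avv' := hF2 hv hF hF'
  have av'v := hF2 hv hF' hF
  have vol0 : ∀ (u : ℝ≥0) (g : ℝ≥0 × ℝ≥0 → ℝ≥0∞), ∫⁻ y in {u} ×ˢ Set.univ, g y = 0 :=
    fun u g => setLIntegral_measure_zero _ _ (volume_singleton_prod_univ u)
  have eNN : ∀ ω, (∫⁻ x, F x ω ∂N ω) * (∫⁻ x, F' x ω ∂N ω)
      = ∫⁻ x, F x ω * (∫⁻ y in Set.Iio x.1 ×ˢ Set.univ, F' y ω ∂N ω) ∂N ω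
        + ∫⁻ x, F x ω * F' x ω ∂N ω
        + ∫⁻ y, F' y ω * (∫⁻ x in Set.Iio y.1 ×ˢ Set.univ, F x ω ∂N ω) ∂N ω := fun ω => by
    rw [lintegral_mul_lintegral_eq_add _ _ (mF ω) (mF' ω)]
    congr 2
    refine lintegral_congr_ae ?_
    filter_upwards [h.setLIntegral_singleton_prod ω (fun y => F' y ω)] with x hx
    rw [hx]
  have eNv : ∀ ω, (∫⁻ x, F x ω ∂N ω) * (∫⁻ x, F' x ω)
      = ∫⁻ x, F x ω * (∫⁻ y in Set.Iio x.1 ×ˢ Set.univ, F' y ω) ∂N ω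
        + ∫⁻ y, F' y ω * (∫⁻ x in Set.Iio y.1 ×ˢ Set.univ, F x ω ∂N ω) := fun ω => by
    rw [lintegral_mul_lintegral_eq_add _ _ (mF ω) (mF' ω)]
    simp only [vol0, mul_zero, lintegral_zero, add_zero]
  have evN : ∀ ω, (∫⁻ x, F x ω) * (∫⁻ x, F' x ω ∂N ω)
      = ∫⁻ x, F' x ω * (∫⁻ y in Set.Iio x.1 ×ˢ Set.univ, F y ω) ∂N ω
        + ∫⁻ y, F y ω * (∫⁻ x in Set.Iio y.1 ×ˢ Set.univ, F' x ω ∂N ω) := fun ω => by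
    rw [mul_comm, lintegral_mul_lintegral_eq_add _ _ (mF' ω) (mF ω)]
    simp only [vol0, mul_zero, lintegral_zero, add_zero]
  have evv : ∀ ω, (∫⁻ x, F x ω) * (∫⁻ x, F' x ω)
      = (∫⁻ x, F x ω * (∫⁻ y in Set.Iio x.1 ×ˢ Set.univ, F' y ω))
        + ∫⁻ y, F' y ω * (∫⁻ x in Set.Iio y.1 ×ˢ Set.univ, F x ω) := fun ω => by
    rw [lintegral_mul_lintegral_eq_add _ _ (mF ω) (mF' ω)]
    simp only [vol0, mul_zero, lintegral_zero, add_zero]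
  simp_rw [eNN, eNv, evN, evv]
  have mNN : Measurable fun ω =>
      ∫⁻ x, F x ω * (∫⁻ y in Set.Iio x.1 ×ˢ Set.univ, F' y ω ∂N ω) ∂N ω
        + ∫⁻ x, F x ω * F' x ω ∂N ω :=
    (hN.measurable_lintegral aNN').add (hN.measurable_lintegral (hF.mul hF'))
  -- Compensation replaces every outer Poisson integral by a Lebesgue one; both sides then list the
  -- same five terms.
  rw [lintegral_add_left mNN,
    lintegral_add_left (hN.measurable_lintegral aNN'),
    lintegral_add_left (hN.measurable_lintegral avv'),
    lintegral_add_left (hN.measurable_lintegral av'v),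
    lintegral_add_left (hv.measurable_lintegral avv'),
    h.lintegral_lintegral_eq aNN', h.lintegral_lintegral_eq aN'N, h.lintegral_lintegral_eq avv',
    h.lintegral_lintegral_eq av'v, h.lintegral_lintegral_eq (hF.mul hF')]
  ring

end Compensation

/-! ### Poisson random measures -/

section PoissonLaw

theorem lintegral_natCast_poissonMeasure (r : ℝ≥0) : ∫⁻ n : ℕ, (n : ℝ≥0∞) ∂poissonMeasure r = r := by
  have h1 : ∀ n : ℕ, ((n + 1 : ℕ) : ℝ≥0∞) * poissonMeasure r {n + 1} = r * poissonMeasure r {n} := by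
    intro n
    rw [poissonMeasure_singleton, poissonMeasure_singleton, ← ENNReal.ofReal_natCast,
      ← ENNReal.ofReal_coe_nnreal, ← ENNReal.ofReal_mul (by positivity),
      ← ENNReal.ofReal_mul (by positivity)]
    congr 1
    rw [Nat.factorial_succ]
    push_cast
    field_simp
    ring
  rw [lintegral_countable', tsum_eq_zero_add' ENNReal.summable]
  simp_rw [h1]
  rw [ENNReal.tsum_mul_left]
  have h2 : ∑' n, poissonMeasure r {n} = 1 := by
    have := lintegral_countable' (μ := poissonMeasure r) (fun _ => 1)
    simpa using this.symm
  simp [h2]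

theorem poissonMeasure_one_lt_le (r : ℝ≥0) : poissonMeasure r {n | 1 < n} ≤ (r : ℝ≥0∞) ^ 2 := by
  have hc : {n : ℕ | 1 < n} = ({0} ∪ {1})ᶜ := by ext n; simp; omega
  -- With this bound, 1 - e^{-r}(1 + r) ≤ 1 - (1 - r)(1 + r) = r².
  have hx : (1 - (r : ℝ)) ≤ Real.exp (-r) := by
    have := Real.add_one_le_exp (-(r : ℝ)); linarith
  have h01 : poissonMeasure r ({0} ∪ {1}) = ENNReal.ofReal (Real.exp (-r) * (1 + r)) := by
    rw [measure_union (by simp) (measurableSet_singleton _), poissonMeasure_singleton,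
      poissonMeasure_singleton, ← ENNReal.ofReal_add (by positivity) (by positivity)]
    congr 1
    simp
    ring
  rw [hc, prob_compl_eq_one_sub (.of_discrete), h01, ← ENNReal.ofReal_one,
    ← ENNReal.ofReal_sub _ (by positivity), ← ENNReal.ofReal_coe_nnreal,
    ← ENNReal.ofReal_pow (by positivity)]
  refine ENNReal.ofReal_le_ofReal ?_
  have hr : (0 : ℝ) ≤ r := r.2
  nlinarith

end PoissonLaw

/-! ### Integer values from a countable π-system -/

section Borel

/-- A countable generating family is what allows an almost sure statement about each set to hold for
all of them at once. -/
theorem nnreal_eq_generateFrom_Iic_rat : NNReal.measurableSpace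
    = MeasurableSpace.generateFrom (Set.range fun q : ℚ => Set.Iic (Real.toNNReal q)) := by
  refine le_antisymm ?_ ?_
  · rw [BorelSpace.measurable_eq (α := ℝ≥0), borel_eq_generateFrom_Iic]
    refine MeasurableSpace.generateFrom_le ?_
    rintro _ ⟨a, rfl⟩
    have : Set.Iic a = ⋂ q : {q : ℚ // a < Real.toNNReal q}, Set.Iic (Real.toNNReal q) := by
      ext u
      simp only [Set.mem_Iic, Set.mem_iInter]
      constructor
      · exact fun hu q => hu.trans q.2.le
      · intro h
        by_contra hlt
        obtain ⟨q, _, h1, h2⟩ := NNReal.lt_iff_exists_rat_btwn a u |>.1 (not_le.1 hlt)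
        exact absurd (h ⟨q, h1⟩) (not_le.2 h2)
    rw [this]
    exact MeasurableSet.iInter fun q =>
      MeasurableSpace.measurableSet_generateFrom ⟨q, rfl⟩
  · refine MeasurableSpace.generateFrom_le ?_
    rintro _ ⟨q, rfl⟩
    exact measurableSet_Iic

/-- The countable π-system of quadrants with rational corners. -/
def rationalQuadrants : Set (Set (ℝ≥0 × ℝ≥0)) :=
  Set.image2 (· ×ˢ ·) (Set.range fun q : ℚ => Set.Iic (Real.toNNReal q))
    (Set.range fun q : ℚ => Set.Iic (Real.toNNReal q))

theorem generateFrom_rationalQuadrants :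
    (inferInstance : MeasurableSpace (ℝ≥0 × ℝ≥0)) = MeasurableSpace.generateFrom rationalQuadrants := by
  have hs : IsCountablySpanning (Set.range fun q : ℚ => Set.Iic (Real.toNNReal q)) := by
    refine ⟨fun n => Set.Iic (n : ℝ≥0), fun n => ⟨n, by simp⟩, ?_⟩
    exact Set.eq_univ_of_forall fun x => Set.mem_iUnion.2 (exists_nat_ge x)
  rw [rationalQuadrants, ← generateFrom_prod_eq hs hs, ← nnreal_eq_generateFrom_Iic_rat]

theorem isPiSystem_rationalQuadrants : IsPiSystem rationalQuadrants := by
  have h : IsPiSystem (Set.range fun q : ℚ => Set.Iic (Real.toNNReal q)) := by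
    rintro _ ⟨p, rfl⟩ _ ⟨q, rfl⟩ -
    refine ⟨min p q, ?_⟩
    rw [Set.Iic_inter_Iic]
    rcases le_total p q with h | h
    · rw [min_eq_left h, min_eq_left (Real.toNNReal_le_toNNReal (by exact_mod_cast h))]
    · rw [min_eq_right h, min_eq_right (Real.toNNReal_le_toNNReal (by exact_mod_cast h))]
  exact h.prod h

theorem isClosed_range_enatCast : IsClosed (Set.range ((↑) : ℕ∞ → ℝ≥0∞)) :=
  ENat.isClosedEmbedding_toENNReal.isClosed_range

/-- Inside a finite box, integrality passes to complements by subtraction and to disjoint unions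
because the extended naturals are closed in [0, ∞]; the same closedness handles the limit over
boxes. -/
theorem enat_valued_of_rationalQuadrants {ν : Measure (ℝ≥0 × ℝ≥0)}
    (hfin : ∀ n, ν (quadrantBox n) < ∞)
    (h : ∀ C ∈ rationalQuadrants, ∃ k : ℕ∞, ν C = k) {C : Set (ℝ≥0 × ℝ≥0)} (hC : MeasurableSet C) :
    ∃ k : ℕ∞, ν C = k := by
  have hbox : ∀ n, quadrantBox n ∈ rationalQuadrants := fun n =>
    ⟨_, ⟨n, rfl⟩, _, ⟨n, rfl⟩, by simp [quadrantBox]⟩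
  have key : ∀ n, ∀ C, MeasurableSet C → ∃ k : ℕ∞, ν (C ∩ quadrantBox n) = k := by
    intro n C hC
    induction C, hC using MeasurableSpace.induction_on_inter generateFrom_rationalQuadrants
      isPiSystem_rationalQuadrants with
    | empty => exact ⟨0, by simp⟩
    | basic C hC =>
      rcases (C ∩ quadrantBox n).eq_empty_or_nonempty with he | hne
      · exact ⟨0, by simp [he]⟩
      · exact h _ (isPiSystem_rationalQuadrants _ hC _ (hbox n) hne)
    | compl C hC ih =>
      obtain ⟨k, hk⟩ := ih
      obtain ⟨l, hl⟩ := h _ (hbox n)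
      refine ⟨l - k, ?_⟩
      have : Cᶜ ∩ quadrantBox n = quadrantBox n \ (C ∩ quadrantBox n) := by ext; simp; tauto
      rw [this, measure_sdiff Set.inter_subset_right
        (hC.inter (measurableSet_quadrantBox n)).nullMeasurableSet
        ((measure_mono Set.inter_subset_right).trans_lt (hfin n)).ne, hk, hl, ENat.toENNReal_sub]
    | iUnion f hd hf ih =>
      choose k hk using ih
      have hsum : ν ((⋃ i, f i) ∩ quadrantBox n) = ∑' i, (k i : ℝ≥0∞) := by
        rw [Set.iUnion_inter, measure_iUnion _ fun i => (hf i).inter (measurableSet_quadrantBox n)]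
        · simp_rw [hk]
        · exact fun i j hij => (hd hij).mono Set.inter_subset_left Set.inter_subset_left
      have hmem : ν ((⋃ i, f i) ∩ quadrantBox n) ∈ Set.range ((↑) : ℕ∞ → ℝ≥0∞) := by
        rw [hsum]
        refine isClosed_range_enatCast.mem_of_tendsto ENNReal.summable.hasSum.tendsto_sum_nat
          (Filter.Eventually.of_forall fun m => ⟨∑ i ∈ Finset.range m, k i, ?_⟩)
        exact map_sum ENat.toENNRealRingHom _ _
      obtain ⟨l, hl⟩ := hmem
      exact ⟨l, hl.symm⟩
  have hlim : Filter.Tendsto (fun n => ν (C ∩ quadrantBox n)) Filter.atTop (nhds (ν C)) := by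
    have := tendsto_measure_iUnion_atTop (μ := ν) (s := fun n => C ∩ quadrantBox n)
      fun i j hij => Set.inter_subset_inter_right _ (quadrantBox_mono hij)
    rwa [← Set.inter_iUnion, iUnion_quadrantBox, Set.inter_univ] at this
  have hmem : ν C ∈ Set.range ((↑) : ℕ∞ → ℝ≥0∞) :=
    isClosed_range_enatCast.mem_of_tendsto hlim (Filter.Eventually.of_forall fun n => by
      obtain ⟨k, hk⟩ := key n C hC
      exact ⟨k, hk.symm⟩)
  obtain ⟨l, hl⟩ := hmem
  exact ⟨l, hl.symm⟩

end Borel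

/-! ### Almost sure regularity of Poisson random measures -/

namespace IsPoissonRandomMeasure

variable {Ω : Type*} {mΩ : MeasurableSpace Ω} {P : Measure Ω}
  {N : Ω → Measure (ℝ≥0 × ℝ≥0)}

theorem measurable_apply (h : IsPoissonRandomMeasure P N) {A : Set (ℝ≥0 × ℝ≥0)}
    (hA : MeasurableSet A) : Measurable fun ω => N ω A :=
  (Measure.measurable_coe hA).comp h.measurable

theorem lintegral_apply (h : IsPoissonRandomMeasure P N) {A : Set (ℝ≥0 × ℝ≥0)}
    (hA : MeasurableSet A) (hA' : volume A ≠ ∞) : ∫⁻ ω, N ω A ∂P = volume A := by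
  have := lintegral_map (μ := P) (f := id) measurable_id (h.measurable_apply hA)
  simp only [id] at this
  rw [← this, h.law A hA hA', lintegral_map measurable_id' (.of_discrete),
    lintegral_natCast_poissonMeasure, ENNReal.coe_toNNReal hA']

theorem measure_one_lt_le (h : IsPoissonRandomMeasure P N) {A : Set (ℝ≥0 × ℝ≥0)}
    (hA : MeasurableSet A) (hA' : volume A ≠ ∞) : P {ω | 1 < N ω A} ≤ volume A ^ 2 := by
  have h1 : P {ω | 1 < N ω A} = P.map (fun ω => N ω A) (Set.Ioi 1) := by
    rw [Measure.map_apply (h.measurable_apply hA) measurableSet_Ioi]; rfl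
  rw [h1, h.law A hA hA', Measure.map_apply (.of_discrete) measurableSet_Ioi]
  have h2 : (fun n : ℕ => (n : ℝ≥0∞)) ⁻¹' Set.Ioi 1 = {n | 1 < n} := by
    ext n; simp
  rw [h2]
  refine (poissonMeasure_one_lt_le _).trans ?_
  rw [ENNReal.coe_toNNReal hA']

theorem ae_enat (h : IsPoissonRandomMeasure P N) {A : Set (ℝ≥0 × ℝ≥0)}
    (hA : MeasurableSet A) (hA' : volume A ≠ ∞) : ∀ᵐ ω ∂P, ∃ k : ℕ∞, N ω A = k := by
  have hcl : MeasurableSet (Set.range ((↑) : ℕ∞ → ℝ≥0∞)) := isClosed_range_enatCast.measurableSet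
  have h1 : P.map (fun ω => N ω A) (Set.range ((↑) : ℕ∞ → ℝ≥0∞))ᶜ = 0 := by
    rw [h.law A hA hA', Measure.map_apply (.of_discrete) hcl.compl]
    convert measure_empty (μ := poissonMeasure (volume A).toNNReal)
    ext n
    simp only [Set.mem_preimage, Set.mem_compl_iff, Set.mem_range, Set.mem_empty_iff_false,
      iff_false, not_not]
    exact ⟨n, by simp⟩
  rw [Measure.map_apply (h.measurable_apply hA) hcl.compl] at h1
  filter_upwards [compl_mem_ae_iff.2 h1] with ω hω
  have : N ω A ∈ Set.range ((↑) : ℕ∞ → ℝ≥0∞) := by simpa using hω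
  obtain ⟨k, hk⟩ := this
  exact ⟨k, hk.symm⟩

theorem ae_finite (h : IsPoissonRandomMeasure P N) {A : Set (ℝ≥0 × ℝ≥0)}
    (hA : MeasurableSet A) (hA' : volume A ≠ ∞) : ∀ᵐ ω ∂P, N ω A < ∞ :=
  ae_lt_top (h.measurable_apply hA) (by rw [h.lintegral_apply hA hA']; exact hA')

theorem ae_natValued (h : IsPoissonRandomMeasure P N) :
    ∀ᵐ ω ∂P, ∀ C, MeasurableSet C → ∃ k : ℕ∞, N ω C = k := by
  have h1 : ∀ᵐ ω ∂P, ∀ n, N ω (quadrantBox n) < ∞ := ae_all_iff.2 fun n =>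
    h.ae_finite (measurableSet_quadrantBox n) (volume_quadrantBox_lt_top n).ne
  have h2 : ∀ᵐ ω ∂P, ∀ p q : ℚ, ∃ k : ℕ∞,
      N ω (Set.Iic (Real.toNNReal p) ×ˢ Set.Iic (Real.toNNReal q)) = k :=
    ae_all_iff.2 fun p => ae_all_iff.2 fun q =>
      h.ae_enat (measurableSet_Iic.prod measurableSet_Iic) (by
        rw [Measure.volume_eq_prod, Measure.prod_prod, volume_nnreal_Iic, volume_nnreal_Iic]
        exact ENNReal.mul_ne_top ENNReal.coe_ne_top ENNReal.coe_ne_top)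
  filter_upwards [h1, h2] with ω h1 h2 C hC
  refine enat_valued_of_rationalQuadrants h1 ?_ hC
  rintro _ ⟨_, ⟨p, rfl⟩, _, ⟨q, rfl⟩, rfl⟩
  exact h2 p q

theorem ae_zero (h : IsPoissonRandomMeasure P N) :
    ∀ᵐ ω ∂P, N ω ({0} ×ˢ Set.univ) = 0 := by
  have hm : MeasurableSet (({0} : Set ℝ≥0) ×ˢ (Set.univ : Set ℝ≥0)) :=
    (measurableSet_singleton _).prod MeasurableSet.univ
  have hv := volume_singleton_prod_univ 0
  refine (lintegral_eq_zero_iff (h.measurable_apply hm)).1 ?_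
  rw [h.lintegral_apply hm (by rw [hv]; simp), hv]

/-- Cut `[0, m) × [0, m]` into `n` vertical strips of area m²/n. Some strip holds two points with
probability at most n (m²/n)² = m⁴/n, which tends to 0. Hence almost surely, for every `m`, some `n`
leaves at most one point per strip, and every vertical line lies in a strip. -/
theorem ae_simple (h : IsPoissonRandomMeasure P N) :
    ∀ᵐ ω ∂P, ∀ u, N ω ({u} ×ˢ Set.univ) ≤ 1 := by
  let I : ℕ → ℕ → ℕ → Set (ℝ≥0 × ℝ≥0) := fun m n k =>
    Set.Ico ((m : ℝ≥0) * k / n) ((m : ℝ≥0) * (k + 1) / n) ×ˢ Set.Iic (m : ℝ≥0)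
  have hIm : ∀ m n k, MeasurableSet (I m n k) := fun m n k =>
    measurableSet_Ico.prod measurableSet_Iic
  have hI : ∀ m n k, volume (I m n k) = (((m : ℝ≥0) * m / n : ℝ≥0) : ℝ≥0∞) := fun m n k => by
    simp only [I]
    rw [Measure.volume_eq_prod, Measure.prod_prod, volume_nnreal_Ico, volume_nnreal_Iic,
      ← ENNReal.coe_mul]
    congr 1
    rw [← tsub_div, mul_add, add_tsub_cancel_left]
    ring
  have h1 : ∀ m : ℕ, ∀ᵐ ω ∂P, ∃ n : ℕ, 0 < n ∧ ∀ k < n, N ω (I m n k) ≤ 1 := by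
    intro m
    have hb : ∀ n : ℕ, 0 < n → P {ω | ¬ ∃ n : ℕ, 0 < n ∧ ∀ k < n, N ω (I m n k) ≤ 1}
        ≤ (((m : ℝ≥0) ^ 4 / n : ℝ≥0) : ℝ≥0∞) := by
      intro n hn
      calc P {ω | ¬ ∃ n : ℕ, 0 < n ∧ ∀ k < n, N ω (I m n k) ≤ 1}
          ≤ P (⋃ k ∈ Finset.range n, {ω | 1 < N ω (I m n k)}) := by
            refine measure_mono fun ω hω => ?_
            rw [Set.mem_ofPred_eq] at hω
            push Not at hω
            obtain ⟨k, hk, hk'⟩ := hω n hn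
            simp only [Set.mem_iUnion, Finset.mem_range]
            exact ⟨k, hk, hk'⟩
        _ ≤ ∑ k ∈ Finset.range n, P {ω | 1 < N ω (I m n k)} := measure_biUnion_finset_le _ _
        _ ≤ ∑ k ∈ Finset.range n, (((m : ℝ≥0) * m / n : ℝ≥0) : ℝ≥0∞) ^ 2 :=
            Finset.sum_le_sum fun k _ => by
              rw [← hI m n k]
              exact h.measure_one_lt_le (hIm m n k) (by rw [hI]; exact ENNReal.coe_ne_top)
        _ = (((m : ℝ≥0) ^ 4 / n : ℝ≥0) : ℝ≥0∞) := by
            rw [Finset.sum_const, Finset.card_range, nsmul_eq_mul]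
            have : (n : ℝ≥0) ≠ 0 := by exact_mod_cast hn.ne'
            rw [← ENNReal.coe_pow, ← ENNReal.coe_natCast, ← ENNReal.coe_mul]
            congr 1
            field_simp
    refine le_antisymm (ge_of_tendsto (x := Filter.atTop) ?_
      (Filter.eventually_atTop.2 ⟨1, fun n hn => hb n hn⟩)) zero_le
    have : Filter.Tendsto (fun n : ℕ => (m : ℝ≥0) ^ 4 / (n : ℝ≥0)) Filter.atTop (nhds 0) :=
      tendsto_const_div_atTop_nhds_zero_nat _
    simpa only [ENNReal.coe_zero] using ENNReal.tendsto_coe.2 this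
  filter_upwards [ae_all_iff.2 h1] with ω hω u
  have hU : ({u} : Set ℝ≥0) ×ˢ (Set.univ : Set ℝ≥0)
      = ⋃ m : ℕ, ({u} : Set ℝ≥0) ×ˢ Set.Iic (m : ℝ≥0) := by
    rw [← Set.prod_iUnion]
    congr 1
    exact (Set.eq_univ_of_forall fun x => Set.mem_iUnion.2 (exists_nat_ge x)).symm
  have hmono : Monotone fun m : ℕ => ({u} : Set ℝ≥0) ×ˢ Set.Iic (m : ℝ≥0) := fun i j hij =>
    Set.prod_mono le_rfl (Set.Iic_subset_Iic.2 (by exact_mod_cast hij))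
  rw [hU]
  obtain ⟨m₀, hm₀⟩ := exists_nat_gt u
  refine le_of_tendsto (tendsto_measure_iUnion_atTop hmono)
    (Filter.eventually_atTop.2 ⟨m₀, fun m hm => ?_⟩)
  obtain ⟨n, hn, hk⟩ := hω m
  have hum : u < m := hm₀.trans_le (by exact_mod_cast hm)
  have hmpos : (0 : ℝ≥0) < m := (zero_le).trans_lt hum
  have hnpos : (0 : ℝ≥0) < n := by exact_mod_cast hn
  -- The index of the strip containing time `u`; `u < m` guarantees `k < n`.
  set k := ⌊u * n / m⌋₊ with hkdef
  have hk1 : (k : ℝ≥0) ≤ u * n / m := Nat.floor_le zero_le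
  have hk2 : u * n / m < k + 1 := Nat.lt_floor_add_one _
  have hkn : k < n := by
    have : (k : ℝ≥0) < n := hk1.trans_lt (by
      rw [div_lt_iff₀ hmpos, mul_comm]; exact mul_lt_mul_of_pos_left hum hnpos)
    exact_mod_cast this
  refine (measure_mono ?_).trans (hk k hkn)
  refine Set.prod_mono (Set.singleton_subset_iff.2 ⟨?_, ?_⟩) le_rfl
  · rw [div_le_iff₀ hnpos]
    rw [le_div_iff₀ hmpos] at hk1
    rwa [mul_comm]
  · rw [lt_div_iff₀ hnpos]
    rw [div_lt_iff₀ hmpos] at hk2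
    rwa [mul_comm (m : ℝ≥0)]

end IsPoissonRandomMeasure

/-! ### Independence of past and future, and a regular version -/

namespace IsPoissonRandomMeasure

variable {Ω : Type*} {mΩ : MeasurableSpace Ω} {P : Measure Ω}
  {N : Ω → Measure (ℝ≥0 × ℝ≥0)}

/-- The value of `N` on a set is independent of its values on finitely many sets disjoint from
it. -/
theorem indepFun_of_disjoint (h : IsPoissonRandomMeasure P N) {τ : Type*} [Fintype τ]
    (C : τ → Set (ℝ≥0 × ℝ≥0)) (hC : ∀ i, MeasurableSet (C i)) {D : Set (ℝ≥0 × ℝ≥0)}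
    (hD : MeasurableSet D) (hd : ∀ i, Disjoint D (C i)) :
    IndepFun (fun ω => N ω D) (fun ω i => N ω (C i)) P := by
  classical
  -- `none` stands for `D` itself, `some S` for the points outside `D` with membership pattern `S`
  -- in the sets `C i`. These atoms are disjoint, so the values of `N` on them are independent.
  let atom : Option (τ → Bool) → Set (ℝ≥0 × ℝ≥0) := fun o =>
    o.elim D fun S => Dᶜ ∩ ⋂ i, {x | x ∈ C i ↔ S i = true}
  have hatom : ∀ o, MeasurableSet (atom o) := by
    rintro (_ | S)
    · exact hD
    · refine hD.compl.inter (MeasurableSet.iInter fun i => ?_)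
      by_cases hS : S i = true
      · simp only [hS, iff_true]
        exact hC i
      · simp only [Bool.not_eq_true _ ▸ hS, Bool.false_eq_true, iff_false]
        exact (hC i).compl
  have hdisj : Pairwise fun i j => Disjoint (atom i) (atom j) := by
    rintro (_ | S) (_ | S') hne
    · exact absurd rfl hne
    · exact Set.disjoint_left.2 fun x hx hx' => hx'.1 hx
    · exact Set.disjoint_left.2 fun x hx hx' => hx.1 hx'
    · refine Set.disjoint_left.2 fun x hx hx' => hne ?_
      congr 1
      ext i
      have h1 := Set.mem_iInter.1 hx.2 i
      have h2 := Set.mem_iInter.1 hx'.2 i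
      simp only [Set.mem_ofPred_eq] at h1 h2
      rw [Bool.eq_iff_iff, ← h1, ← h2]
  let e := Fintype.equivFin (Option (τ → Bool))
  have hind : iIndepFun (fun o ω => N ω (atom o)) P := by
    have h1 := (h.indep _ (fun k => atom (e.symm k)) (fun k => hatom _)
      fun i j hij => hdisj (e.symm.injective.ne hij)).precomp e.injective
    simpa using h1
  have h2 := hind.indepFun_finset {none} (Finset.univ.erase none) (by simp)
    fun o => h.measurable_apply (hatom o)
  -- Each `C i` misses `D`, so it is the union of the atoms whose pattern contains `i`.
  have hsum : ∀ ω i, N ω (C i) = ∑ S : τ → Bool, if S i = true then N ω (atom (some S)) else 0 := by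
    intro ω i
    rw [← Finset.sum_filter, ← measure_biUnion_finset]
    · congr 1
      ext x
      simp only [Set.mem_iUnion, Finset.mem_filter, Finset.mem_univ, true_and]
      constructor
      · intro hx
        refine ⟨fun j => decide (x ∈ C j), by simpa using hx, ?_, ?_⟩
        · exact fun hxD => Set.disjoint_left.1 (hd i) hxD hx
        · exact Set.mem_iInter.2 fun j => by simp
      · rintro ⟨S, hS, hx⟩
        exact (Set.mem_iInter.1 hx.2 i).2 hS
    · exact fun S _ S' _ hne => hdisj (by simpa using hne)
    · exact fun S _ => hatom _
  have hnone : (none : Option (τ → Bool)) ∈ ({none} : Finset (Option (τ → Bool))) := by simp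
  have hφ : Measurable fun f : ({none} : Finset (Option (τ → Bool))) → ℝ≥0∞ => f ⟨none, hnone⟩ :=
    measurable_pi_apply _
  have h3 := h2.comp
    (φ := fun f : ({none} : Finset (Option (τ → Bool))) → ℝ≥0∞ => f ⟨none, hnone⟩)
    (ψ := fun (f : ↥(Finset.univ.erase none : Finset (Option (τ → Bool))) → ℝ≥0∞) (i : τ) =>
      ∑ S : τ → Bool, if S i = true then f ⟨some S, by simp⟩ else 0) hφ (by
      refine measurable_pi_lambda _ fun i => Finset.measurable_sum _ fun S _ => ?_
      split_ifs
      · exact measurable_pi_apply _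
      · exact measurable_const)
  have hψ : (fun ω i => N ω (C i)) = (fun (f : ↥(Finset.univ.erase none :
      Finset (Option (τ → Bool))) → ℝ≥0∞) (i : τ) =>
      ∑ S : τ → Bool, if S i = true then f ⟨some S, by simp⟩ else 0) ∘
      fun ω (o : ↥(Finset.univ.erase none : Finset (Option (τ → Bool)))) => N ω (atom o) := by
    funext ω i
    exact hsum ω i
  rw [hψ]
  exact h3

/-- The future of a Poisson random measure is independent of its natural history. -/
theorem indep_naturalHistory [IsProbabilityMeasure P] (h : IsPoissonRandomMeasure P N) (s : ℝ≥0)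
    {D : Set (ℝ≥0 × ℝ≥0)} (hD : MeasurableSet D) (hDs : Disjoint D (Set.Iic s ×ˢ Set.univ)) :
    Indep (naturalHistory N h.measurable s) (MeasurableSpace.comap (fun ω => N ω D) inferInstance)
      P := by
  let ι := {p : Set ℝ≥0 × Set ℝ≥0 // MeasurableSet p.1 ∧ MeasurableSet p.2 ∧ p.1 ⊆ Set.Iic s}
  let m : ι → MeasurableSpace Ω := fun p =>
    MeasurableSpace.comap (fun ω => N ω (p.1.1 ×ˢ p.1.2)) inferInstance
  have hm : ∀ i, m i ≤ mΩ := fun i =>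
    (h.measurable_apply (i.2.1.prod i.2.2.1)).comap_le
  have hle : naturalHistory N h.measurable s ≤ ⨆ i ∈ (Set.univ : Set ι), m i := by
    refine iSup_le fun T => iSup_le fun B => iSup_le fun hT => iSup_le fun hB =>
      iSup_le fun hTs => ?_
    exact le_iSup₂_of_le (f := fun i (_ : i ∈ (Set.univ : Set ι)) => m i)
      ⟨(T, B), hT, hB, hTs⟩ trivial le_rfl
  refine indep_of_indep_of_le_left ?_ hle
  -- Finite intersections of events about single rectangles form a π-system generating the past,
  -- which reduces the claim to finitely many sets disjoint from `D`.
  refine IndepSets.indep (iSup₂_le fun i _ => hm i) (h.measurable_apply hD).comap_le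
    (isPiSystem_piiUnionInter (fun i => {t | MeasurableSet[m i] t})
      (fun i => @MeasurableSpace.isPiSystem_measurableSet _ (m i)) Set.univ)
    (@MeasurableSpace.isPiSystem_measurableSet _
      (MeasurableSpace.comap (fun ω => N ω D) inferInstance))
    (generateFrom_piiUnionInter_measurableSet m Set.univ).symm
    (@MeasurableSpace.generateFrom_measurableSet _ (_)).symm ?_
  rw [IndepSets_iff]
  rintro _ _ ⟨t, -, f, hf, rfl⟩ ⟨V, hV, rfl⟩
  have hf' : ∀ i : t, ∃ W, MeasurableSet W ∧ (fun ω => N ω (i.1.1.1 ×ˢ i.1.1.2)) ⁻¹' W = f i :=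
    fun i => hf i i.2
  choose W hW hWf using hf'
  have hind := h.indepFun_of_disjoint (fun i : t => i.1.1.1 ×ˢ i.1.1.2)
    (fun i => i.1.2.1.prod i.1.2.2.1) hD fun i =>
      hDs.mono_right (Set.prod_mono i.1.2.2.2 (Set.subset_univ _))
  have hpre : (⋂ i ∈ t, f i) = (fun ω (i : t) => N ω (i.1.1.1 ×ˢ i.1.1.2)) ⁻¹' Set.univ.pi W := by
    ext ω
    simp only [Set.mem_iInter, Set.mem_preimage, Set.mem_pi, Set.mem_univ, true_implies]
    constructor
    · intro hω i
      have := hω i i.2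
      rwa [← hWf i] at this
    · intro hω i hi
      have := hω ⟨i, hi⟩
      rw [← hWf ⟨i, hi⟩]
      exact this
  rw [hpre]
  exact hind.symm.measure_inter_preimage_eq_mul _ _
    (MeasurableSet.univ_pi hW) hV

/-- The history of `N` completed with the null sets. -/
def completedHistory (N : Ω → Measure (ℝ≥0 × ℝ≥0)) (hN : Measurable N) (P : Measure Ω) :
    Filtration ℝ≥0 mΩ where
  -- The completion may contain sets that are not measurable; intersecting with `mΩ` keeps a
  -- filtration of the given space.
  seq t := eventuallyMeasurableSpace (naturalHistory N hN t) (ae P) ⊓ mΩ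
  mono' _ _ hst := inf_le_inf_right _ fun _ ⟨u, hu, hsu⟩ =>
    ⟨u, (naturalHistory N hN).mono hst _ hu, hsu⟩
  le' _ := inf_le_right

theorem naturalHistory_le_completedHistory (hN : Measurable N) (t : ℝ≥0) :
    naturalHistory N hN t ≤ completedHistory N hN P t :=
  le_inf le_eventuallyMeasurableSpace ((naturalHistory N hN).le t)

/-- A Poisson random measure has a modification which is surely simple, and whose compensator is
the Lebesgue measure for a filtration containing the natural history. -/
theorem exists_isSimplePoissonMeasure [IsProbabilityMeasure P] (h : IsPoissonRandomMeasure P N) :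
    ∃ (G : Filtration ℝ≥0 mΩ) (N' : Ω → Measure (ℝ≥0 × ℝ≥0)), IsSimplePoissonMeasure P G N' ∧
      N' =ᵐ[P] N ∧ ∀ t, naturalHistory N h.measurable t ≤ G t := by
  classical
  have hgood : ∀ᵐ ω ∂P, (∀ n, N ω (quadrantBox n) < ∞) ∧
      (∀ C, MeasurableSet C → ∃ k : ℕ∞, N ω C = k) ∧ N ω ({0} ×ˢ Set.univ) = 0 ∧
      ∀ u, N ω ({u} ×ˢ Set.univ) ≤ 1 := by
    filter_upwards [ae_all_iff.2 fun n => h.ae_finite (measurableSet_quadrantBox n)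
      (volume_quadrantBox_lt_top n).ne, h.ae_natValued, h.ae_zero, h.ae_simple] with ω h1 h2 h3 h4
      using ⟨h1, h2, h3, h4⟩
  obtain ⟨S, hSgood, hSm, hS⟩ : ∃ S, (∀ ω ∈ S, (∀ n, N ω (quadrantBox n) < ∞) ∧
      (∀ C, MeasurableSet C → ∃ k : ℕ∞, N ω C = k) ∧ N ω ({0} ×ˢ Set.univ) = 0 ∧
      ∀ u, N ω ({u} ×ˢ Set.univ) ≤ 1) ∧ MeasurableSet S ∧ P Sᶜ = 0 := by
    obtain ⟨t, ht, htm, ht0⟩ := exists_measurable_superset_of_null (ae_iff.1 hgood)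
    refine ⟨tᶜ, fun ω hω => ?_, htm.compl, by simpa using ht0⟩
    by_contra hc
    exact hω (ht hc)
  -- On the exceptional null set the measure is replaced by zero, which has all the required
  -- properties. Adaptedness then holds only after completion.
  let N' : Ω → Measure (ℝ≥0 × ℝ≥0) := fun ω => if ω ∈ S then N ω else 0
  have hN' : N' =ᵐ[P] N := by
    filter_upwards [(compl_mem_ae_iff (s := Sᶜ)).2 hS] with ω hω
    exact if_pos (by simpa using hω)
  have hN'm : Measurable N' := h.measurable.ite hSm measurable_const
  refine ⟨completedHistory N h.measurable P, N', ?_, hN', naturalHistory_le_completedHistory _⟩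
  refine { finite := ?_, adapted := ?_, zero := ?_, compensated := ?_, natValued := ?_, simple := ?_ }
  · intro ω n
    by_cases hω : ω ∈ S
    · simp only [N', if_pos hω]; exact (hSgood ω hω).1 n
    · simp [N', if_neg hω]
  · intro t T B hT hB hTt
    have h1 : Measurable[naturalHistory N h.measurable t] fun ω => N ω (T ×ˢ B) := by
      refine Measurable.mono (comap_measurable _) ?_ le_rfl
      exact le_iSup_of_le T <| le_iSup_of_le B <| le_iSup_of_le hT <| le_iSup_of_le hB <|
        le_iSup_of_le hTt le_rfl
    have h2 : (fun ω => N' ω (T ×ˢ B)) =ᵐ[P] fun ω => N ω (T ×ˢ B) := by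
      filter_upwards [hN'] with ω hω
      rw [hω]
    have h3 := h1.eventuallyMeasurable_of_eventuallyEq h2
    have h4 : Measurable fun ω => N' ω (T ×ˢ B) :=
      (Measure.measurable_coe (hT.prod hB)).comp hN'm
    exact fun V hV => ⟨h3 hV, h4 hV⟩
  · intro ω
    by_cases hω : ω ∈ S
    · simp only [N', if_pos hω]; exact (hSgood ω hω).2.2.1
    · simp [N', if_neg hω]
  -- Independence is available for the uncompleted past, so `A` is exchanged for an almost surely
  -- equal set `A'` there.
  · rintro s t n A B ⟨⟨A', hA', hAA'⟩, -⟩ hB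
    set D := Set.Ioc s t ×ˢ (B ∩ Set.Iic (n : ℝ≥0)) with hDdef
    have hD : MeasurableSet D := measurableSet_Ioc.prod (hB.inter measurableSet_Iic)
    have hDv : volume D ≠ ∞ := by
      rw [hDdef, Measure.volume_eq_prod, Measure.prod_prod, volume_nnreal_Ioc]
      refine ENNReal.mul_ne_top ENNReal.coe_ne_top ?_
      exact ((measure_mono Set.inter_subset_right).trans_lt
        ((volume_nnreal_Iic n).trans_lt ENNReal.coe_lt_top)).ne
    have hDs : Disjoint D (Set.Iic s ×ˢ Set.univ) := Set.disjoint_left.2 fun x hx hx' =>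
      absurd hx.1.1 (not_lt.2 hx'.1)
    have hA'm : MeasurableSet A' := (naturalHistory N h.measurable).le s _ hA'
    calc ∫⁻ ω in A, N' ω D ∂P = ∫⁻ ω in A', N ω D ∂P := by
          rw [setLIntegral_congr hAA']
          refine lintegral_congr_ae (ae_restrict_of_ae ?_)
          filter_upwards [hN'] with ω hω
          rw [hω]
      _ = ∫⁻ ω, A'.indicator 1 ω * N ω D ∂P := by
          rw [← lintegral_indicator hA'm]
          congr 1 with ω
          by_cases hω : ω ∈ A' <;> simp [hω]
      _ = (∫⁻ ω, A'.indicator 1 ω ∂P) * ∫⁻ ω, N ω D ∂P :=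
          lintegral_mul_eq_lintegral_mul_lintegral_of_independent_measurableSpace
            ((naturalHistory N h.measurable).le s) (h.measurable_apply hD).comap_le
            (h.indep_naturalHistory s hD hDs)
            (Measurable.indicator (m := naturalHistory N h.measurable s) measurable_const hA')
            (comap_measurable _)
      _ = P A * volume D := by
          rw [h.lintegral_apply hD hDv, lintegral_indicator_one hA'm, measure_congr hAA']
  · intro ω C hC
    by_cases hω : ω ∈ S
    · simp only [N', if_pos hω]; exact (hSgood ω hω).2.1 C hC
    · exact ⟨0, by simp [N', if_neg hω]⟩
  · intro ω u
    by_cases hω : ω ∈ S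
    · simp only [N', if_pos hω]; exact (hSgood ω hω).2.2.2 u
    · simp [N', if_neg hω]

end IsPoissonRandomMeasure

/-! ### The resolvent of the Hawkes kernel -/

section Convolution

theorem measurable_setLIntegral_of_lt {g : ℝ≥0 → ℝ≥0 → ℝ≥0∞} (hg : Measurable (Function.uncurry g)) :
    Measurable fun v => ∫⁻ u in Set.Ioi v, g v u := by
  have hs : MeasurableSet {p : ℝ≥0 × ℝ≥0 | p.1 < p.2} := measurableSet_lt (by fun_prop) (by fun_prop)
  have := (hg.indicator hs).lintegral_prod_right' (ν := (volume : Measure ℝ≥0))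
  convert this using 2 with v
  rw [← lintegral_indicator measurableSet_Ioi]
  congr 1

theorem measurable_setLIntegral_of_ge {g : ℝ≥0 → ℝ≥0 → ℝ≥0∞} (hg : Measurable (Function.uncurry g)) :
    Measurable fun t => ∫⁻ s in Set.Iic t, g t s := by
  have hs : MeasurableSet {p : ℝ≥0 × ℝ≥0 | p.2 ≤ p.1} := measurableSet_le (by fun_prop) (by fun_prop)
  have := (hg.indicator hs).lintegral_prod_right' (ν := (volume : Measure ℝ≥0))
  convert this using 2 with v
  rw [← lintegral_indicator measurableSet_Iic]
  congr 1

/-- Interchanging the integrals over the region `v < u`. -/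
theorem lintegral_Ioi_swap {ν : Measure ℝ≥0} [SFinite ν] {g : ℝ≥0 → ℝ≥0 → ℝ≥0∞}
    (hg : Measurable (Function.uncurry g)) :
    ∫⁻ v, (∫⁻ u in Set.Ioi v, g v u) ∂ν = ∫⁻ u, (∫⁻ v in Set.Iio u, g v u ∂ν) := by
  have hs : MeasurableSet {p : ℝ≥0 × ℝ≥0 | p.1 < p.2} := measurableSet_lt (by fun_prop) (by fun_prop)
  have h1 : ∀ v, ∫⁻ u in Set.Ioi v, g v u
      = ∫⁻ u, {p : ℝ≥0 × ℝ≥0 | p.1 < p.2}.indicator (Function.uncurry g) (v, u) := fun v => by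
    rw [← lintegral_indicator measurableSet_Ioi]
    congr 1
  have h2 : ∀ u, ∫⁻ v in Set.Iio u, g v u ∂ν
      = ∫⁻ v, {p : ℝ≥0 × ℝ≥0 | p.1 < p.2}.indicator (Function.uncurry g) (v, u) ∂ν := fun u => by
    rw [← lintegral_indicator measurableSet_Iio]
    congr 1
  simp_rw [h1, h2]
  exact lintegral_lintegral_swap (hg.indicator hs).aemeasurable

theorem setLIntegral_Ioo_translate {g h : ℝ≥0 → ℝ≥0∞} (hg : Measurable g) (hh : Measurable h)
    (v u : ℝ≥0) :
    ∫⁻ w in Set.Ioo v u, g (w - v) * h (u - w) = ∫⁻ s in Set.Iic (u - v), g s * h (u - v - s) := by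
  -- For `u ≤ v` truncated subtraction turns the right-hand domain into `{0}`, which is null rather
  -- than empty.
  rcases le_or_gt u v with huv | hvu
  · rw [Set.Ioo_eq_empty (not_lt.2 huv), tsub_eq_zero_of_le huv, setLIntegral_empty,
      ← Set.Icc_bot, bot_eq_zero, Set.Icc_self]
    exact (setLIntegral_measure_zero _ _ (measure_singleton _)).symm
  have hm : Measurable ((Set.Iic (u - v)).indicator fun s => g s * h (u - v - s)) :=
    Measurable.indicator (by fun_prop) measurableSet_Iic
  rw [← lintegral_indicator measurableSet_Iic, ← setLIntegral_Ici_translate hm v,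
    setLIntegral_congr (Ioo_ae_eq_Icc (μ := volume)), ← lintegral_indicator measurableSet_Icc,
    ← lintegral_indicator measurableSet_Ici]
  congr 1 with w
  by_cases hw : v ≤ w
  · by_cases hw' : w ≤ u
    · rw [Set.indicator_of_mem (show w ∈ Set.Icc v u from ⟨hw, hw'⟩),
        Set.indicator_of_mem (show w ∈ Set.Ici v from hw),
        Set.indicator_of_mem (show w - v ∈ Set.Iic (u - v) from tsub_le_tsub_right hw' v),
        tsub_tsub_tsub_cancel_right hw]
    · rw [Set.indicator_of_notMem (fun h : w ∈ Set.Icc v u => hw' h.2),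
        Set.indicator_of_mem (show w ∈ Set.Ici v from hw), Set.indicator_of_notMem]
      intro h
      exact hw' ((tsub_le_tsub_iff_right hvu.le).1 h)
  · rw [Set.indicator_of_notMem (fun h : w ∈ Set.Icc v u => hw h.1),
      Set.indicator_of_notMem (fun h : w ∈ Set.Ici v => hw h)]

theorem setLIntegral_Ioi_translate {g : ℝ≥0 → ℝ≥0∞} (hg : Measurable g) (v : ℝ≥0) :
    ∫⁻ u in Set.Ioi v, g (u - v) = ∫⁻ u, g u := by
  rw [← setLIntegral_Ici_translate hg v, setLIntegral_congr Ioi_ae_eq_Ici]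

end Convolution

/-! ### The resolvent and the dual equation -/

section Resolvent

variable {Φ : ℝ≥0 → ℝ≥0}

theorem measurable_iterConv (hΦ : Measurable Φ) (n : ℕ) : Measurable (iterConv Φ n) := by
  induction n with
  | zero => exact hΦ.coe_nnreal_ennreal
  | succ n ih =>
    refine measurable_setLIntegral_of_ge (g := fun t s => (Φ (t - s) : ℝ≥0∞) * iterConv Φ n s) ?_
    simp only [Function.uncurry_def]
    fun_prop

theorem measurable_hawkesPsi (hΦ : Measurable Φ) : Measurable (hawkesPsi Φ) :=
  Measurable.tsum fun n => measurable_iterConv hΦ n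

theorem hawkesPsi_eq (hΦ : Measurable Φ) (t : ℝ≥0) :
    hawkesPsi Φ t = Φ t + ∫⁻ s in Set.Iic t, (Φ (t - s) : ℝ≥0∞) * hawkesPsi Φ s := by
  have h1 : ∀ s, (Φ (t - s) : ℝ≥0∞) * hawkesPsi Φ s
      = ∑' n, (Φ (t - s) : ℝ≥0∞) * iterConv Φ n s := fun s => by
    rw [hawkesPsi, ENNReal.tsum_mul_left]
  simp_rw [h1]
  have hm : ∀ n, Measurable fun s => (Φ (t - s) : ℝ≥0∞) * iterConv Φ n s := fun n =>
    Measurable.mul (by fun_prop) (measurable_iterConv hΦ n)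
  rw [lintegral_tsum fun n => (hm n).aemeasurable, hawkesPsi, tsum_eq_zero_add' ENNReal.summable]
  rfl

theorem hawkesPsi_eq' (hΦ : Measurable Φ) (t : ℝ≥0) :
    hawkesPsi Φ t = Φ t + ∫⁻ s in Set.Iic t, (Φ s : ℝ≥0∞) * hawkesPsi Φ (t - s) := by
  have hΨ := measurable_hawkesPsi hΦ
  rw [hawkesPsi_eq hΦ, ← setLIntegral_Iic_reflect (by fun_prop)]
  congr 1
  refine setLIntegral_congr_fun measurableSet_Iic fun s hs => ?_
  simp only [tsub_tsub_cancel_of_le (show s ≤ t from hs)]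

theorem lintegral_convolution {g h : ℝ≥0 → ℝ≥0∞} (hg : Measurable g) (hh : Measurable h) :
    ∫⁻ t, (∫⁻ s in Set.Iic t, g (t - s) * h s) = (∫⁻ u, g u) * ∫⁻ u, h u := by
  have h1 : ∀ t, ∫⁻ s in Set.Iic t, g (t - s) * h s = ∫⁻ s in Set.Iio t, g (t - s) * h s :=
    fun t => setLIntegral_congr Iio_ae_eq_Iic.symm
  simp_rw [h1]
  rw [← lintegral_Ioi_swap (g := fun s t => g (t - s) * h s)
    (by simp only [Function.uncurry_def]; fun_prop), ← lintegral_const_mul _ hh]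
  refine lintegral_congr fun s => ?_
  rw [lintegral_mul_const _ (by fun_prop), setLIntegral_Ioi_translate hg]

/-- The mass of a convolution is the product of the masses, so Ψ has mass equal to a geometric
series in ‖Φ‖₁ < 1. -/
theorem lintegral_hawkesPsi_lt_top (hΦ : Measurable Φ) (h1 : ∫⁻ u, (Φ u : ℝ≥0∞) < 1) :
    ∫⁻ u, hawkesPsi Φ u < ∞ := by
  have hn : ∀ n, ∫⁻ u, iterConv Φ n u = (∫⁻ u, (Φ u : ℝ≥0∞)) ^ (n + 1) := by
    intro n
    induction n with
    | zero => simp [iterConv]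
    | succ n ih =>
      rw [pow_succ', ← ih, ← lintegral_convolution (by fun_prop) (measurable_iterConv hΦ n)]
      rfl
  unfold hawkesPsi
  rw [lintegral_tsum fun n => (measurable_iterConv hΦ n).aemeasurable]
  simp_rw [hn, pow_succ]
  rw [ENNReal.tsum_mul_right, ENNReal.tsum_geometric]
  refine ENNReal.mul_lt_top (ENNReal.inv_lt_top.2 (tsub_pos_of_lt h1)) (h1.trans ENNReal.one_lt_top)

/-- The solution `h` of `h v = f v + ∫_v^∞ h u Φ(u - v) du`. -/
noncomputable def hawkesDual (Φ : ℝ≥0 → ℝ≥0) (f : ℝ≥0 → ℝ≥0∞) (v : ℝ≥0) : ℝ≥0∞ :=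
  f v + ∫⁻ u in Set.Ioi v, f u * hawkesPsi Φ (u - v)

theorem measurable_hawkesDual (hΦ : Measurable Φ) {f : ℝ≥0 → ℝ≥0∞} (hf : Measurable f) :
    Measurable (hawkesDual Φ f) := by
  have hΨ := measurable_hawkesPsi hΦ
  exact hf.add (measurable_setLIntegral_of_lt (g := fun v u => f u * hawkesPsi Φ (u - v))
    (by simp only [Function.uncurry_def]; fun_prop))

/-- Exchanging integrals turns ∫ h Φ into ∫ f(u) (Φ + Φ*Ψ)(u-v) du, and the bracket is Ψ. -/
theorem hawkesDual_eq (hΦ : Measurable Φ) {f : ℝ≥0 → ℝ≥0∞} (hf : Measurable f) (v : ℝ≥0) :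
    hawkesDual Φ f v = f v + ∫⁻ u in Set.Ioi v, hawkesDual Φ f u * Φ (u - v) := by
  have hΨ := measurable_hawkesPsi hΦ
  have hd := measurable_hawkesDual hΦ hf
  have h1 : ∫⁻ u in Set.Ioi v, hawkesDual Φ f u * Φ (u - v)
      = (∫⁻ u in Set.Ioi v, f u * Φ (u - v))
        + ∫⁻ u in Set.Ioi v, f u * ∫⁻ s in Set.Iic (u - v),
          (Φ s : ℝ≥0∞) * hawkesPsi Φ (u - v - s) := by
    have h2 : ∫⁻ w in Set.Ioi v, (∫⁻ u in Set.Ioi w, f u * hawkesPsi Φ (u - w) * Φ (w - v))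
        = ∫⁻ u in Set.Ioi v, f u * ∫⁻ s in Set.Iic (u - v),
          (Φ s : ℝ≥0∞) * hawkesPsi Φ (u - v - s) := by
      rw [lintegral_Ioi_swap (g := fun w u => f u * hawkesPsi Φ (u - w) * Φ (w - v))
        (by simp only [Function.uncurry_def]; fun_prop)]
      rw [← lintegral_indicator measurableSet_Ioi]
      refine lintegral_congr fun u => ?_
      rw [Measure.restrict_restrict measurableSet_Iio, Set.inter_comm, Set.Ioi_inter_Iio]
      by_cases hu : v < u
      · rw [Set.indicator_of_mem (show u ∈ Set.Ioi v from hu),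
          ← setLIntegral_Ioo_translate (g := fun s => (Φ s : ℝ≥0∞)) (by fun_prop) hΨ v u,
          ← lintegral_const_mul _ (by fun_prop)]
        refine lintegral_congr fun w => by ring
      · rw [Set.indicator_of_notMem (fun h : u ∈ Set.Ioi v => hu h),
          Set.Ioo_eq_empty hu, setLIntegral_empty]
    rw [← h2, ← lintegral_add_left (by fun_prop)]
    refine lintegral_congr fun u => ?_
    rw [hawkesDual, add_mul, ← lintegral_mul_const _ (by fun_prop)]
  have hm1 : Measurable fun u => f u * (Φ (u - v) : ℝ≥0∞) := by fun_prop
  rw [h1, hawkesDual, ← lintegral_add_left hm1]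
  congr 1
  refine lintegral_congr fun u => ?_
  rw [← mul_add, ← hawkesPsi_eq' hΦ]

theorem le_hawkesDual (f : ℝ≥0 → ℝ≥0∞) (v : ℝ≥0) : f v ≤ hawkesDual Φ f v := le_self_add

theorem hawkesDual_le (hΦ : Measurable Φ) {f : ℝ≥0 → ℝ≥0∞} {c : ℝ≥0∞} (hf : ∀ u, f u ≤ c)
    (v : ℝ≥0) : hawkesDual Φ f v ≤ c * (1 + ∫⁻ u, hawkesPsi Φ u) := by
  have hΨ := measurable_hawkesPsi hΦ
  rw [mul_add, mul_one]
  refine add_le_add (hf v) ?_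
  calc ∫⁻ u in Set.Ioi v, f u * hawkesPsi Φ (u - v)
      ≤ ∫⁻ u in Set.Ioi v, c * hawkesPsi Φ (u - v) :=
        lintegral_mono fun u => mul_le_mul_left (hf u) _
    _ = c * ∫⁻ u, hawkesPsi Φ u := by
        rw [lintegral_const_mul _ (by fun_prop), setLIntegral_Ioi_translate hΨ]

theorem hawkesDual_eq_zero {f : ℝ≥0 → ℝ≥0∞} {T : ℝ≥0} (hf : ∀ u, T < u → f u = 0) {v : ℝ≥0}
    (hv : T < v) : hawkesDual Φ f v = 0 := by
  rw [hawkesDual, hf v hv, zero_add]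
  rw [setLIntegral_congr_fun (g := fun _ => 0) measurableSet_Ioi fun u hu => by
    simp only [hf u (hv.trans hu), zero_mul]]
  simp

/-- Fubini; this is the source of the factor 1 + ∫_0^v Ψ in the covariances. -/
theorem lintegral_hawkesDual (hΦ : Measurable Φ) {f : ℝ≥0 → ℝ≥0∞} (hf : Measurable f) :
    ∫⁻ v, hawkesDual Φ f v = ∫⁻ v, f v * (1 + ∫⁻ w in Set.Iic v, hawkesPsi Φ w) := by
  have hΨ := measurable_hawkesPsi hΦ
  unfold hawkesDual
  rw [lintegral_add_left hf, lintegral_Ioi_swap (g := fun v u => f u * hawkesPsi Φ (u - v))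
    (by simp only [Function.uncurry_def]; fun_prop), ← lintegral_add_left hf]
  refine lintegral_congr fun u => ?_
  rw [mul_add, mul_one, lintegral_const_mul _ (by fun_prop), setLIntegral_congr Iio_ae_eq_Iic,
    setLIntegral_Iic_reflect hΨ]

theorem hawkesDual_iSup (hΦ : Measurable Φ) {f : ℕ → ℝ≥0 → ℝ≥0∞} (hf : ∀ n, Measurable (f n))
    (hmono : Monotone f) (v : ℝ≥0) :
    hawkesDual Φ (fun u => ⨆ n, f n u) v = ⨆ n, hawkesDual Φ (f n) v := by
  have hΨ := measurable_hawkesPsi hΦ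
  unfold hawkesDual
  simp_rw [ENNReal.iSup_mul]
  have hm : ∀ n, Measurable fun u => f n u * hawkesPsi Φ (u - v) := fun n => by fun_prop
  rw [lintegral_iSup hm fun i j hij u => mul_le_mul_left (hmono hij u) _]
  exact ENNReal.iSup_add_iSup_of_monotone (fun i j hij => hmono hij v)
    fun i j hij => lintegral_mono fun u => mul_le_mul_left (hmono hij u) _

theorem hawkesDual_mono {f g : ℝ≥0 → ℝ≥0∞} (h : f ≤ g) : hawkesDual Φ f ≤ hawkesDual Φ g :=
  fun v => add_le_add (h v) (lintegral_mono fun u => mul_le_mul_left (h u) _)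

end Resolvent

/-! ### The Hawkes counting measure -/

section Pathwise

variable {Φ : ℝ≥0 → ℝ≥0} {μ : ℝ≥0} {f : ℝ≥0 → ℝ≥0∞} {ν : Measure ℝ≥0}

/-- Fubini moves Φ from the past of `u` onto the dual function, where the dual equation absorbs it.
When μ + ∫ Φ dν is the intensity, this represents ∫ f dν as a constant plus a compensated integral.
-/
theorem lintegral_hawkesDual_mul_add [SFinite ν] (hΦ : Measurable Φ) (hf : Measurable f) :
    (∫⁻ u, hawkesDual Φ f u * (μ + ∫⁻ v in Set.Iio u, (Φ (u - v) : ℝ≥0∞) ∂ν)) + ∫⁻ u, f u ∂ν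
      = μ * (∫⁻ u, hawkesDual Φ f u) + ∫⁻ u, hawkesDual Φ f u ∂ν := by
  have hd := measurable_hawkesDual hΦ hf
  have h1 : ∫⁻ u, hawkesDual Φ f u * ∫⁻ v in Set.Iio u, (Φ (u - v) : ℝ≥0∞) ∂ν
      = ∫⁻ v, (∫⁻ u in Set.Ioi v, hawkesDual Φ f u * Φ (u - v)) ∂ν := by
    rw [lintegral_Ioi_swap (g := fun v u => hawkesDual Φ f u * (Φ (u - v) : ℝ≥0∞))
      (by simp only [Function.uncurry_def]; fun_prop)]
    refine lintegral_congr fun u => ?_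
    rw [lintegral_const_mul _ (by fun_prop)]
  simp_rw [mul_add]
  rw [lintegral_add_left (by fun_prop), h1, lintegral_mul_const _ hd, mul_comm, add_assoc]
  congr 1
  rw [add_comm, ← lintegral_add_left hf]
  exact lintegral_congr fun v => (hawkesDual_eq hΦ hf v).symm

/-- Apply the identity to ν restricted to `S`. For `u` in the lower set `S` the past of `u` lies in
`S`, so the intensity is unchanged; dropping the times outside `S` costs the equality. -/
theorem setLIntegral_hawkesDual_mul_add_le [SFinite ν] (hΦ : Measurable Φ) (hf : Measurable f)
    {S : Set ℝ≥0} (hS : MeasurableSet S) (hlow : IsLowerSet S) :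
    (∫⁻ u in S, hawkesDual Φ f u * (μ + ∫⁻ v in Set.Iio u, (Φ (u - v) : ℝ≥0∞) ∂ν))
        + ∫⁻ u in S, f u ∂ν
      ≤ μ * (∫⁻ u, hawkesDual Φ f u) + ∫⁻ u in S, hawkesDual Φ f u ∂ν := by
  rw [← lintegral_hawkesDual_mul_add (ν := ν.restrict S) hΦ hf]
  refine add_le_add_left ?_ _
  refine le_trans (le_of_eq ?_) (setLIntegral_le_lintegral S _)
  refine setLIntegral_congr_fun hS fun u hu => ?_
  rw [Measure.restrict_restrict measurableSet_Iio, Set.inter_eq_left.2]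
  exact fun v hv => hlow (le_of_lt hv) hu

/-- The set is an initial interval. By continuity from below the mass strictly before its supremum
is at most `K`, and the endpoint adds at most one atom. Cutting at `n` makes the supremum exist. -/
theorem measure_setOf_measure_Iio_le {K : ℝ≥0∞} (hν : ∀ u, ν {u} ≤ 1) :
    ν {u | ν (Set.Iio u) ≤ K} ≤ K + 1 := by
  set S := {u | ν (Set.Iio u) ≤ K} with hS
  have h0 : (0 : ℝ≥0) ∈ S := by
    simp [hS]
  have hT : ∀ n : ℕ, ν (S ∩ Set.Iic (n : ℝ≥0)) ≤ K + 1 := by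
    intro n
    have hne : (S ∩ Set.Iic (n : ℝ≥0)).Nonempty := ⟨0, h0, Set.mem_Iic.2 zero_le⟩
    have hb : BddAbove (S ∩ Set.Iic (n : ℝ≥0)) := ⟨n, fun u hu => hu.2⟩
    have hlub := isLUB_csSup hne hb
    set τ := sSup (S ∩ Set.Iic (n : ℝ≥0))
    obtain ⟨u, hmono, -, hlim, hmem⟩ := hlub.exists_seq_monotone_tendsto hne
    have hIio : ν (Set.Iio τ) ≤ K := by
      have hsub : Set.Iio τ ⊆ ⋃ k, Set.Iio (u k) := fun x hx => by
        obtain ⟨k, hk⟩ := (hlim.eventually (lt_mem_nhds hx)).exists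
        exact Set.mem_iUnion.2 ⟨k, hk⟩
      refine (measure_mono hsub).trans ?_
      have hm : Monotone fun k => Set.Iio (u k) := fun i j hij => Set.Iio_subset_Iio (hmono hij)
      rw [hm.measure_iUnion]
      exact iSup_le fun k => (hmem k).1
    calc ν (S ∩ Set.Iic (n : ℝ≥0)) ≤ ν (Set.Iio τ ∪ {τ}) := by
          refine measure_mono fun x hx => ?_
          rcases (hlub.1 hx).lt_or_eq with h | h
          · exact Or.inl h
          · exact Or.inr h
      _ ≤ ν (Set.Iio τ) + ν {τ} := measure_union_le _ _
      _ ≤ K + 1 := add_le_add hIio (hν τ)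
  have hU : S = ⋃ n : ℕ, S ∩ Set.Iic (n : ℝ≥0) := by
    have hIic : ⋃ n : ℕ, Set.Iic (n : ℝ≥0) = Set.univ :=
      Set.eq_univ_of_forall fun x => Set.mem_iUnion.2 (exists_nat_ge x)
    rw [← Set.inter_iUnion, hIic, Set.inter_univ]
  have hm : Monotone fun n : ℕ => S ∩ Set.Iic (n : ℝ≥0) := fun i j hij =>
    Set.inter_subset_inter_right _ (Set.Iic_subset_Iic.2 (by exact_mod_cast hij))
  rw [hU, hm.measure_iUnion]
  exact iSup_le hT

end Pathwise

/-! ### Thinning by the intensity, stopped at a given mass -/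

section Thinning

variable {Ω : Type*} {mΩ : MeasurableSpace Ω}

/-- The counting measure of the points `(u, θ)` of `N` with `θ ≤ lam u`. -/
noncomputable def thinnedMeasure (N : Ω → Measure (ℝ≥0 × ℝ≥0)) (lam : ℝ≥0 → Ω → ℝ≥0) (ω : Ω) :
    Measure ℝ≥0 :=
  ((N ω).restrict {x | x.2 ≤ lam x.1 ω}).map Prod.fst

/-- The times before which the thinned measure has mass at most `K`. -/
def thinnedHorizon (N : Ω → Measure (ℝ≥0 × ℝ≥0)) (lam : ℝ≥0 → Ω → ℝ≥0) (K : ℝ≥0∞) (ω : Ω) :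
    Set ℝ≥0 :=
  {u | thinnedMeasure N lam ω (Set.Iio u) ≤ K}

/-- The predictable field whose integral against `N` is the integral of `f` over the horizon. -/
noncomputable def thinnedField (N : Ω → Measure (ℝ≥0 × ℝ≥0)) (lam : ℝ≥0 → Ω → ℝ≥0) (K : ℝ≥0∞)
    (f : ℝ≥0 → ℝ≥0∞) (x : ℝ≥0 × ℝ≥0) (ω : Ω) : ℝ≥0∞ :=
  (thinnedHorizon N lam K ω).indicator f x.1 * (Set.Iic (lam x.1 ω)).indicator 1 x.2

variable {P : Measure Ω} {G : Filtration ℝ≥0 mΩ} {N : Ω → Measure (ℝ≥0 × ℝ≥0)}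
  {lam : ℝ≥0 → Ω → ℝ≥0} {K : ℝ≥0∞} {f g : ℝ≥0 → ℝ≥0∞}

theorem isLowerSet_thinnedHorizon (ω : Ω) : IsLowerSet (thinnedHorizon N lam K ω) :=
  fun _ _ hab ha => (measure_mono (Set.Iio_subset_Iio hab)).trans ha

theorem measurableSet_thinnedHorizon (ω : Ω) : MeasurableSet (thinnedHorizon N lam K ω) :=
  (isLowerSet_thinnedHorizon ω).ordConnected.measurableSet

@[simp] theorem thinnedHorizon_top (ω : Ω) : thinnedHorizon N lam ∞ ω = Set.univ := by
  ext; simp [thinnedHorizon]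

theorem measurable_intensity_path (hlam : Measurable[G.predictable] fun p : ℝ≥0 × Ω => lam p.1 p.2)
    (ω : Ω) : Measurable fun u => lam u ω :=
  (Measurable.mono hlam predictable_le_prod le_rfl).comp
    (g := fun p : ℝ≥0 × Ω => lam p.1 p.2) (f := fun u => (u, ω)) (by fun_prop)

theorem measurableSet_le_intensity
    (hlam : Measurable[G.predictable] fun p : ℝ≥0 × Ω => lam p.1 p.2) (ω : Ω) :
    MeasurableSet {x : ℝ≥0 × ℝ≥0 | x.2 ≤ lam x.1 ω} :=
  measurableSet_le measurable_snd ((measurable_intensity_path hlam ω).comp measurable_fst)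

theorem lintegral_thinnedMeasure (hf : Measurable f) (ω : Ω) :
    ∫⁻ u, f u ∂thinnedMeasure N lam ω = ∫⁻ x in {x | x.2 ≤ lam x.1 ω}, f x.1 ∂N ω := by
  rw [thinnedMeasure, lintegral_map hf measurable_fst]

theorem lintegral_thinnedField
    (hlam : Measurable[G.predictable] fun p : ℝ≥0 × Ω => lam p.1 p.2) (hf : Measurable f) (ω : Ω) :
    ∫⁻ x, thinnedField N lam K f x ω ∂N ω
      = ∫⁻ u in thinnedHorizon N lam K ω, f u ∂thinnedMeasure N lam ω := by
  have hS := measurableSet_thinnedHorizon (N := N) (lam := lam) (K := K) ω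
  rw [← lintegral_indicator hS, lintegral_thinnedMeasure (hf.indicator hS),
    ← lintegral_indicator (measurableSet_le_intensity hlam ω)]
  refine lintegral_congr fun x => ?_
  by_cases hx : x.2 ≤ lam x.1 ω <;> simp [thinnedField, Set.indicator, hx]

/-- Integrating out the mark over `[0, λ_u]` leaves the factor `λ_u`: this identifies the
compensator. -/
theorem lintegral_thinnedField_volume
    (hlam : Measurable[G.predictable] fun p : ℝ≥0 × Ω => lam p.1 p.2) (hf : Measurable f) (ω : Ω) :
    ∫⁻ x, thinnedField N lam K f x ω
      = ∫⁻ u in thinnedHorizon N lam K ω, f u * lam u ω := by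
  have hS := measurableSet_thinnedHorizon (N := N) (lam := lam) (K := K) ω
  have hm : Measurable fun x => thinnedField N lam K f x ω := by
    refine ((hf.indicator hS).comp measurable_fst).mul ?_
    have := (measurable_one (α := ℝ≥0∞)).indicator (measurableSet_le_intensity hlam ω)
    exact this
  rw [Measure.volume_eq_prod, lintegral_prod _ hm.aemeasurable, ← lintegral_indicator hS]
  refine lintegral_congr fun u => ?_
  simp only [thinnedField]
  rw [lintegral_const_mul _ (measurable_one.indicator measurableSet_Iic),
    lintegral_indicator_one measurableSet_Iic, volume_nnreal_Iic]
  by_cases hu : u ∈ thinnedHorizon N lam K ω <;> simp [hu]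

theorem isPredictableProcess_thinnedMeasure_Iio (hN : IsAdaptedRandomMeasure G N)
    (hlam : Measurable[G.predictable] fun p : ℝ≥0 × Ω => lam p.1 p.2) :
    IsPredictableProcess G fun v ω => thinnedMeasure N lam ω (Set.Iio v) := by
  convert hN.isPredictableProcess_setLIntegral_Iio (IsPredictableField.le_indicator hlam)
    using 3 with v ω
  have hm : MeasurableSet (Prod.fst ⁻¹' Set.Iio v : Set (ℝ≥0 × ℝ≥0)) :=
    measurable_fst measurableSet_Iio
  rw [thinnedMeasure, Measure.map_apply measurable_fst measurableSet_Iio,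
    Measure.restrict_apply hm, Set.inter_comm, ← Measure.restrict_apply
      (measurableSet_le_intensity hlam ω), Set.prod_univ,
    ← lintegral_indicator_one (measurableSet_le_intensity hlam ω)]
  rfl

/-- The horizon is defined through the mass of the half-open `[0, u)`, a predictable process; this
is why stopping does not break predictability. -/
theorem isPredictableField_thinnedField (hN : IsAdaptedRandomMeasure G N)
    (hlam : Measurable[G.predictable] fun p : ℝ≥0 × Ω => lam p.1 p.2) (hf : Measurable f) :
    IsPredictableField G (thinnedField N lam K f) := by
  have hY := isPredictableProcess_thinnedMeasure_Iio hN hlam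
  have hS : MeasurableSet[G.predictable]
      {p : ℝ≥0 × Ω | thinnedMeasure N lam p.2 (Set.Iio p.1) ≤ K} :=
    measurableSet_le (mδ := G.predictable) hY measurable_const
  have hχ : IsPredictableProcess G fun u ω => (thinnedHorizon N lam K ω).indicator f u := by
    have := Measurable.indicator (m := G.predictable)
      (IsPredictableProcess.of_deterministic (G := G) hf) hS
    exact this
  exact hχ.field.mul (IsPredictableField.le_indicator hlam)

theorem thinnedMeasure_singleton_le (h : IsSimplePoissonMeasure P G N) (ω : Ω) (u : ℝ≥0) :
    thinnedMeasure N lam ω {u} ≤ 1 := by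
  rw [thinnedMeasure, Measure.map_apply measurable_fst (measurableSet_singleton u)]
  refine (Measure.restrict_apply_le _ _).trans ((measure_mono ?_).trans (h.simple ω u))
  rintro x hx
  exact ⟨hx, trivial⟩

theorem sFinite_thinnedMeasure (hN : IsAdaptedRandomMeasure G N) (ω : Ω) :
    SFinite (thinnedMeasure N lam ω) := by
  have := hN.sFinite ω
  unfold thinnedMeasure
  infer_instance

end Thinning

/-! ### First and second moments of the Hawkes counting measure -/

section Moments

variable {Ω : Type*} {mΩ : MeasurableSpace Ω}

/-- `lam` is predictable and satisfies the Hawkes equation driven by the simple Poisson random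
measure `N`, the thinned measure being locally finite. -/
structure IsHawkesCounting (P : Measure Ω) (G : Filtration ℝ≥0 mΩ)
    (N : Ω → Measure (ℝ≥0 × ℝ≥0)) (μ : ℝ≥0) (Φ : ℝ≥0 → ℝ≥0) (lam : ℝ≥0 → Ω → ℝ≥0) : Prop where
  poisson : IsSimplePoissonMeasure P G N
  predictable : Measurable[G.predictable] fun p : ℝ≥0 × Ω => lam p.1 p.2
  measurable_kernel : Measurable Φ
  kernel_lt_one : ∫⁻ u, (Φ u : ℝ≥0∞) < 1
  solves : ∀ᵐ ω ∂P, ∀ u, (lam u ω : ℝ≥0∞)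
    = μ + ∫⁻ v in Set.Iio u, (Φ (u - v) : ℝ≥0∞) ∂thinnedMeasure N lam ω
  counting : ∀ᵐ ω ∂P, ∀ u, thinnedMeasure N lam ω (Set.Iio u) < ∞

/-- The integral of `f` against the thinned measure up to the horizon. -/
noncomputable def thinnedIntegral (N : Ω → Measure (ℝ≥0 × ℝ≥0)) (lam : ℝ≥0 → Ω → ℝ≥0) (K : ℝ≥0∞)
    (f : ℝ≥0 → ℝ≥0∞) (ω : Ω) : ℝ≥0∞ :=
  ∫⁻ u in thinnedHorizon N lam K ω, f u ∂thinnedMeasure N lam ω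

/-- The compensator of the integral of `f` against the thinned measure up to the horizon. -/
noncomputable def thinnedCompensator (N : Ω → Measure (ℝ≥0 × ℝ≥0)) (lam : ℝ≥0 → Ω → ℝ≥0)
    (K : ℝ≥0∞) (f : ℝ≥0 → ℝ≥0∞) (ω : Ω) : ℝ≥0∞ :=
  ∫⁻ u in thinnedHorizon N lam K ω, f u * lam u ω

theorem thinnedIntegral_iSup {N : Ω → Measure (ℝ≥0 × ℝ≥0)} {lam : ℝ≥0 → Ω → ℝ≥0} {K : ℝ≥0∞}
    {F : ℕ → ℝ≥0 → ℝ≥0∞} (hF : ∀ n, Measurable (F n)) (hmono : Monotone F) (ω : Ω) :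
    thinnedIntegral N lam K (fun u => ⨆ n, F n u) ω = ⨆ n, thinnedIntegral N lam K (F n) ω :=
  lintegral_iSup hF hmono

/-- Bounded functions with bounded support. -/
def IsBoundedSupported (f : ℝ≥0 → ℝ≥0∞) : Prop :=
  ∃ c T : ℝ≥0, (∀ u, f u ≤ c) ∧ ∀ u, T < u → f u = 0

theorem IsBoundedSupported.mul {f g : ℝ≥0 → ℝ≥0∞} (hf : IsBoundedSupported f)
    (hg : IsBoundedSupported g) : IsBoundedSupported fun u => f u * g u := by
  obtain ⟨c, T, hc, hT⟩ := hf
  obtain ⟨d, -, hd, -⟩ := hg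
  refine ⟨c * d, T, fun u => ?_, fun u hu => by simp [hT u hu]⟩
  rw [ENNReal.coe_mul]
  exact mul_le_mul' (hc u) (hd u)

theorem IsBoundedSupported.lintegral_lt_top {f : ℝ≥0 → ℝ≥0∞} (hf : IsBoundedSupported f) :
    ∫⁻ u, f u < ∞ := by
  obtain ⟨c, T, hc, hT⟩ := hf
  calc ∫⁻ u, f u ≤ ∫⁻ u, (Set.Iic T).indicator (fun _ => (c : ℝ≥0∞)) u := by
        refine lintegral_mono fun u => ?_
        by_cases hu : u ≤ T
        · rw [Set.indicator_of_mem (show u ∈ Set.Iic T from hu)]; exact hc u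
        · rw [hT u (not_le.1 hu)]; exact zero_le
    _ < ∞ := by
        rw [lintegral_indicator measurableSet_Iic, setLIntegral_const, volume_nnreal_Iic]
        exact ENNReal.mul_lt_top ENNReal.coe_lt_top ENNReal.coe_lt_top

/-- Truncation of `f` in height and support. -/
noncomputable def boxTruncation (f : ℝ≥0 → ℝ≥0∞) (n : ℕ) : ℝ≥0 → ℝ≥0∞ :=
  (Set.Iic (n : ℝ≥0)).indicator fun u => min (f u) n

theorem measurable_boxTruncation {f : ℝ≥0 → ℝ≥0∞} (hf : Measurable f) (n : ℕ) :
    Measurable (boxTruncation f n) :=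
  (hf.min measurable_const).indicator measurableSet_Iic

theorem monotone_boxTruncation (f : ℝ≥0 → ℝ≥0∞) : Monotone (boxTruncation f) := by
  intro i j hij u
  have hc : (i : ℝ≥0) ≤ j := by exact_mod_cast hij
  have hc' : (i : ℝ≥0∞) ≤ j := by exact_mod_cast hij
  by_cases hi : u ≤ i
  · rw [boxTruncation, boxTruncation, Set.indicator_of_mem (show u ∈ Set.Iic (i : ℝ≥0) from hi),
      Set.indicator_of_mem (show u ∈ Set.Iic (j : ℝ≥0) from hi.trans hc)]
    exact min_le_min_left _ hc'
  · rw [boxTruncation, Set.indicator_of_notMem (show u ∉ Set.Iic (i : ℝ≥0) from hi)]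
    exact zero_le

theorem iSup_boxTruncation (f : ℝ≥0 → ℝ≥0∞) : (fun u => ⨆ n, boxTruncation f n u) = f := by
  funext u
  refine le_antisymm (iSup_le fun n => ?_) (le_of_forall_lt fun a ha => ?_)
  · exact Set.indicator_apply_le' (fun _ => min_le_left _ _) fun _ => zero_le
  · obtain ⟨n, hn⟩ := ENNReal.exists_nat_gt (ne_top_of_lt ha)
    obtain ⟨m, hm⟩ := exists_nat_ge u
    refine lt_of_lt_of_le ?_ (le_iSup _ (max n m))
    have hu : u ∈ Set.Iic ((max n m : ℕ) : ℝ≥0) :=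
      hm.trans (by exact_mod_cast le_max_right n m)
    rw [boxTruncation, Set.indicator_of_mem hu]
    exact lt_min ha (hn.trans_le (by exact_mod_cast le_max_left n m))

theorem isBoundedSupported_boxTruncation (f : ℝ≥0 → ℝ≥0∞) (n : ℕ) :
    IsBoundedSupported (boxTruncation f n) :=
  ⟨n, n, fun _ => Set.indicator_apply_le' (fun _ => (min_le_right _ _).trans (by simp))
    fun _ => zero_le, fun u hu => Set.indicator_of_notMem
      (show u ∉ Set.Iic (n : ℝ≥0) from not_le.2 hu) _⟩

/-- From h ≤ c + (H - m) one gets h² ≤ 2c² + 2(H - m)²; the cross term is moved to the left to avoid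
subtraction. -/
theorem sq_add_four_mul_le {h m H : ℝ≥0∞} {c : ℝ≥0∞} (hm : m ≠ ∞) (hH : H ≠ ∞) (hc : c ≠ ∞)
    (hle : m + h ≤ c + H) : h ^ 2 + 4 * (H * m) ≤ 2 * c ^ 2 + 2 * (H * H) + 2 * (m * m) := by
  have hh : h ≠ ∞ := ((le_add_self.trans hle).trans_lt
    (ENNReal.add_lt_top.2 ⟨hc.lt_top, hH.lt_top⟩)).ne
  lift h to ℝ≥0 using hh
  lift m to ℝ≥0 using hm
  lift H to ℝ≥0 using hH
  lift c to ℝ≥0 using hc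
  norm_cast at hle ⊢
  rw [← NNReal.coe_le_coe] at hle ⊢
  push_cast at hle ⊢
  have h0 : (0 : ℝ) ≤ h := h.2
  have h1 : (h : ℝ) ^ 2 ≤ (c + H - m : ℝ) ^ 2 := pow_le_pow_left₀ h0 (by linarith) 2
  nlinarith [sq_nonneg ((c : ℝ) - (H - m))]

/-- This is (a - c)(b - d) = (A - m)(B - n), expanded with all signs made positive. -/
theorem mul_add_mul_eq_of_add_eq {a b A B m n c d : ℝ≥0∞} (hm : m ≠ ∞) (hn : n ≠ ∞) (hA : A ≠ ∞)
    (hB : B ≠ ∞) (hc : c ≠ ∞) (hd : d ≠ ∞) (h1 : m + a = c + A) (h2 : n + b = d + B) :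
    a * b + c * d + (A * n + m * B) = a * d + c * b + (A * B + m * n) := by
  have ha : a ≠ ∞ := ((le_add_self.trans h1.le).trans_lt
    (ENNReal.add_lt_top.2 ⟨hc.lt_top, hA.lt_top⟩)).ne
  have hb : b ≠ ∞ := ((le_add_self.trans h2.le).trans_lt
    (ENNReal.add_lt_top.2 ⟨hd.lt_top, hB.lt_top⟩)).ne
  lift a to ℝ≥0 using ha
  lift b to ℝ≥0 using hb
  lift m to ℝ≥0 using hm
  lift n to ℝ≥0 using hn
  lift A to ℝ≥0 using hA
  lift B to ℝ≥0 using hB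
  lift c to ℝ≥0 using hc
  lift d to ℝ≥0 using hd
  norm_cast at h1 h2 ⊢
  rw [← NNReal.coe_inj] at h1 h2 ⊢
  push_cast at h1 h2 ⊢
  have e1 : (a : ℝ) = c + A - m := by linarith
  have e2 : (b : ℝ) = d + B - n := by linarith
  rw [e1, e2]
  ring

theorem ENNReal.mul_le_sq_add_sq (a b : ℝ≥0∞) : a * b ≤ a ^ 2 + b ^ 2 := by
  rcases le_total a b with h | h
  · calc a * b ≤ b * b := mul_le_mul_left h b
      _ = b ^ 2 := (sq b).symm
      _ ≤ a ^ 2 + b ^ 2 := le_add_self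
  · calc a * b ≤ a * a := mul_le_mul_right h a
      _ = a ^ 2 := (sq a).symm
      _ ≤ a ^ 2 + b ^ 2 := le_self_add

theorem ENNReal.iSup_mul_iSup_of_monotone {u v : ℕ → ℝ≥0∞} (hu : Monotone u) (hv : Monotone v) :
    (⨆ n, u n) * ⨆ n, v n = ⨆ n, u n * v n := by
  refine le_antisymm ?_ ENNReal.iSup_mul_le
  rw [ENNReal.iSup_mul]
  refine iSup_le fun i => ?_
  rw [ENNReal.mul_iSup]
  refine iSup_le fun j => le_iSup_of_le (max i j) ?_
  exact mul_le_mul' (hu (le_max_left i j)) (hv (le_max_right i j))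

namespace IsHawkesCounting

variable {P : Measure Ω} {G : Filtration ℝ≥0 mΩ} {N : Ω → Measure (ℝ≥0 × ℝ≥0)} {μ : ℝ≥0}
  {Φ : ℝ≥0 → ℝ≥0} {lam : ℝ≥0 → Ω → ℝ≥0} {K : ℝ≥0∞} {f g : ℝ≥0 → ℝ≥0∞}

theorem measurable_thinnedIntegral (hk : IsHawkesCounting P G N μ Φ lam) (hf : Measurable f) :
    Measurable (thinnedIntegral N lam K f) := by
  have h := hk.poisson.toIsAdaptedRandomMeasure.measurable_lintegral
    (isPredictableField_thinnedField (K := K) hk.poisson.toIsAdaptedRandomMeasure hk.predictable hf)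
  simp_rw [lintegral_thinnedField hk.predictable hf] at h
  exact h

theorem measurable_thinnedCompensator (hk : IsHawkesCounting P G N μ Φ lam) (hf : Measurable f) :
    Measurable (thinnedCompensator N lam K f) := by
  have h := (isAdaptedRandomMeasure_volume (G := G)).measurable_lintegral
    (isPredictableField_thinnedField (K := K) hk.poisson.toIsAdaptedRandomMeasure hk.predictable hf)
  simp_rw [lintegral_thinnedField_volume hk.predictable hf] at h
  exact h

theorem lintegral_thinnedIntegral [IsProbabilityMeasure P] (hk : IsHawkesCounting P G N μ Φ lam)
    (hf : Measurable f) :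
    ∫⁻ ω, thinnedIntegral N lam K f ω ∂P = ∫⁻ ω, thinnedCompensator N lam K f ω ∂P := by
  have h := hk.poisson.lintegral_lintegral_eq
    (isPredictableField_thinnedField (K := K) hk.poisson.toIsAdaptedRandomMeasure hk.predictable hf)
  simp_rw [lintegral_thinnedField hk.predictable hf,
    lintegral_thinnedField_volume hk.predictable hf] at h
  exact h

theorem isometry [IsProbabilityMeasure P] (hk : IsHawkesCounting P G N μ Φ lam)
    (hf : Measurable f) (hg : Measurable g) :
    ∫⁻ ω, thinnedIntegral N lam K f ω * thinnedIntegral N lam K g ω ∂P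
        + ∫⁻ ω, thinnedCompensator N lam K f ω * thinnedCompensator N lam K g ω ∂P
      = ∫⁻ ω, thinnedIntegral N lam K f ω * thinnedCompensator N lam K g ω ∂P
        + ∫⁻ ω, thinnedCompensator N lam K f ω * thinnedIntegral N lam K g ω ∂P
        + ∫⁻ ω, thinnedCompensator N lam K (fun u => f u * g u) ω ∂P := by
  have hN := hk.poisson.toIsAdaptedRandomMeasure
  have h := hk.poisson.isometry (isPredictableField_thinnedField (K := K) hN hk.predictable hf)
    (isPredictableField_thinnedField (K := K) hN hk.predictable hg)
  -- Both indicators are idempotent, so the product of two thinned fields is the thinned field of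
  -- the product.
  have hfg : ∀ x ω, thinnedField N lam K f x ω * thinnedField N lam K g x ω
      = thinnedField N lam K (fun u => f u * g u) x ω := fun x ω => by
    by_cases h1 : x.1 ∈ thinnedHorizon N lam K ω <;> by_cases h2 : x.2 ≤ lam x.1 ω <;>
      simp [thinnedField, h1, Set.indicator, h2]
  have hm : Measurable fun u => f u * g u := hf.mul hg
  simp_rw [hfg] at h
  simp_rw [lintegral_thinnedField hk.predictable hf, lintegral_thinnedField hk.predictable hg,
    lintegral_thinnedField_volume hk.predictable hf, lintegral_thinnedField_volume hk.predictable hg,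
    lintegral_thinnedField_volume hk.predictable hm] at h
  exact h

theorem thinnedCompensator_add_le (hk : IsHawkesCounting P G N μ Φ lam) :
    ∀ᵐ ω ∂P, ∀ K f, Measurable f →
      thinnedCompensator N lam K (hawkesDual Φ f) ω + thinnedIntegral N lam K f ω
        ≤ μ * (∫⁻ u, hawkesDual Φ f u) + thinnedIntegral N lam K (hawkesDual Φ f) ω := by
  filter_upwards [hk.solves] with ω hω K f hf
  have := sFinite_thinnedMeasure (lam := lam) hk.poisson.toIsAdaptedRandomMeasure ω
  unfold thinnedCompensator thinnedIntegral
  simp_rw [hω]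
  exact setLIntegral_hawkesDual_mul_add_le hk.measurable_kernel hf (measurableSet_thinnedHorizon ω)
    (isLowerSet_thinnedHorizon ω)

theorem thinnedCompensator_add_eq (hk : IsHawkesCounting P G N μ Φ lam) :
    ∀ᵐ ω ∂P, ∀ f, Measurable f →
      thinnedCompensator N lam ∞ (hawkesDual Φ f) ω + thinnedIntegral N lam ∞ f ω
        = μ * (∫⁻ u, hawkesDual Φ f u) + thinnedIntegral N lam ∞ (hawkesDual Φ f) ω := by
  filter_upwards [hk.solves] with ω hω f hf
  have := sFinite_thinnedMeasure (lam := lam) hk.poisson.toIsAdaptedRandomMeasure ω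
  unfold thinnedCompensator thinnedIntegral
  simp_rw [hω, thinnedHorizon_top, setLIntegral_univ]
  exact lintegral_hawkesDual_mul_add hk.measurable_kernel hf

theorem isBoundedSupported_hawkesDual (hk : IsHawkesCounting P G N μ Φ lam)
    (hf : IsBoundedSupported f) : IsBoundedSupported (hawkesDual Φ f) := by
  obtain ⟨c, T, hc, hT⟩ := hf
  have hfin : (c : ℝ≥0∞) * (1 + ∫⁻ u, hawkesPsi Φ u) ≠ ∞ := by
    refine ENNReal.mul_ne_top ENNReal.coe_ne_top (ENNReal.add_ne_top.2 ⟨by simp, ?_⟩)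
    exact (lintegral_hawkesPsi_lt_top hk.measurable_kernel hk.kernel_lt_one).ne
  refine ⟨(c * (1 + ∫⁻ u, hawkesPsi Φ u)).toNNReal, T, fun u => ?_, fun u hu =>
    hawkesDual_eq_zero hT hu⟩
  rw [ENNReal.coe_toNNReal hfin]
  exact hawkesDual_le hk.measurable_kernel hc u

theorem thinnedIntegral_le (hk : IsHawkesCounting P G N μ Φ lam) {c : ℝ≥0} (hc : ∀ u, f u ≤ c)
    (ω : Ω) : thinnedIntegral N lam K f ω ≤ c * (K + 1) :=
  calc thinnedIntegral N lam K f ω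
      ≤ ∫⁻ u in thinnedHorizon N lam K ω, (c : ℝ≥0∞) ∂thinnedMeasure N lam ω := lintegral_mono hc
    _ ≤ c * (K + 1) := by
        rw [setLIntegral_const]
        exact mul_le_mul_right (measure_setOf_measure_Iio_le
          (thinnedMeasure_singleton_le hk.poisson ω)) _

/-- Up to the horizon ν has mass at most `K + 1`. The compensator is bounded too, since f ≤ h and
the pathwise inequality bounds ∫ h λ by μ ∫ h + ∫ h dν. -/
theorem exists_bound (hk : IsHawkesCounting P G N μ Φ lam) (hf : Measurable f)
    (hb : IsBoundedSupported f) (hK : K ≠ ∞) : ∃ C : ℝ≥0∞, C ≠ ∞ ∧ ∀ᵐ ω ∂P,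
      thinnedIntegral N lam K f ω ≤ C ∧ thinnedCompensator N lam K f ω ≤ C := by
  have hb' := hk.isBoundedSupported_hawkesDual hb
  have hI := hb'.lintegral_lt_top
  obtain ⟨c, -, hc, -⟩ := hb
  obtain ⟨c', -, hc', -⟩ := hb'
  refine ⟨c * (K + 1) + (μ * (∫⁻ u, hawkesDual Φ f u) + c' * (K + 1)), ?_, ?_⟩
  · have hK1 : K + 1 ≠ ∞ := ENNReal.add_ne_top.2 ⟨hK, by simp⟩
    exact ENNReal.add_ne_top.2 ⟨ENNReal.mul_ne_top ENNReal.coe_ne_top hK1, ENNReal.add_ne_top.2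
      ⟨ENNReal.mul_ne_top ENNReal.coe_ne_top hI.ne, ENNReal.mul_ne_top ENNReal.coe_ne_top hK1⟩⟩
  · filter_upwards [hk.thinnedCompensator_add_le] with ω hω
    refine ⟨(hk.thinnedIntegral_le hc ω).trans le_self_add, ?_⟩
    have h1 : thinnedCompensator N lam K f ω ≤ thinnedCompensator N lam K (hawkesDual Φ f) ω :=
      lintegral_mono fun u => mul_le_mul_left (le_hawkesDual f u) _
    refine h1.trans (le_self_add.trans ((hω K f hf).trans ?_))
    exact (add_le_add_right (hk.thinnedIntegral_le hc' ω) _).trans le_add_self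

/-- Non-explosion enters here: the horizons at integer levels exhaust the half-line. -/
theorem thinnedIntegral_top_eq_iSup (hk : IsHawkesCounting P G N μ Φ lam) :
    ∀ᵐ ω ∂P, ∀ f, thinnedIntegral N lam ∞ f ω = ⨆ n : ℕ, thinnedIntegral N lam n f ω := by
  filter_upwards [hk.counting] with ω hω f
  have hm : Monotone fun n : ℕ => thinnedHorizon N lam n ω := fun i j hij u hu =>
    le_trans (show thinnedMeasure N lam ω (Set.Iio u) ≤ i from hu) (by exact_mod_cast hij)
  have hU : ⋃ n : ℕ, thinnedHorizon N lam n ω = Set.univ :=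
    Set.eq_univ_of_forall fun u => by
      obtain ⟨n, hn⟩ := ENNReal.exists_nat_gt (hω u).ne
      exact Set.mem_iUnion.2 ⟨n, hn.le⟩
  unfold thinnedIntegral
  rw [thinnedHorizon_top, ← hU, setLIntegral_iUnion_of_directed _ hm.directed_le]

theorem monotone_thinnedIntegral (f : ℝ≥0 → ℝ≥0∞) (ω : Ω) :
    Monotone fun n : ℕ => thinnedIntegral N lam n f ω := fun i j hij =>
  lintegral_mono_set fun u hu =>
    le_trans (show thinnedMeasure N lam ω (Set.Iio u) ≤ i from hu) (by exact_mod_cast hij)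

variable [IsProbabilityMeasure P]

/-- In the mean of the pathwise inequality, E ∫ h λ and E ∫ h dν agree up to the horizon and are
finite, so they cancel. The resulting bound does not depend on `K`. -/
theorem lintegral_thinnedIntegral_le (hk : IsHawkesCounting P G N μ Φ lam) (hf : Measurable f)
    (hb : IsBoundedSupported f) (hK : K ≠ ∞) :
    ∫⁻ ω, thinnedIntegral N lam K f ω ∂P ≤ μ * ∫⁻ u, hawkesDual Φ f u := by
  have hd := measurable_hawkesDual hk.measurable_kernel hf
  obtain ⟨C, hC, hCb⟩ := hk.exists_bound hd (hk.isBoundedSupported_hawkesDual hb) hK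
  have hfin : ∫⁻ ω, thinnedIntegral N lam K (hawkesDual Φ f) ω ∂P ≠ ∞ := by
    refine ((lintegral_mono_ae (g := fun _ => C) (hCb.mono fun ω h => h.1)).trans_lt ?_).ne
    simpa using hC.lt_top
  have h1 : ∫⁻ ω, thinnedCompensator N lam K (hawkesDual Φ f) ω ∂P
        + ∫⁻ ω, thinnedIntegral N lam K f ω ∂P
      ≤ μ * (∫⁻ u, hawkesDual Φ f u) + ∫⁻ ω, thinnedIntegral N lam K (hawkesDual Φ f) ω ∂P := by
    rw [← lintegral_add_left (hk.measurable_thinnedCompensator hd)]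
    refine (lintegral_mono_ae (hk.thinnedCompensator_add_le.mono fun ω h => h K f hf)).trans ?_
    rw [lintegral_add_left measurable_const]
    simp
  rw [← hk.lintegral_thinnedIntegral hd, add_comm] at h1
  exact (ENNReal.add_le_add_iff_right hfin).1 h1

theorem lintegral_thinnedIntegral_top_lt_top (hk : IsHawkesCounting P G N μ Φ lam)
    (hf : Measurable f) (hb : IsBoundedSupported f) :
    ∫⁻ ω, thinnedIntegral N lam ∞ f ω ∂P < ∞ := by
  have h1 : ∫⁻ ω, thinnedIntegral N lam ∞ f ω ∂P ≤ μ * ∫⁻ u, hawkesDual Φ f u := by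
    rw [lintegral_congr_ae (hk.thinnedIntegral_top_eq_iSup.mono fun ω h => h f),
      lintegral_iSup (fun n => hk.measurable_thinnedIntegral hf)
        fun i j hij ω => monotone_thinnedIntegral f ω hij]
    exact iSup_le fun n => hk.lintegral_thinnedIntegral_le hf hb (by simp)
  exact h1.trans_lt (ENNReal.mul_lt_top ENNReal.coe_lt_top
    (hk.isBoundedSupported_hawkesDual hb).lintegral_lt_top)

/-- The same cancellation without stopping is now legitimate, because the mean for h itself is
already known to be finite. -/
theorem lintegral_thinnedIntegral_top_of_bounded (hk : IsHawkesCounting P G N μ Φ lam)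
    (hf : Measurable f) (hb : IsBoundedSupported f) :
    ∫⁻ ω, thinnedIntegral N lam ∞ f ω ∂P = μ * ∫⁻ u, hawkesDual Φ f u := by
  have hd := measurable_hawkesDual hk.measurable_kernel hf
  have hfin := hk.lintegral_thinnedIntegral_top_lt_top hd (hk.isBoundedSupported_hawkesDual hb)
  have h1 : ∫⁻ ω, thinnedCompensator N lam ∞ (hawkesDual Φ f) ω ∂P
        + ∫⁻ ω, thinnedIntegral N lam ∞ f ω ∂P
      = μ * (∫⁻ u, hawkesDual Φ f u) + ∫⁻ ω, thinnedIntegral N lam ∞ (hawkesDual Φ f) ω ∂P := by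
    rw [← lintegral_add_left (hk.measurable_thinnedCompensator hd),
      lintegral_congr_ae (hk.thinnedCompensator_add_eq.mono fun ω h => h f hf),
      lintegral_add_left measurable_const]
    simp
  rw [← hk.lintegral_thinnedIntegral hd, add_comm] at h1
  exact (ENNReal.add_left_inj hfin.ne).1 h1

/-- Squares of integrals of bounded functions with bounded support are integrable. -/
theorem lintegral_thinnedIntegral_sq_lt_top (hk : IsHawkesCounting P G N μ Φ lam)
    (hf : Measurable f) (hb : IsBoundedSupported f) :
    ∫⁻ ω, thinnedIntegral N lam ∞ f ω ^ 2 ∂P < ∞ := by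
  have hd := measurable_hawkesDual hk.measurable_kernel hf
  have hdb := hk.isBoundedSupported_hawkesDual hb
  have hc : μ * ∫⁻ u, hawkesDual Φ f u ≠ ∞ :=
    ENNReal.mul_ne_top ENNReal.coe_ne_top hdb.lintegral_lt_top.ne
  set c := μ * ∫⁻ u, hawkesDual Φ f u with hcdef
  set Q := ∫⁻ ω, thinnedIntegral N lam ∞ (fun u => hawkesDual Φ f u * hawkesDual Φ f u) ω ∂P
  have hQ : Q < ∞ := hk.lintegral_thinnedIntegral_top_lt_top (hd.mul hd) (hdb.mul hdb)
  have key : ∀ n : ℕ, ∫⁻ ω, thinnedIntegral N lam n f ω ^ 2 ∂P ≤ 2 * c ^ 2 + 2 * Q := by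
    intro n
    obtain ⟨C, hC, hCb⟩ := hk.exists_bound hd hdb (K := n) (by simp)
    have hI := hk.measurable_thinnedIntegral (K := n) hd
    have hM := hk.measurable_thinnedCompensator (K := n) hd
    have hpt : ∀ᵐ ω ∂P, thinnedIntegral N lam n f ω ^ 2
        + 4 * (thinnedIntegral N lam n (hawkesDual Φ f) ω
          * thinnedCompensator N lam n (hawkesDual Φ f) ω)
        ≤ 2 * c ^ 2 + 2 * (thinnedIntegral N lam n (hawkesDual Φ f) ω
            * thinnedIntegral N lam n (hawkesDual Φ f) ω)
          + 2 * (thinnedCompensator N lam n (hawkesDual Φ f) ω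
            * thinnedCompensator N lam n (hawkesDual Φ f) ω) := by
      filter_upwards [hk.thinnedCompensator_add_le, hCb] with ω h1 h2
      exact sq_add_four_mul_le (h2.2.trans_lt hC.lt_top).ne (h2.1.trans_lt hC.lt_top).ne hc
        (h1 n f hf)
    have hint := lintegral_mono_ae hpt
    have hiso := hk.isometry (K := n) hd hd
    have hHm : ∫⁻ ω, thinnedIntegral N lam n (hawkesDual Φ f) ω
          * thinnedCompensator N lam n (hawkesDual Φ f) ω ∂P ≠ ∞ := by
      refine ((lintegral_mono_ae (g := fun _ => C * C)
        (hCb.mono fun ω h => mul_le_mul' h.1 h.2)).trans_lt ?_).ne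
      simpa using ENNReal.mul_lt_top hC.lt_top hC.lt_top
    have hcomm : ∫⁻ ω, thinnedCompensator N lam n (hawkesDual Φ f) ω
          * thinnedIntegral N lam n (hawkesDual Φ f) ω ∂P
        = ∫⁻ ω, thinnedIntegral N lam n (hawkesDual Φ f) ω
          * thinnedCompensator N lam n (hawkesDual Φ f) ω ∂P :=
      lintegral_congr fun ω => mul_comm _ _
    have hIM : Measurable fun ω => thinnedIntegral N lam n (hawkesDual Φ f) ω
        * thinnedCompensator N lam n (hawkesDual Φ f) ω := hI.mul hM
    have hII : Measurable fun ω => thinnedIntegral N lam n (hawkesDual Φ f) ω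
        * thinnedIntegral N lam n (hawkesDual Φ f) ω := hI.mul hI
    have hMM : Measurable fun ω => thinnedCompensator N lam n (hawkesDual Φ f) ω
        * thinnedCompensator N lam n (hawkesDual Φ f) ω := hM.mul hM
    rw [lintegral_add_left ((hk.measurable_thinnedIntegral hf).pow_const 2),
      lintegral_const_mul _ hIM, lintegral_add_right _ (hMM.const_mul 2),
      lintegral_add_left measurable_const, lintegral_const_mul _ hII,
      lintegral_const_mul _ hMM, lintegral_const, measure_univ, mul_one] at hint
    rw [hcomm] at hiso
    -- The quadratic variation term is bounded uniformly in `n` by a first moment.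
    have hQn : ∫⁻ ω, thinnedCompensator N lam n
        (fun u => hawkesDual Φ f u * hawkesDual Φ f u) ω ∂P ≤ Q := by
      have hm : Measurable fun u => hawkesDual Φ f u * hawkesDual Φ f u := hd.mul hd
      rw [← hk.lintegral_thinnedIntegral hm]
      exact lintegral_mono fun ω => lintegral_mono_set fun u _ => by simp
    set HM := ∫⁻ ω, thinnedIntegral N lam n (hawkesDual Φ f) ω
          * thinnedCompensator N lam n (hawkesDual Φ f) ω ∂P
    have h4 : 4 * HM ≠ ∞ := ENNReal.mul_ne_top (by simp) hHm
    -- By the isometry 2(E H² + E M²) = 4 E HM + 2 E ∫ h² λ, so the cross terms cancel and leave a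
    -- bound free of `n`.
    refine (ENNReal.add_le_add_iff_right h4).1 (hint.trans ?_)
    rw [add_assoc, ← mul_add, hiso]
    calc 2 * c ^ 2 + 2 * (HM + HM + ∫⁻ ω, thinnedCompensator N lam n
          (fun u => hawkesDual Φ f u * hawkesDual Φ f u) ω ∂P)
        ≤ 2 * c ^ 2 + 2 * (HM + HM + Q) := by gcongr
      _ = 2 * c ^ 2 + 2 * Q + 4 * HM := by ring
  have hsup : ∫⁻ ω, thinnedIntegral N lam ∞ f ω ^ 2 ∂P
      = ⨆ n : ℕ, ∫⁻ ω, thinnedIntegral N lam n f ω ^ 2 ∂P := by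
    rw [← lintegral_iSup (fun n => (hk.measurable_thinnedIntegral hf).pow_const 2)
      fun i j hij ω => pow_le_pow_left₀ zero_le (monotone_thinnedIntegral f ω hij) 2]
    refine lintegral_congr_ae (hk.thinnedIntegral_top_eq_iSup.mono fun ω h => ?_)
    simp only
    simp_rw [h f, sq]
    exact ENNReal.iSup_mul_iSup_of_monotone (monotone_thinnedIntegral f ω)
      (monotone_thinnedIntegral f ω)
  rw [hsup]
  refine (iSup_le key).trans_lt (ENNReal.add_lt_top.2 ⟨?_, ENNReal.mul_lt_top (by simp) hQ⟩)
  exact ENNReal.mul_lt_top (by simp) (ENNReal.pow_lt_top hc.lt_top)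

/-- The centred integrals of f and g are the compensated integrals of their duals. The isometry
turns the covariance into the mean of the compensator of h_f h_g, and the first moment formula for
h_f h_g finishes. -/
theorem lintegral_thinnedIntegral_mul_of_bounded (hk : IsHawkesCounting P G N μ Φ lam)
    (hf : Measurable f) (hg : Measurable g) (hbf : IsBoundedSupported f)
    (hbg : IsBoundedSupported g) :
    ∫⁻ ω, thinnedIntegral N lam ∞ f ω * thinnedIntegral N lam ∞ g ω ∂P
      = (μ * ∫⁻ u, hawkesDual Φ f u) * (μ * ∫⁻ u, hawkesDual Φ g u)
        + μ * ∫⁻ u, hawkesDual Φ (fun u => hawkesDual Φ f u * hawkesDual Φ g u) u := by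
  have hΦ := hk.measurable_kernel
  have hdf := measurable_hawkesDual hΦ hf
  have hdg := measurable_hawkesDual hΦ hg
  have hdbf := hk.isBoundedSupported_hawkesDual hbf
  have hdbg := hk.isBoundedSupported_hawkesDual hbg
  have hcf : μ * ∫⁻ u, hawkesDual Φ f u ≠ ∞ :=
    ENNReal.mul_ne_top ENNReal.coe_ne_top hdbf.lintegral_lt_top.ne
  have hcg : μ * ∫⁻ u, hawkesDual Φ g u ≠ ∞ :=
    ENNReal.mul_ne_top ENNReal.coe_ne_top hdbg.lintegral_lt_top.ne
  have hEf := hk.lintegral_thinnedIntegral_top_of_bounded hf hbf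
  have hEg := hk.lintegral_thinnedIntegral_top_of_bounded hg hbg
  set c := μ * ∫⁻ u, hawkesDual Φ f u
  set d := μ * ∫⁻ u, hawkesDual Φ g u
  have hsqH : ∀ {f}, Measurable f → IsBoundedSupported f →
      ∫⁻ ω, thinnedIntegral N lam ∞ f ω ^ 2 ∂P < ∞ := fun hf hb =>
    hk.lintegral_thinnedIntegral_sq_lt_top hf hb
  have hsqM : ∀ {f}, Measurable f → IsBoundedSupported f →
      ∫⁻ ω, thinnedCompensator N lam ∞ (hawkesDual Φ f) ω ^ 2 ∂P < ∞ := by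
    intro f hf hb
    have hd := measurable_hawkesDual hΦ hf
    have hdb := hk.isBoundedSupported_hawkesDual hb
    have hc : μ * ∫⁻ u, hawkesDual Φ f u ≠ ∞ :=
      ENNReal.mul_ne_top ENNReal.coe_ne_top hdb.lintegral_lt_top.ne
    -- The pathwise identity bounds the compensator by a constant plus the integral of the dual,
    -- whose square is integrable.
    have hle : ∫⁻ ω, thinnedCompensator N lam ∞ (hawkesDual Φ f) ω ^ 2 ∂P
        ≤ ∫⁻ ω, 3 * (μ * ∫⁻ u, hawkesDual Φ f u) ^ 2
          + 3 * thinnedIntegral N lam ∞ (hawkesDual Φ f) ω ^ 2 ∂P := by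
      refine lintegral_mono_ae (hk.thinnedCompensator_add_eq.mono fun ω h => ?_)
      have h1 := (le_self_add.trans (h f hf).le)
      refine (pow_le_pow_left₀ zero_le h1 2).trans ?_
      have h2 := ENNReal.mul_le_sq_add_sq (μ * ∫⁻ u, hawkesDual Φ f u)
        (thinnedIntegral N lam ∞ (hawkesDual Φ f) ω)
      set a := μ * ∫⁻ u, hawkesDual Φ f u
      set b := thinnedIntegral N lam ∞ (hawkesDual Φ f) ω
      calc (a + b) ^ 2 = a ^ 2 + b ^ 2 + 2 * (a * b) := by ring
        _ ≤ a ^ 2 + b ^ 2 + 2 * (a ^ 2 + b ^ 2) := by gcongr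
        _ = 3 * a ^ 2 + 3 * b ^ 2 := by ring
    refine hle.trans_lt ?_
    rw [lintegral_add_left measurable_const,
      lintegral_const_mul _ ((hk.measurable_thinnedIntegral hd).pow_const 2)]
    refine ENNReal.add_lt_top.2 ⟨?_, ENNReal.mul_lt_top (by simp) (hsqH hd hdb)⟩
    simpa using ENNReal.mul_lt_top (by simp) (ENNReal.pow_lt_top hc.lt_top)
  have hprod : ∀ {X Y : Ω → ℝ≥0∞}, Measurable X → ∫⁻ ω, X ω ^ 2 ∂P < ∞ → ∫⁻ ω, Y ω ^ 2 ∂P < ∞ →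
      ∫⁻ ω, X ω * Y ω ∂P ≠ ∞ := by
    intro X Y hX hX2 hY2
    refine ((lintegral_mono fun ω => ENNReal.mul_le_sq_add_sq (X ω) (Y ω)).trans_lt ?_).ne
    rw [lintegral_add_left (hX.pow_const 2)]
    exact ENNReal.add_lt_top.2 ⟨hX2, hY2⟩
  have hae : ∀ {X : Ω → ℝ≥0∞}, Measurable X → ∫⁻ ω, X ω ^ 2 ∂P < ∞ → ∀ᵐ ω ∂P, X ω ≠ ∞ := by
    intro X hX hX2
    filter_upwards [ae_lt_top (hX.pow_const 2) hX2.ne] with ω hω h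
    rw [h] at hω
    simp at hω
  have mf := hk.measurable_thinnedIntegral (K := ∞) hf
  have mg := hk.measurable_thinnedIntegral (K := ∞) hg
  have mA := hk.measurable_thinnedIntegral (K := ∞) hdf
  have mB := hk.measurable_thinnedIntegral (K := ∞) hdg
  have mM := hk.measurable_thinnedCompensator (K := ∞) hdf
  have mN := hk.measurable_thinnedCompensator (K := ∞) hdg
  have hpt : ∀ᵐ ω ∂P, thinnedIntegral N lam ∞ f ω * thinnedIntegral N lam ∞ g ω + c * d
      + (thinnedIntegral N lam ∞ (hawkesDual Φ f) ω * thinnedCompensator N lam ∞ (hawkesDual Φ g) ω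
        + thinnedCompensator N lam ∞ (hawkesDual Φ f) ω
          * thinnedIntegral N lam ∞ (hawkesDual Φ g) ω)
      = thinnedIntegral N lam ∞ f ω * d + c * thinnedIntegral N lam ∞ g ω
        + (thinnedIntegral N lam ∞ (hawkesDual Φ f) ω * thinnedIntegral N lam ∞ (hawkesDual Φ g) ω
          + thinnedCompensator N lam ∞ (hawkesDual Φ f) ω
            * thinnedCompensator N lam ∞ (hawkesDual Φ g) ω) := by
    filter_upwards [hk.thinnedCompensator_add_eq, hae mA (hsqH hdf hdbf), hae mB (hsqH hdg hdbg),
      hae mM (hsqM hf hbf), hae mN (hsqM hg hbg)] with ω h hA hB hM hN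
    exact mul_add_mul_eq_of_add_eq hM hN hA hB hcf hcg (h f hf) (h g hg)
  have hint := lintegral_congr_ae hpt
  have hiso := hk.isometry (K := ∞) hdf hdg
  have hX1 : ∫⁻ ω, thinnedIntegral N lam ∞ (hawkesDual Φ f) ω
      * thinnedCompensator N lam ∞ (hawkesDual Φ g) ω ∂P ≠ ∞ :=
    hprod mA (hsqH hdf hdbf) (hsqM hg hbg)
  have hX2 : ∫⁻ ω, thinnedCompensator N lam ∞ (hawkesDual Φ f) ω
      * thinnedIntegral N lam ∞ (hawkesDual Φ g) ω ∂P ≠ ∞ :=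
    hprod mM (hsqM hf hbf) (hsqH hdg hdbg)
  have mfg' : Measurable fun u => hawkesDual Φ f u * hawkesDual Φ g u := hdf.mul hdg
  have mfg : Measurable fun ω => thinnedIntegral N lam ∞ f ω * thinnedIntegral N lam ∞ g ω := mf.mul mg
  have mfgc : Measurable fun ω => thinnedIntegral N lam ∞ f ω * thinnedIntegral N lam ∞ g ω + c * d :=
    mfg.add measurable_const
  have mAN : Measurable fun ω => thinnedIntegral N lam ∞ (hawkesDual Φ f) ω
      * thinnedCompensator N lam ∞ (hawkesDual Φ g) ω := mA.mul mN
  have mAB : Measurable fun ω => thinnedIntegral N lam ∞ (hawkesDual Φ f) ω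
      * thinnedIntegral N lam ∞ (hawkesDual Φ g) ω := mA.mul mB
  have mfd : Measurable fun ω => thinnedIntegral N lam ∞ f ω * d + c * thinnedIntegral N lam ∞ g ω :=
    (mf.mul_const d).add (mg.const_mul c)
  rw [lintegral_add_left mfgc, lintegral_add_left mfg, lintegral_add_left mAN,
    lintegral_add_left mfd, lintegral_add_left (mf.mul_const d), lintegral_add_left mAB, hiso,
    lintegral_mul_const _ mf, lintegral_const_mul _ mg, hEf, hEg, lintegral_const, measure_univ,
    mul_one, ← hk.lintegral_thinnedIntegral mfg',
    hk.lintegral_thinnedIntegral_top_of_bounded mfg' (hdbf.mul hdbg)] at hint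
  set X := ∫⁻ ω, thinnedIntegral N lam ∞ (hawkesDual Φ f) ω
      * thinnedCompensator N lam ∞ (hawkesDual Φ g) ω ∂P
  set Y := ∫⁻ ω, thinnedCompensator N lam ∞ (hawkesDual Φ f) ω
      * thinnedIntegral N lam ∞ (hawkesDual Φ g) ω ∂P
  have hcd : c * d ≠ ∞ := ENNReal.mul_ne_top hcf hcg
  have hfin : c * d + (X + Y) ≠ ∞ :=
    ENNReal.add_ne_top.2 ⟨hcd, ENNReal.add_ne_top.2 ⟨hX1, hX2⟩⟩
  refine (ENNReal.add_left_inj hfin).1 ?_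
  rw [← add_assoc, hint]
  ring

/-- Both sides commute with increasing limits, so truncation in height and support suffices and
infinite values are allowed. -/
theorem lintegral_thinnedIntegral_top (hk : IsHawkesCounting P G N μ Φ lam) (hf : Measurable f) :
    ∫⁻ ω, thinnedIntegral N lam ∞ f ω ∂P
      = μ * ∫⁻ v, f v * (1 + ∫⁻ w in Set.Iic v, hawkesPsi Φ w) := by
  have hm := measurable_boxTruncation hf
  have hmono := monotone_boxTruncation f
  rw [← lintegral_hawkesDual hk.measurable_kernel hf, ← iSup_boxTruncation f]
  simp_rw [thinnedIntegral_iSup hm hmono, hawkesDual_iSup hk.measurable_kernel hm hmono]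
  rw [lintegral_iSup (fun n => hk.measurable_thinnedIntegral (hm n))
      fun i j hij ω => lintegral_mono (hmono hij),
    lintegral_iSup (fun n => measurable_hawkesDual hk.measurable_kernel (hm n))
      fun i j hij => hawkesDual_mono (hmono hij), ENNReal.mul_iSup]
  exact iSup_congr fun n => hk.lintegral_thinnedIntegral_top_of_bounded (hm n)
    (isBoundedSupported_boxTruncation f n)

theorem lintegral_thinnedIntegral_mul (hk : IsHawkesCounting P G N μ Φ lam)
    (hf : Measurable f) (hg : Measurable g) :
    ∫⁻ ω, thinnedIntegral N lam ∞ f ω * thinnedIntegral N lam ∞ g ω ∂P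
      = (∫⁻ ω, thinnedIntegral N lam ∞ f ω ∂P) * (∫⁻ ω, thinnedIntegral N lam ∞ g ω ∂P)
        + μ * ∫⁻ v, hawkesDual Φ f v * hawkesDual Φ g v
            * (1 + ∫⁻ w in Set.Iic v, hawkesPsi Φ w) := by
  have hΦ := hk.measurable_kernel
  have mf := measurable_boxTruncation hf
  have mg := measurable_boxTruncation hg
  have hmf := monotone_boxTruncation f
  have hmg := monotone_boxTruncation g
  have df : ∀ n, Measurable (hawkesDual Φ (boxTruncation f n)) :=
    fun n => measurable_hawkesDual hΦ (mf n)
  have dg : ∀ n, Measurable (hawkesDual Φ (boxTruncation g n)) :=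
    fun n => measurable_hawkesDual hΦ (mg n)
  have dmf : Monotone fun n => hawkesDual Φ (boxTruncation f n) := fun i j hij =>
    hawkesDual_mono (hmf hij)
  have dmg : Monotone fun n => hawkesDual Φ (boxTruncation g n) := fun i j hij =>
    hawkesDual_mono (hmg hij)
  have hfg : Measurable fun v => hawkesDual Φ f v * hawkesDual Φ g v :=
    (measurable_hawkesDual hΦ hf).mul (measurable_hawkesDual hΦ hg)
  have If : Monotone fun n ω => thinnedIntegral N lam ∞ (boxTruncation f n) ω := fun i j hij ω =>
    lintegral_mono (hmf hij)
  have Ig : Monotone fun n ω => thinnedIntegral N lam ∞ (boxTruncation g n) ω := fun i j hij ω =>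
    lintegral_mono (hmg hij)
  have key := fun n => hk.lintegral_thinnedIntegral_mul_of_bounded (mf n) (mg n)
    (isBoundedSupported_boxTruncation f n) (isBoundedSupported_boxTruncation g n)
  simp_rw [← hk.lintegral_thinnedIntegral_top_of_bounded (mf _) (isBoundedSupported_boxTruncation f _),
    ← hk.lintegral_thinnedIntegral_top_of_bounded (mg _) (isBoundedSupported_boxTruncation g _)] at key
  rw [← lintegral_hawkesDual hΦ hfg, ← iSup_boxTruncation f, ← iSup_boxTruncation g]
  simp_rw [thinnedIntegral_iSup mf hmf, thinnedIntegral_iSup mg hmg,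
    hawkesDual_iSup hΦ mf hmf, hawkesDual_iSup hΦ mg hmg]
  have e1 : ∀ ω, (⨆ n, thinnedIntegral N lam ∞ (boxTruncation f n) ω)
      * (⨆ n, thinnedIntegral N lam ∞ (boxTruncation g n) ω)
      = ⨆ n, thinnedIntegral N lam ∞ (boxTruncation f n) ω
        * thinnedIntegral N lam ∞ (boxTruncation g n) ω := fun ω =>
    ENNReal.iSup_mul_iSup_of_monotone (fun i j hij => If hij ω) fun i j hij => Ig hij ω
  have e2 : ∀ v, (⨆ n, hawkesDual Φ (boxTruncation f n) v) * (⨆ n, hawkesDual Φ (boxTruncation g n) v)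
      = ⨆ n, hawkesDual Φ (boxTruncation f n) v * hawkesDual Φ (boxTruncation g n) v := fun v =>
    ENNReal.iSup_mul_iSup_of_monotone (fun i j hij => dmf hij v) fun i j hij => dmg hij v
  have dm : Monotone fun n v => hawkesDual Φ (boxTruncation f n) v * hawkesDual Φ (boxTruncation g n) v :=
    fun i j hij v => mul_le_mul' (dmf hij v) (dmg hij v)
  have dmeas : ∀ n, Measurable fun v =>
      hawkesDual Φ (boxTruncation f n) v * hawkesDual Φ (boxTruncation g n) v := fun n =>
    (df n).mul (dg n)
  have hII : ∀ n, Measurable fun ω => thinnedIntegral N lam ∞ (boxTruncation f n) ω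
      * thinnedIntegral N lam ∞ (boxTruncation g n) ω := fun n =>
    (hk.measurable_thinnedIntegral (mf n)).mul (hk.measurable_thinnedIntegral (mg n))
  simp_rw [e1, e2]
  rw [lintegral_iSup hII fun i j hij ω => mul_le_mul' (If hij ω) (Ig hij ω),
    lintegral_iSup (fun n => hk.measurable_thinnedIntegral (mf n)) If,
    lintegral_iSup (fun n => hk.measurable_thinnedIntegral (mg n)) Ig]
  simp_rw [hawkesDual_iSup hΦ dmeas dm]
  have mEf : Monotone fun n => ∫⁻ ω, thinnedIntegral N lam ∞ (boxTruncation f n) ω ∂P :=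
    fun i j hij => lintegral_mono (If hij)
  have mEg : Monotone fun n => ∫⁻ ω, thinnedIntegral N lam ∞ (boxTruncation g n) ω ∂P :=
    fun i j hij => lintegral_mono (Ig hij)
  rw [lintegral_iSup (fun n => measurable_hawkesDual hΦ (dmeas n))
      fun i j hij => hawkesDual_mono (dm hij), ENNReal.iSup_mul_iSup_of_monotone mEf mEg,
    ENNReal.mul_iSup, ENNReal.iSup_add_iSup_of_monotone
      (fun i j hij => mul_le_mul' (mEf hij) (mEg hij))
      fun i j hij => mul_le_mul_right (lintegral_mono (hawkesDual_mono (dm hij))) _]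
  exact iSup_congr key

end IsHawkesCounting

end Moments

/-! ### Delayed kernels and their resolvents -/

section DelayKernel

/-- The function `u ↦ ζ (t - u)` on `[0, t)`, extended by zero. -/
noncomputable def delayKernel (ζ : ℝ≥0 → ℝ≥0) (t : ℝ≥0) : ℝ≥0 → ℝ≥0∞ :=
  (Set.Iio t).indicator fun u => (ζ (t - u) : ℝ≥0∞)

variable {Φ ζ : ℝ≥0 → ℝ≥0} {W : ℝ≥0 → ℝ≥0∞} {s t : ℝ≥0}

theorem measurable_delayKernel (hζ : Measurable ζ) (t : ℝ≥0) : Measurable (delayKernel ζ t) :=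
  Measurable.indicator (by fun_prop) measurableSet_Iio

theorem setLIntegral_Iio_eq_Iic (g : ℝ≥0 → ℝ≥0∞) (t : ℝ≥0) :
    ∫⁻ u in Set.Iio t, g u = ∫⁻ u in Set.Iic t, g u :=
  setLIntegral_congr Iio_ae_eq_Iic

theorem hawkesDual_delayKernel (ζ : ℝ≥0 → ℝ≥0) (t v : ℝ≥0) :
    hawkesDual Φ (delayKernel ζ t) v
      = delayKernel ζ t v + ∫⁻ u in Set.Ioo v t, (ζ (t - u) : ℝ≥0∞) * hawkesPsi Φ (u - v) := by
  rw [hawkesDual, ← Set.Ioi_inter_Iio, Set.inter_comm, ← Measure.restrict_restrict measurableSet_Iio,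
    ← lintegral_indicator measurableSet_Iio]
  congr 1
  refine lintegral_congr fun u => ?_
  by_cases hu : u ∈ Set.Iio t <;> simp [delayKernel, hu]

/-- After translation this is the resolvent equation Ψ = Φ + Ψ*Φ at time `s - v`. -/
theorem hawkesDual_delayKernel_self (hΦ : Measurable Φ) (s : ℝ≥0) :
    hawkesDual Φ (delayKernel Φ s) = (Set.Iio s).indicator fun v => hawkesPsi Φ (s - v) := by
  funext v
  rw [hawkesDual_delayKernel]
  by_cases hv : v ∈ Set.Iio s
  · rw [Set.indicator_of_mem hv, delayKernel, Set.indicator_of_mem hv, hawkesPsi_eq hΦ (s - v)]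
    congr 1
    simp_rw [mul_comm (Φ _ : ℝ≥0∞)]
    exact setLIntegral_Ioo_translate (measurable_hawkesPsi hΦ) hΦ.coe_nnreal_ennreal v s
  · rw [Set.indicator_of_notMem hv, delayKernel, Set.indicator_of_notMem hv,
      Set.Ioo_eq_empty (show ¬ v < s from hv)]
    simp

theorem hawkesDual_delayKernel_one (s : ℝ≥0) :
    hawkesDual Φ (delayKernel (fun _ => 1) s)
      = (Set.Iio s).indicator fun v => 1 + ∫⁻ y in Set.Icc v s, hawkesPsi Φ (y - v) := by
  funext v
  rw [hawkesDual_delayKernel]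
  by_cases hv : v ∈ Set.Iio s
  · rw [Set.indicator_of_mem hv, delayKernel, Set.indicator_of_mem hv]
    simp only [ENNReal.coe_one, one_mul]
    rw [setLIntegral_congr Ioo_ae_eq_Icc]
  · rw [Set.indicator_of_notMem hv, delayKernel, Set.indicator_of_notMem hv,
      Set.Ioo_eq_empty (show ¬ v < s from hv)]
    simp

theorem measurable_setLIntegral_hawkesPsi_Icc (hΦ : Measurable Φ) (s : ℝ≥0) :
    Measurable fun v => ∫⁻ y in Set.Icc v s, hawkesPsi Φ (y - v) := by
  have hΨ := measurable_hawkesPsi hΦ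
  have h := measurable_setLIntegral_of_lt
    (g := fun v y => (Set.Iic s).indicator (fun _ => (1 : ℝ≥0∞)) y * hawkesPsi Φ (y - v))
    (((measurable_const.indicator measurableSet_Iic).comp measurable_snd).mul (by fun_prop))
  convert h using 2 with v
  rw [← setLIntegral_congr Ioc_ae_eq_Icc, ← Set.Ioi_inter_Iic, Set.inter_comm,
    ← Measure.restrict_restrict measurableSet_Iic, ← lintegral_indicator measurableSet_Iic]
  refine lintegral_congr fun u => ?_
  by_cases hu : u ∈ Set.Iic s <;> simp [hu]

theorem measurable_setLIntegral_hawkesPsi_Iic (hΦ : Measurable Φ) :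
    Measurable fun v => ∫⁻ w in Set.Iic v, hawkesPsi Φ w := by
  have hΨ := measurable_hawkesPsi hΦ
  exact measurable_setLIntegral_of_ge (g := fun _ w => hawkesPsi Φ w)
    (by simp only [Function.uncurry_def]; fun_prop)

/-- Splitting the dual function into its two summands gives the single and the double integral; `min
s u` combines `v < s` with `v < u`. -/
theorem setLIntegral_hawkesDual_delayKernel_mul (hΦ : Measurable Φ) (hζ : Measurable ζ)
    (hW : Measurable W) (hst : s ≤ t) :
    ∫⁻ v in Set.Iio s, hawkesDual Φ (delayKernel ζ t) v * W v
      = (∫⁻ v in Set.Iic s, ζ (t - v) * W v)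
        + ∫⁻ u in Set.Iic t, ∫⁻ v in Set.Iic (min s u),
            ζ (t - u) * hawkesPsi Φ (u - v) * W v := by
  have hΨ := measurable_hawkesPsi hΦ
  have hk := measurable_delayKernel hζ t
  have h1 : ∀ v ∈ Set.Iio s, hawkesDual Φ (delayKernel ζ t) v * W v
      = ζ (t - v) * W v
        + ∫⁻ u in Set.Ioi v, delayKernel ζ t u * hawkesPsi Φ (u - v) * W v := fun v hv => by
    rw [hawkesDual, add_mul, lintegral_mul_const _ (by fun_prop), delayKernel,
      Set.indicator_of_mem (show v ∈ Set.Iio t from lt_of_lt_of_le hv hst)]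
  rw [setLIntegral_congr_fun measurableSet_Iio h1, lintegral_add_left (by fun_prop),
    setLIntegral_Iio_eq_Iic,
    lintegral_Ioi_swap (g := fun v u => delayKernel ζ t u * hawkesPsi Φ (u - v) * W v)
      (by simp only [Function.uncurry_def]; fun_prop),
    ← setLIntegral_Iio_eq_Iic _ t, ← lintegral_indicator measurableSet_Iio]
  congr 1
  refine lintegral_congr fun u => ?_
  rw [Measure.restrict_restrict measurableSet_Iio, Set.Iio_inter_Iio, setLIntegral_Iio_eq_Iic,
    min_comm]
  by_cases hu : u ∈ Set.Iio t <;> simp [delayKernel, hu]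

theorem lintegral_indicator_mul_hawkesDual_mul (hΦ : Measurable Φ) (hζ : Measurable ζ)
    {F l : ℝ≥0 → ℝ≥0∞} (hF : Measurable F) (hl : Measurable l) (hst : s ≤ t) :
    ∫⁻ v, (Set.Iio s).indicator F v * hawkesDual Φ (delayKernel ζ t) v * l v
      = (∫⁻ v in Set.Iic s, ζ (t - v) * F v * l v)
        + ∫⁻ u in Set.Iic t, ∫⁻ v in Set.Iic (min s u),
            ζ (t - u) * hawkesPsi Φ (u - v) * F v * l v := by
  have h := setLIntegral_hawkesDual_delayKernel_mul hΦ hζ (hF.mul hl) hst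
  simp only [Pi.mul_apply, ← mul_assoc] at h
  rw [← h, ← lintegral_indicator measurableSet_Iio]
  refine lintegral_congr fun v => ?_
  by_cases hv : v ∈ Set.Iio s
  · simp only [Set.indicator_of_mem hv, mul_comm (F v)]
  · simp only [Set.indicator_of_notMem hv, zero_mul]

theorem lintegral_hawkesDual_delayKernel_self (hΦ : Measurable Φ) (s : ℝ≥0) :
    ∫⁻ v, hawkesDual Φ (delayKernel Φ s) v = ∫⁻ u in Set.Iic s, hawkesPsi Φ u := by
  rw [hawkesDual_delayKernel_self hΦ, lintegral_indicator measurableSet_Iio,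
    setLIntegral_Iio_eq_Iic, setLIntegral_Iic_reflect (measurable_hawkesPsi hΦ)]

theorem lintegral_hawkesDual_delayKernel_one (hΦ : Measurable Φ) (s : ℝ≥0) :
    ∫⁻ v, hawkesDual Φ (delayKernel (fun _ => 1) s) v
      = s + ∫⁻ u in Set.Iic s, ∫⁻ r in Set.Iic u, hawkesPsi Φ r := by
  have h : ∀ v, delayKernel (fun _ => 1) s v * (1 + ∫⁻ w in Set.Iic v, hawkesPsi Φ w)
      = (Set.Iio s).indicator (fun v => 1 + ∫⁻ w in Set.Iic v, hawkesPsi Φ w) v := fun v => by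
    by_cases hv : v ∈ Set.Iio s <;> simp [delayKernel, hv]
  rw [lintegral_hawkesDual hΦ (measurable_delayKernel measurable_const s), lintegral_congr h,
    lintegral_indicator measurableSet_Iio, setLIntegral_Iio_eq_Iic,
    lintegral_add_left measurable_const, setLIntegral_one, volume_nnreal_Iic]

theorem one_add_setLIntegral_hawkesPsi_le (v : ℝ≥0) :
    1 + ∫⁻ w in Set.Iic v, hawkesPsi Φ w ≤ 1 + ∫⁻ w, hawkesPsi Φ w :=
  add_le_add_right (setLIntegral_le_lintegral _ _) _

theorem lintegral_hawkesDual_delayKernel_self_lt_top (hΦ : Measurable Φ)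
    (h1 : ∫⁻ u, (Φ u : ℝ≥0∞) < 1) (s : ℝ≥0) :
    ∫⁻ v, hawkesDual Φ (delayKernel Φ s) v < ∞ := by
  rw [lintegral_hawkesDual_delayKernel_self hΦ]
  exact (setLIntegral_le_lintegral _ _).trans_lt (lintegral_hawkesPsi_lt_top hΦ h1)

theorem lintegral_hawkesDual_delayKernel_one_lt_top (hΦ : Measurable Φ)
    (h1 : ∫⁻ u, (Φ u : ℝ≥0∞) < 1) (s : ℝ≥0) :
    ∫⁻ v, hawkesDual Φ (delayKernel (fun _ => 1) s) v < ∞ := by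
  rw [lintegral_hawkesDual_delayKernel_one hΦ]
  refine ENNReal.add_lt_top.2 ⟨ENNReal.coe_lt_top, ?_⟩
  calc ∫⁻ u in Set.Iic s, ∫⁻ r in Set.Iic u, hawkesPsi Φ r
      ≤ ∫⁻ _ in Set.Iic s, ∫⁻ r, hawkesPsi Φ r :=
        lintegral_mono fun u => setLIntegral_le_lintegral _ _
    _ < ∞ := by
        rw [setLIntegral_const, volume_nnreal_Iic]
        exact ENNReal.mul_lt_top (lintegral_hawkesPsi_lt_top hΦ h1) ENNReal.coe_lt_top

theorem hawkesDual_delayKernel_one_le (hΦ : Measurable Φ) (s v : ℝ≥0) :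
    hawkesDual Φ (delayKernel (fun _ => 1) s) v ≤ 1 + ∫⁻ u, hawkesPsi Φ u := by
  have h := hawkesDual_le (f := delayKernel (fun _ => 1) s) (c := 1) hΦ
    (fun u => Set.indicator_apply_le' (fun _ => by simp) fun _ => zero_le) v
  rwa [one_mul] at h

/-- Cauchy–Schwarz with a lossy constant: write the square as a double integral and use φ(x)φ(y) ≤
φ(x)² + φ(y)². Only finiteness is at stake. -/
theorem ENNReal.sq_lintegral_mul_le {α : Type*} [MeasurableSpace α] {ν : Measure α}
    {φ ψ : α → ℝ≥0∞} (hφ : Measurable φ) (hψ : Measurable ψ) :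
    (∫⁻ x, φ x * ψ x ∂ν) ^ 2 ≤ 2 * ((∫⁻ x, φ x ^ 2 * ψ x ∂ν) * ∫⁻ x, ψ x ∂ν) := by
  have hφψ : Measurable fun x => φ x * ψ x := hφ.mul hψ
  have hφ2 : Measurable fun x => φ x ^ 2 * ψ x := (hφ.pow_const 2).mul hψ
  calc (∫⁻ x, φ x * ψ x ∂ν) ^ 2
      = ∫⁻ x, (∫⁻ y, φ x * ψ x * (φ y * ψ y) ∂ν) ∂ν := by
        simp_rw [lintegral_const_mul _ hφψ]
        rw [lintegral_mul_const _ hφψ, sq]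
    _ ≤ ∫⁻ x, (∫⁻ y, (φ x ^ 2 * ψ x * ψ y + ψ x * (φ y ^ 2 * ψ y)) ∂ν) ∂ν := by
        refine lintegral_mono fun x => lintegral_mono fun y => ?_
        calc φ x * ψ x * (φ y * ψ y) = φ x * φ y * (ψ x * ψ y) := by ring
          _ ≤ (φ x ^ 2 + φ y ^ 2) * (ψ x * ψ y) :=
              mul_le_mul_left (ENNReal.mul_le_sq_add_sq _ _) _
          _ = φ x ^ 2 * ψ x * ψ y + ψ x * (φ y ^ 2 * ψ y) := by ring
    _ = 2 * ((∫⁻ x, φ x ^ 2 * ψ x ∂ν) * ∫⁻ x, ψ x ∂ν) := by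
        have h : ∀ x, ∫⁻ y, (φ x ^ 2 * ψ x * ψ y + ψ x * (φ y ^ 2 * ψ y)) ∂ν
            = φ x ^ 2 * ψ x * (∫⁻ y, ψ y ∂ν) + ψ x * ∫⁻ y, φ y ^ 2 * ψ y ∂ν := fun x => by
          rw [lintegral_add_left (hψ.const_mul _), lintegral_const_mul _ hψ,
            lintegral_const_mul _ hφ2]
        simp_rw [h]
        rw [lintegral_add_left (hφ2.mul_const _), lintegral_mul_const _ hφ2,
          lintegral_mul_const _ hψ]
        ring

/-- The resolvent is locally square integrable when the kernel is. -/
theorem setLIntegral_hawkesPsi_sq_lt_top (hΦ : Measurable Φ) (h1 : ∫⁻ u, (Φ u : ℝ≥0∞) < 1)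
    (h2 : ∫⁻ u in Set.Iic t, (Φ u : ℝ≥0∞) ^ 2 < ∞) :
    ∫⁻ u in Set.Iic t, hawkesPsi Φ u ^ 2 < ∞ := by
  have hΨ := measurable_hawkesPsi hΦ
  have hL := lintegral_hawkesPsi_lt_top hΦ h1
  -- Cutting Φ² off at `t` makes it integrable on the half-line and changes nothing for `u ≤ t`, so
  -- its convolution with Ψ has finite mass.
  set g : ℝ≥0 → ℝ≥0∞ := (Set.Iic t).indicator fun u => (Φ u : ℝ≥0∞) ^ 2 with hg
  have mg : Measurable g := Measurable.indicator (by fun_prop) measurableSet_Iic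
  -- With Ψ = a + b, the 3 comes from (a + b)² ≤ 3a² + 3b², and 6 = 3 · 2 uses the constant of the
  -- Cauchy–Schwarz bound on b².
  have hle : ∀ u ∈ Set.Iic t, hawkesPsi Φ u ^ 2 ≤ 3 * (Φ u : ℝ≥0∞) ^ 2
      + 6 * (∫⁻ r, hawkesPsi Φ r) * ∫⁻ r in Set.Iic u, g (u - r) * hawkesPsi Φ r := by
    intro u hu
    have hCS := ENNReal.sq_lintegral_mul_le (ν := (volume : Measure ℝ≥0).restrict (Set.Iic u))
      (φ := fun r => (Φ (u - r) : ℝ≥0∞)) (ψ := hawkesPsi Φ) (by fun_prop) hΨ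
    have hgu : ∫⁻ r in Set.Iic u, (Φ (u - r) : ℝ≥0∞) ^ 2 * hawkesPsi Φ r
        = ∫⁻ r in Set.Iic u, g (u - r) * hawkesPsi Φ r :=
      lintegral_congr fun r => by
        rw [hg, Set.indicator_of_mem (show u - r ∈ Set.Iic t from
          (tsub_le_self : u - r ≤ u).trans hu)]
    rw [hgu] at hCS
    have hCS' := hCS.trans (mul_le_mul_right (mul_le_mul_right
      (setLIntegral_le_lintegral (Set.Iic u) (hawkesPsi Φ)) _) 2)
    rw [hawkesPsi_eq hΦ u]
    set a : ℝ≥0∞ := (Φ u : ℝ≥0∞)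
    set b := ∫⁻ r in Set.Iic u, (Φ (u - r) : ℝ≥0∞) * hawkesPsi Φ r
    set c := ∫⁻ r in Set.Iic u, g (u - r) * hawkesPsi Φ r
    set L := ∫⁻ r, hawkesPsi Φ r
    calc (a + b) ^ 2 = a ^ 2 + b ^ 2 + 2 * (a * b) := by ring
      _ ≤ a ^ 2 + b ^ 2 + 2 * (a ^ 2 + b ^ 2) := by
          gcongr; exact ENNReal.mul_le_sq_add_sq a b
      _ = 3 * a ^ 2 + 3 * b ^ 2 := by ring
      _ ≤ 3 * a ^ 2 + 3 * (2 * (c * L)) := by gcongr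
      _ = 3 * a ^ 2 + 6 * L * c := by ring
  have mc : Measurable fun u => ∫⁻ r in Set.Iic u, g (u - r) * hawkesPsi Φ r :=
    measurable_setLIntegral_of_ge (g := fun u r => g (u - r) * hawkesPsi Φ r)
      (by simp only [Function.uncurry_def]; fun_prop)
  have hc : ∫⁻ u in Set.Iic t, (∫⁻ r in Set.Iic u, g (u - r) * hawkesPsi Φ r) < ∞ := by
    refine (setLIntegral_le_lintegral _ _).trans_lt ?_
    rw [lintegral_convolution mg hΨ, lintegral_indicator measurableSet_Iic]
    exact ENNReal.mul_lt_top h2 hL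
  refine (setLIntegral_mono (by fun_prop) hle).trans_lt ?_
  rw [lintegral_add_left (by fun_prop), lintegral_const_mul _ (by fun_prop),
    lintegral_const_mul _ mc]
  exact ENNReal.add_lt_top.2 ⟨ENNReal.mul_lt_top (by simp) h2,
    ENNReal.mul_lt_top (ENNReal.mul_lt_top (by simp) hL) hc⟩

theorem lintegral_hawkesDual_delayKernel_self_sq (hΦ : Measurable Φ) (s : ℝ≥0) :
    ∫⁻ v, hawkesDual Φ (delayKernel Φ s) v ^ 2 = ∫⁻ u in Set.Iic s, hawkesPsi Φ u ^ 2 := by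
  rw [hawkesDual_delayKernel_self hΦ, ← setLIntegral_Iic_reflect
    ((measurable_hawkesPsi hΦ).pow_const 2), ← setLIntegral_Iio_eq_Iic,
    ← lintegral_indicator measurableSet_Iio]
  refine lintegral_congr fun v => ?_
  by_cases hv : v ∈ Set.Iio s <;> simp [hv]

end DelayKernel

/-! ### Moments of the Hawkes process -/

section Hawkes

variable {Ω : Type*} {mΩ : MeasurableSpace Ω} {P : Measure Ω} {G : Filtration ℝ≥0 mΩ}
  {N : Ω → Measure (ℝ≥0 × ℝ≥0)} {μ : ℝ≥0} {Φ ζ : ℝ≥0 → ℝ≥0} {lam : ℝ≥0 → Ω → ℝ≥0}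

/-- The defining integral excludes time 0 and the delay kernel does not; the absence of points at 0
reconciles them. -/
theorem hawkesX_eq_lintegral_thinnedMeasure
    (hlam : Measurable[G.predictable] fun p : ℝ≥0 × Ω => lam p.1 p.2) (hζ : Measurable ζ) {ω : Ω}
    (h0 : N ω ({0} ×ˢ Set.univ) = 0) (t : ℝ≥0) :
    hawkesX N lam ζ t ω = ∫⁻ u, delayKernel ζ t u ∂thinnedMeasure N lam ω := by
  rw [lintegral_thinnedMeasure (measurable_delayKernel hζ t),
    ← lintegral_indicator (measurableSet_le_intensity hlam ω), hawkesX,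
    ← lintegral_indicator (measurableSet_Ioo.prod MeasurableSet.univ)]
  have hae : ∀ᵐ x ∂N ω, x ∉ ({0} ×ˢ Set.univ : Set (ℝ≥0 × ℝ≥0)) := measure_eq_zero_iff_ae_notMem.1 h0
  refine lintegral_congr_ae (hae.mono fun x hx => ?_)
  have hx0 : 0 < x.1 := pos_iff_ne_zero.2 fun h => hx ⟨h, trivial⟩
  by_cases h1 : x.1 < t <;> by_cases h2 : x.2 ≤ lam x.1 ω <;>
    simp [Set.indicator, delayKernel, h1, h2, hx0]

theorem thinnedMeasure_Iio_le_hawkesH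
    (hlam : Measurable[G.predictable] fun p : ℝ≥0 × Ω => lam p.1 p.2) {ω : Ω}
    (h0 : N ω ({0} ×ˢ Set.univ) = 0) (t : ℝ≥0) :
    thinnedMeasure N lam ω (Set.Iio t) ≤ hawkesH N lam t ω := by
  have h := hawkesX_eq_lintegral_thinnedMeasure hlam (ζ := fun _ => 1) measurable_const h0 t
  simp only [delayKernel, ENNReal.coe_one] at h
  rw [lintegral_indicator measurableSet_Iio, setLIntegral_one] at h
  rw [← h, hawkesX, hawkesH]
  simp only [ENNReal.coe_one]
  exact lintegral_mono_set (Set.prod_mono_left Set.Ioo_subset_Ioc_self)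

/-- Passing to the regular version affects the equation only on a null set, and predictability
survives because the new filtration is larger. -/
theorem IsHawkesIntensity.exists_isHawkesCounting [IsProbabilityMeasure P]
    (hN : IsPoissonRandomMeasure P N) (hΦ : Measurable Φ) (hΦ1 : ∫⁻ u, (Φ u : ℝ≥0∞) < 1)
    (hlam : IsHawkesIntensity P N hN.measurable μ Φ lam) :
    ∃ (G : Filtration ℝ≥0 mΩ) (N' : Ω → Measure (ℝ≥0 × ℝ≥0)),
      IsHawkesCounting P G N' μ Φ lam ∧ N' =ᵐ[P] N := by
  obtain ⟨G, N', hN', hae, hG⟩ := hN.exists_isSimplePoissonMeasure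
  have hpred : Measurable[G.predictable] fun p : ℝ≥0 × Ω => lam p.1 p.2 :=
    hlam.predictable.mono (predictable_mono hG) le_rfl
  refine ⟨G, N', ⟨hN', hpred, hΦ, hΦ1, ?_, ?_⟩, hae⟩
  · filter_upwards [hae, hlam.solves] with ω hω hsol u
    have hX : hawkesX N lam Φ u ω = hawkesX N' lam Φ u ω := by simp only [hawkesX, hω]
    rw [hsol u, hX, hawkesX_eq_lintegral_thinnedMeasure hpred hΦ (hN'.zero ω)]
    simp only [delayKernel]
    rw [lintegral_indicator measurableSet_Iio]
  · filter_upwards [hae, hlam.counting] with ω hω hcount u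
    have hH : hawkesH N lam u ω = hawkesH N' lam u ω := by simp only [hawkesH, hω]
    exact (thinnedMeasure_Iio_le_hawkesH hpred (hN'.zero ω) u).trans_lt (hH ▸ hcount u)

theorem IsHawkesCounting.hawkesX_ae_eq (hk : IsHawkesCounting P G N μ Φ lam)
    {N' : Ω → Measure (ℝ≥0 × ℝ≥0)} (hae : N =ᵐ[P] N') (hζ : Measurable ζ) (t : ℝ≥0) :
    hawkesX N' lam ζ t =ᵐ[P] thinnedIntegral N lam ∞ (delayKernel ζ t) := by
  filter_upwards [hae] with ω hω
  have hX : hawkesX N' lam ζ t ω = hawkesX N lam ζ t ω := by simp only [hawkesX, hω]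
  rw [hX, hawkesX_eq_lintegral_thinnedMeasure hk.predictable hζ (hk.poisson.zero ω),
    thinnedIntegral, thinnedHorizon_top, setLIntegral_univ]

end Hawkes
-- The moment formulas
theorem theorem2 {Ω : Type*} [MeasurableSpace Ω] (P : Measure Ω) [IsProbabilityMeasure P]
    (N : Ω → Measure (ℝ≥0 × ℝ≥0)) (hN : IsPoissonRandomMeasure P N)
    (μ : ℝ≥0) (hμ : 0 < μ)
    (Φ : ℝ≥0 → ℝ≥0) (hΦ : Measurable Φ) (hΦ1 : ∫⁻ u, (Φ u : ℝ≥0∞) < 1)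
    (lam : ℝ≥0 → Ω → ℝ≥0) (hlam : IsHawkesIntensity P N hN.measurable μ Φ lam) :
    -- Part (i)
    (∀ s : ℝ≥0,
      (∫⁻ ω, hawkesX N lam (fun _ => 1) s ω ∂P
          = μ * s + μ * ∫⁻ u in Set.Iic s, ∫⁻ r in Set.Iic u, hawkesPsi Φ r) ∧
      (∫⁻ ω, hawkesX N lam Φ s ω ∂P = μ * ∫⁻ u in Set.Iic s, hawkesPsi Φ u) ∧
      ∫⁻ ω, hawkesX N lam (fun _ => 1) s ω ∂P < ∞ ∧
      ∫⁻ ω, hawkesX N lam Φ s ω ∂P < ∞) ∧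
    -- Part (ii)
    (∀ ζ : ℝ≥0 → ℝ≥0, (ζ = Φ ∨ ζ = fun _ => 1) → ∀ s t : ℝ≥0, s ≤ t →
      (∫⁻ ω, hawkesX N lam Φ s ω * hawkesX N lam ζ t ω ∂P
        = (∫⁻ ω, hawkesX N lam Φ s ω ∂P) * (∫⁻ ω, hawkesX N lam ζ t ω ∂P)
          + μ * (∫⁻ v in Set.Iic s, ζ (t - v) * hawkesPsi Φ (s - v)
              * (1 + ∫⁻ w in Set.Iic v, hawkesPsi Φ w))
          + μ * (∫⁻ u in Set.Iic t, ∫⁻ v in Set.Iic (min s u),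
              ζ (t - u) * hawkesPsi Φ (u - v) * hawkesPsi Φ (s - v)
              * (1 + ∫⁻ w in Set.Iic v, hawkesPsi Φ (v - w)))) ∧
      (∫⁻ ω, hawkesX N lam (fun _ => 1) s ω * hawkesX N lam ζ t ω ∂P
        = (∫⁻ ω, hawkesX N lam (fun _ => 1) s ω ∂P) * (∫⁻ ω, hawkesX N lam ζ t ω ∂P)
          + μ * (∫⁻ u in Set.Iic s, ζ (t - u)
              * (1 + ∫⁻ y in Set.Icc u s, hawkesPsi Φ (y - u))
              * (1 + ∫⁻ w in Set.Iic u, hawkesPsi Φ w))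
          + μ * (∫⁻ u in Set.Iic t, ∫⁻ v in Set.Iic (min s u),
              ζ (t - u) * hawkesPsi Φ (u - v)
              * (1 + ∫⁻ w in Set.Iic v, hawkesPsi Φ w)
              * (1 + ∫⁻ y in Set.Icc v s, hawkesPsi Φ (y - v)))) ∧
      ((ζ = fun _ => 1) ∨ ∫⁻ u in Set.Iic t, (Φ u : ℝ≥0∞) ^ 2 < ∞ →
        ∫⁻ ω, hawkesX N lam Φ s ω * hawkesX N lam ζ t ω ∂P < ∞) ∧
      ∫⁻ ω, hawkesX N lam (fun _ => 1) s ω * hawkesX N lam ζ t ω ∂P < ∞) := by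
  obtain ⟨G, N', hk, hae⟩ := hlam.exists_isHawkesCounting hN hΦ hΦ1
  have hone : Measurable fun _ : ℝ≥0 => (1 : ℝ≥0) := measurable_const
  have hΨ := measurable_hawkesPsi hΦ
  have hℓ : Measurable fun v => 1 + ∫⁻ w in Set.Iic v, hawkesPsi Φ w :=
    measurable_const.add (measurable_setLIntegral_hawkesPsi_Iic hΦ)
  have hL : 1 + ∫⁻ w, hawkesPsi Φ w < ∞ :=
    ENNReal.add_lt_top.2 ⟨by simp, lintegral_hawkesPsi_lt_top hΦ hΦ1⟩
  have hfirst : ∀ {ζ : ℝ≥0 → ℝ≥0}, Measurable ζ → ∀ s, ∫⁻ ω, hawkesX N lam ζ s ω ∂P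
      = μ * ∫⁻ v, hawkesDual Φ (delayKernel ζ s) v := fun {ζ} hζ s => by
    rw [lintegral_congr_ae (hk.hawkesX_ae_eq hae hζ s),
      hk.lintegral_thinnedIntegral_top (measurable_delayKernel hζ s),
      lintegral_hawkesDual hΦ (measurable_delayKernel hζ s)]
  have hsecond : ∀ {ξ ζ : ℝ≥0 → ℝ≥0}, Measurable ξ → Measurable ζ → ∀ s t,
      ∫⁻ ω, hawkesX N lam ξ s ω * hawkesX N lam ζ t ω ∂P
        = (∫⁻ ω, hawkesX N lam ξ s ω ∂P) * (∫⁻ ω, hawkesX N lam ζ t ω ∂P)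
          + μ * ∫⁻ v, hawkesDual Φ (delayKernel ξ s) v * hawkesDual Φ (delayKernel ζ t) v
            * (1 + ∫⁻ w in Set.Iic v, hawkesPsi Φ w) := fun {ξ ζ} hξ hζ s t => by
    have h1 := hk.hawkesX_ae_eq hae hξ s
    have h2 := hk.hawkesX_ae_eq hae hζ t
    rw [lintegral_congr_ae h1, lintegral_congr_ae h2]
    refine (lintegral_congr_ae (h1.mul h2)).trans ?_
    exact hk.lintegral_thinnedIntegral_mul (measurable_delayKernel hξ s)
      (measurable_delayKernel hζ t)
  have hfin1 : ∀ s, ∫⁻ ω, hawkesX N lam (fun _ => 1) s ω ∂P < ∞ := fun s => by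
    rw [hfirst hone]
    exact ENNReal.mul_lt_top ENNReal.coe_lt_top
      (lintegral_hawkesDual_delayKernel_one_lt_top hΦ hΦ1 s)
  have hfinΦ : ∀ s, ∫⁻ ω, hawkesX N lam Φ s ω ∂P < ∞ := fun s => by
    rw [hfirst hΦ]
    exact ENNReal.mul_lt_top ENNReal.coe_lt_top
      (lintegral_hawkesDual_delayKernel_self_lt_top hΦ hΦ1 s)
  -- The dual of the constant kernel is bounded by 1 + ∫ Ψ, so integrability of the other dual is
  -- enough.
  have hbdd : ∀ {ζ : ℝ≥0 → ℝ≥0}, Measurable ζ → ∀ s t,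
      ∫⁻ v, hawkesDual Φ (delayKernel ζ t) v < ∞ →
      ∫⁻ v, hawkesDual Φ (delayKernel (fun _ => 1) s) v * hawkesDual Φ (delayKernel ζ t) v
        * (1 + ∫⁻ w in Set.Iic v, hawkesPsi Φ w) < ∞ := fun {ζ} hζ s t h => by
    have hd := measurable_hawkesDual hΦ (measurable_delayKernel hζ t)
    calc ∫⁻ v, hawkesDual Φ (delayKernel (fun _ => 1) s) v * hawkesDual Φ (delayKernel ζ t) v
          * (1 + ∫⁻ w in Set.Iic v, hawkesPsi Φ w)
        ≤ ∫⁻ v, (1 + ∫⁻ w, hawkesPsi Φ w) * hawkesDual Φ (delayKernel ζ t) v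
          * (1 + ∫⁻ w, hawkesPsi Φ w) := lintegral_mono fun v =>
            mul_le_mul' (mul_le_mul' (hawkesDual_delayKernel_one_le hΦ s v) le_rfl)
              (one_add_setLIntegral_hawkesPsi_le v)
      _ < ∞ := by
          rw [lintegral_mul_const _ (hd.const_mul _), lintegral_const_mul _ hd]
          exact ENNReal.mul_lt_top (ENNReal.mul_lt_top hL h) hL
  refine ⟨fun s => ⟨?_, ?_, hfin1 s, hfinΦ s⟩, fun ζ hζ s t hst => ?_⟩
  · rw [hfirst hone, lintegral_hawkesDual_delayKernel_one hΦ, mul_add]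
  · rw [hfirst hΦ, lintegral_hawkesDual_delayKernel_self hΦ]
  have mζ : Measurable ζ := by rcases hζ with rfl | rfl <;> assumption
  have hfinζ : ∫⁻ v, hawkesDual Φ (delayKernel ζ t) v < ∞ := by
    rcases hζ with rfl | rfl
    · exact lintegral_hawkesDual_delayKernel_self_lt_top hΦ hΦ1 t
    · exact lintegral_hawkesDual_delayKernel_one_lt_top hΦ hΦ1 t
  have hEζ : ∫⁻ ω, hawkesX N lam ζ t ω ∂P < ∞ := by
    rw [hfirst mζ]
    exact ENNReal.mul_lt_top ENNReal.coe_lt_top hfinζ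
  refine ⟨?_, ?_, fun h => ?_, ?_⟩
  · rw [hsecond hΦ mζ, hawkesDual_delayKernel_self hΦ,
      lintegral_indicator_mul_hawkesDual_mul hΦ mζ (by fun_prop) hℓ hst, mul_add, ← add_assoc]
    -- Reconciles ∫_0^v Ψ(v-w) dw in the statement with ∫_0^v Ψ(w) dw.
    simp_rw [setLIntegral_Iic_reflect hΨ]
  · have hJ : Measurable fun v => 1 + ∫⁻ y in Set.Icc v s, hawkesPsi Φ (y - v) :=
      measurable_const.add (measurable_setLIntegral_hawkesPsi_Icc hΦ s)
    rw [hsecond hone mζ, hawkesDual_delayKernel_one,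
      lintegral_indicator_mul_hawkesDual_mul hΦ mζ hJ hℓ hst, mul_add, ← add_assoc]
    congr 2
    exact lintegral_congr fun u => lintegral_congr fun v => mul_right_comm _ _ _
  · rw [hsecond hΦ mζ]
    refine ENNReal.add_lt_top.2 ⟨ENNReal.mul_lt_top (hfinΦ s) hEζ,
      ENNReal.mul_lt_top ENNReal.coe_lt_top ?_⟩
    by_cases hζ1 : ζ = fun _ => 1
    · subst hζ1
      -- Exchanging the factors, and with them the roles of `s` and `t`, puts the constant kernel
      -- first.
      simp_rw [mul_comm (hawkesDual Φ (delayKernel Φ s) _)]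
      exact hbdd hΦ t s (lintegral_hawkesDual_delayKernel_self_lt_top hΦ hΦ1 s)
    · obtain rfl : ζ = Φ := hζ.resolve_right hζ1
      -- Neither dual need be bounded here, so the product is controlled by the squares, that is by
      -- local square integrability of Ψ.
      have hsq := setLIntegral_hawkesPsi_sq_lt_top hΦ hΦ1 (h.resolve_left hζ1)
      have hd := fun r => measurable_hawkesDual hΦ (measurable_delayKernel hΦ r)
      calc ∫⁻ v, hawkesDual ζ (delayKernel ζ s) v * hawkesDual ζ (delayKernel ζ t) v
            * (1 + ∫⁻ w in Set.Iic v, hawkesPsi ζ w)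
          ≤ ∫⁻ v, (hawkesDual ζ (delayKernel ζ s) v ^ 2 + hawkesDual ζ (delayKernel ζ t) v ^ 2)
            * (1 + ∫⁻ w, hawkesPsi ζ w) := lintegral_mono fun v =>
              mul_le_mul' (ENNReal.mul_le_sq_add_sq _ _) (one_add_setLIntegral_hawkesPsi_le v)
        _ < ∞ := by
            rw [lintegral_mul_const' _ _ hL.ne, lintegral_add_left ((hd s).pow_const 2),
              lintegral_hawkesDual_delayKernel_self_sq hΦ,
              lintegral_hawkesDual_delayKernel_self_sq hΦ]
            exact ENNReal.mul_lt_top (ENNReal.add_lt_top.2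
              ⟨(lintegral_mono_set (Set.Iic_subset_Iic.2 hst)).trans_lt hsq, hsq⟩) hL
  · rw [hsecond hone mζ]
    exact ENNReal.add_lt_top.2 ⟨ENNReal.mul_lt_top (hfin1 s) hEζ,
      ENNReal.mul_lt_top ENNReal.coe_lt_top (hbdd mζ s t hfinζ)⟩
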